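/- Let $M\ge 1$ and $d,m,T\ge 0$ be integers. Consider a jump Gauss–Markov system: a Markov chain $z_t$ in $\{1,\dots,M\}$ with initial law $\lambda_0$ and transition probabilities $\lambda_{t\mid t-1}(z_t\mid z_{t-1})$ (which may vanish), a hidden state $x_t\in\mathbb R^d$ and an observation $y_t\in\mathbb R^m$ with $$x_0\mid z_0\sim \mathcal N(\mu_0(z_0),\Sigma_0(z_0)),\qquad x_t\mid x_{t-1},z_{t-1}\sim\mathcal N(\Phi_t(z_{t-1})x_{t-1}+u_t(z_{t-1}),\,Q_t(z_{t-1})),$$ $$y_t\mid x_t,z_t\sim\mathcal N(C_t(z_t)x_t+b_t(z_t),\,R_t(z_t)),$$ all covariance matrices being positive definite. Write $h_t(y_t\mid x_t,z_t)$ for the density of $y_t$ given $(x_t,z_t)$. Fix observations $y_0,\dots,y_T$ and put $$\gamma_0(x_0,z_0)=h_0(y_0\mid x_0,z_0)\,\lambda_0(z_0)\,\mathcal N(x_0;\mu_0(z_0),\Sigma_0(z_0)),$$ $$\gamma_{t\mid t-1}(x_t,z_t\mid x_{t-1},z_{t-1})=h_t(y_t\mid x_t,z_t)\,\lambda_{t\mid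 t-1}(z_t\mid z_{t-1})\,\mathcal N(x_t;\Phi_t(z_{t-1})x_{t-1}+u_t(z_{t-1}),Q_t(z_{t-1})),$$ and $\gamma_{0:t}=\gamma_0\prod_{s=1}^t\gamma_{s\mid s-1}$. The variational family consists of the densities $\pi_{0:T}(x_{0:T},z_{0:T})=f_{0:T}(z_{0:T})\,g_{0:T}(x_{0:T})$ in which $f_{0:T}$ is the law of a Markov chain on $\{1,\dots,M\}$ and $g_{0:T}$ is the density of a Markov process on $\mathbb R^d$. Both are given by their reverse-time factorizations $$f_{0:T}=f_T\prod_{t=1}^T f_{t-1\mid t},\qquad g_{0:T}=g_T\prod_{t=1}^T g_{t-1\mid t};$$ put $\pi_{t-1\mid t}=f_{t-1\mid t}\,g_{t-1\mid t}$, and let $\pi_t=f_tg_t$ be the time-marginals. A variational posterior is a member of the family that maximizes $\int\log\{\gamma_{0:T}/\pi_{0:T}\}\,d\pi_{0:T}$ over the family. The forward value functional at time $t$ is $$V_t(\pi_t)=\max_{\pi_{0:t-1\mid t}}\int\Big(\int\log\frac{\gamma_{0:t}}{\pi_{0:t-1\mid t}}\,d\pi_{0:t-1\mid t}\Big)d\pi_t,$$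 where the maximum is over products $\pi_{0:t-1\mid t}=\prod_{s=1}^{t}\pi_{s-1\mid s}$ of reverse-time kernels of the family, and $V_0(\pi_0)=\int\log\gamma_0\,d\pi_0$. Its representer along the reverse-time kernels of a member $\pi_{0:T}$ of the family is given by $\alpha_0=\gamma_0$ and $$\log\alpha_t(x_t,z_t)=\sum_{z_{t-1}}\int\log\Big\{\frac{\gamma_{t\mid t-1}(x_t,z_t\mid x_{t-1},z_{t-1})\,\alpha_{t-1}(x_{t-1},z_{t-1})}{\pi_{t-1\mid t}(x_{t-1},z_{t-1}\mid x_t,z_t)}\Big\}\,\pi_{t-1\mid t}(x_{t-1},z_{t-1}\mid x_t,z_t)\,dx_{t-1}.$$ Here $\log 0=-\infty$, and expectations of logarithms are extended-real valued. **Theorem.** A variational posterior exists. Let $\pi_{0:T}=f_{0:T}\,g_{0:T}$ be any variational posterior and let $\alpha_t$ be the representer along its reverse-time kernels. Then, for every $0\le t\le T$: 1. there are $\kappa_t>0$, a probability mass function $f^\star_t$ on $\{1,\dots,M\}$, vectors $\mu^\star_t(z)\in\mathbb R^d$ and positive definite matrices $\Sigma^\star_t(z)$ such that, for almost every $x\in\mathbb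 R^d$ and all $z$, $$\log\alpha_t(x,z)=\log\kappa_t+\log f^\star_t(z)+\log\mathcal N(x;\mu^\star_t(z),\Sigma^\star_t(z));$$ 2. the maximum defining $V_t(\pi_t)$ is attained, and $V_t(\pi_t)=\int\log\alpha_t\,d\pi_t$. Moreover, the optimal continuous factor $g_{0:T}$ is Gauss–Markov: up to a null set it is the density $\mathcal N(x_T;m,S)\prod_{t=1}^T\mathcal N(x_{t-1};A_tx_t+a_t,P_t)$ of a linear Gaussian Markov chain (in reverse time), with positive definite covariances $S,P_1,\dots,P_T$. -/

import Mathlib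

open MeasureTheory
open scoped ENNReal

noncomputable section

/-- The extended integral `∫ F⁺ dμ - ∫ F⁻ dμ` of an extended-real function. It is `-∞` as soon as
the negative part has infinite integral. -/
def extIntegral {Ω : Type*} [MeasurableSpace Ω] (μ : Measure Ω) (F : Ω → EReal) : EReal :=
  ((∫⁻ ω, (F ω).toENNReal ∂μ : ℝ≥0∞) : EReal) - ((∫⁻ ω, (-F ω).toENNReal ∂μ : ℝ≥0∞) : EReal)

/-- The density `N(x; μ, C)` of the Gaussian law on `ℝ^d` with mean `μ` and covariance `C`. -/
def gaussianDensity {d : ℕ} (μ : Fin d → ℝ) (C : Matrix (Fin d) (Fin d) ℝ) (x : Fin d → ℝ) : ℝ :=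
  (Real.sqrt ((2 * Real.pi) ^ d * C.det))⁻¹ *
    Real.exp (-(1 / 2) * ((x - μ) ⬝ᵥ (C⁻¹.mulVec (x - μ))))

/-- A jump Gauss--Markov system with modes `Fin M`, states in `ℝ^d` and observations in `ℝ^m`.
Fields indexed by `t` and describing a transition concern the step from time `t` to `t + 1`. -/
structure JumpGaussMarkov (M d m : ℕ) where
  /-- law of the initial mode -/
  modeInit : PMF (Fin M)
  /-- `modeTrans t z` is the law of the mode at time `t + 1` given the mode `z` at time `t` -/
  modeTrans : ℕ → Fin M → PMF (Fin M)
  initMean : Fin M → Fin d → ℝ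
  initCov : Fin M → Matrix (Fin d) (Fin d) ℝ
  initCov_posDef : ∀ z, (initCov z).PosDef
  transMat : ℕ → Fin M → Matrix (Fin d) (Fin d) ℝ
  transShift : ℕ → Fin M → Fin d → ℝ
  transCov : ℕ → Fin M → Matrix (Fin d) (Fin d) ℝ
  transCov_posDef : ∀ t z, (transCov t z).PosDef
  obsMat : ℕ → Fin M → Matrix (Fin m) (Fin d) ℝ
  obsShift : ℕ → Fin M → Fin m → ℝ
  obsCov : ℕ → Fin M → Matrix (Fin m) (Fin m) ℝ
  obsCov_posDef : ∀ t z, (obsCov t z).PosDef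

namespace JumpGaussMarkov

variable {M d m : ℕ} (S : JumpGaussMarkov M d m)

/-- Density of the initial state given the initial mode. -/
def stateInit (z : Fin M) (x : Fin d → ℝ) : ℝ :=
  gaussianDensity (S.initMean z) (S.initCov z) x

/-- Density at `x` of the state at time `t + 1`, given state `x'` and mode `z'` at time `t`. -/
def stateTrans (t : ℕ) (x' : Fin d → ℝ) (z' : Fin M) (x : Fin d → ℝ) : ℝ :=
  gaussianDensity ((S.transMat t z').mulVec x' + S.transShift t z') (S.transCov t z') x

/-- Likelihood of the observation `y` at time `t`, given state `x` and mode `z` at time `t`. -/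
def obsLik (t : ℕ) (x : Fin d → ℝ) (z : Fin M) (y : Fin m → ℝ) : ℝ :=
  gaussianDensity ((S.obsMat t z).mulVec x + S.obsShift t z) (S.obsCov t z) y

variable (y : ℕ → Fin m → ℝ)

/-- Unnormalized density of the hidden state at time `0` given the observation at time `0`. -/
def unnormInit (x : Fin d → ℝ) (z : Fin M) : ℝ≥0∞ :=
  ENNReal.ofReal (S.obsLik 0 x z (y 0)) * (S.modeInit z * ENNReal.ofReal (S.stateInit z x))

/-- Unnormalized conditional density at `(x, z)` of the hidden state at time `t + 1`, given the
hidden state `(x', z')` at time `t` and the observation at time `t + 1`. -/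
def unnormTrans (t : ℕ) (x' : Fin d → ℝ) (z' : Fin M) (x : Fin d → ℝ) (z : Fin M) : ℝ≥0∞ :=
  ENNReal.ofReal (S.obsLik (t + 1) x z (y (t + 1))) *
    (S.modeTrans t z' z * ENNReal.ofReal (S.stateTrans t x' z' x))

/-- Unnormalized density of the hidden path up to time `t`, given the observations up to `t`. -/
def unnormPath (t : ℕ) (x : Fin (t + 1) → Fin d → ℝ) (z : Fin (t + 1) → Fin M) : ℝ≥0∞ :=
  S.unnormInit y (x 0) (z 0) *
    ∏ i : Fin t, S.unnormTrans y i (x i.castSucc) (z i.castSucc) (x i.succ) (z i.succ)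

end JumpGaussMarkov

/-- Reverse-time Markov transition kernels of a factored family: `fRev t z` is the law of the mode
at time `t` given the mode `z` at time `t + 1`, and `gRev t x` is the density of the continuous
state at time `t` given the continuous state `x` at time `t + 1`. -/
structure ReverseKernels (M d : ℕ) where
  fRev : ℕ → Fin M → PMF (Fin M)
  gRev : ℕ → (Fin d → ℝ) → (Fin d → ℝ) → ℝ≥0∞
  gRev_measurable : ∀ t, Measurable (Function.uncurry (gRev t))
  gRev_lintegral : ∀ t x, ∫⁻ x', gRev t x x' = 1

namespace ReverseKernels

variable {M d : ℕ} (q : ReverseKernels M d)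

/-- `f_{0:t-1 | t}`, evaluated along a path of modes. -/
def fCond (t : ℕ) (z : Fin (t + 1) → Fin M) : ℝ≥0∞ :=
  ∏ i : Fin t, q.fRev i (z i.succ) (z i.castSucc)

/-- `g_{0:t-1 | t}`, evaluated along a path of continuous states. -/
def gCond (t : ℕ) (x : Fin (t + 1) → Fin d → ℝ) : ℝ≥0∞ :=
  ∏ i : Fin t, q.gRev i (x i.succ) (x i.castSucc)

end ReverseKernels

/-- An element `f_{0:T}(z_{0:T}) g_{0:T}(x_{0:T})` of the factored variational family, both factors
being Markov and given by their reverse-time factorizations: the laws `fLast`, `gLast` at the final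
time together with the reverse-time kernels. -/
structure FactoredDensity (M d : ℕ) extends ReverseKernels M d where
  fLast : PMF (Fin M)
  gLast : (Fin d → ℝ) → ℝ≥0∞
  gLast_measurable : Measurable gLast
  gLast_lintegral : ∫⁻ x, gLast x = 1

namespace FactoredDensity

variable {M d : ℕ} (π : FactoredDensity M d)

/-- The discrete factor `f_{0:T}`. -/
def fPath (T : ℕ) (z : Fin (T + 1) → Fin M) : ℝ≥0∞ :=
  π.fLast (z (Fin.last T)) * π.fCond T z

/-- The continuous factor `g_{0:T}`. -/
def gPath (T : ℕ) (x : Fin (T + 1) → Fin d → ℝ) : ℝ≥0∞ :=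
  π.gLast (x (Fin.last T)) * π.gCond T x

/-- The law of the mode at time `T - k` (for `k ≤ T`). -/
def fMargBack (T : ℕ) : ℕ → Fin M → ℝ≥0∞
  | 0 => fun z => π.fLast z
  | k + 1 => fun z' => ∑ z, π.fRev (T - (k + 1)) z z' * fMargBack T k z

/-- The density of the continuous state at time `T - k` (for `k ≤ T`). -/
def gMargBack (T : ℕ) : ℕ → (Fin d → ℝ) → ℝ≥0∞
  | 0 => π.gLast
  | k + 1 => fun x' => ∫⁻ x, π.gRev (T - (k + 1)) x x' * gMargBack T k x

/-- The time-marginal `f_t` of `f_{0:T}`, for `t ≤ T`. -/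
def fMarg (T t : ℕ) : Fin M → ℝ≥0∞ := π.fMargBack T (T - t)

/-- The time-marginal `g_t` of `g_{0:T}`, for `t ≤ T`. -/
def gMarg (T t : ℕ) : (Fin d → ℝ) → ℝ≥0∞ := π.gMargBack T (T - t)

end FactoredDensity

/-- The measure on the hidden space `ℝ^d × {1, …, M}` with density `g(x) f(z)`. -/
def hiddenMeasure {M d : ℕ} (g : (Fin d → ℝ) → ℝ≥0∞) (f : Fin M → ℝ≥0∞) :
    Measure ((Fin d → ℝ) × Fin M) :=
  ((volume : Measure (Fin d → ℝ)).prod Measure.count).withDensity fun p => g p.1 * f p.2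

/-- The measure on hidden paths up to time `t` with density `g(x_{0:t}) f(z_{0:t})`. -/
def hiddenPathMeasure {M d : ℕ} (t : ℕ) (g : (Fin (t + 1) → Fin d → ℝ) → ℝ≥0∞)
    (f : (Fin (t + 1) → Fin M) → ℝ≥0∞) :
    Measure ((Fin (t + 1) → Fin d → ℝ) × (Fin (t + 1) → Fin M)) :=
  ((volume : Measure (Fin (t + 1) → Fin d → ℝ)).prod Measure.count).withDensity
    fun p => g p.1 * f p.2

section Variational

variable {M d m : ℕ} (S : JumpGaussMarkov M d m) (y : ℕ → Fin m → ℝ)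

/-- The variational (evidence) lower bound `∫ log (γ_{0:T} / π_{0:T}) dπ_{0:T}`. -/
def lowerBound (T : ℕ) (π : FactoredDensity M d) : EReal :=
  extIntegral (hiddenPathMeasure T (π.gPath T) (π.fPath T)) fun p =>
    ENNReal.log (S.unnormPath y T p.1 p.2 / (π.gPath T p.1 * π.fPath T p.2))

/-- `π` is a variational posterior: it maximizes the variational lower bound over the family. -/
def IsVariationalPosterior (T : ℕ) (π : FactoredDensity M d) : Prop :=
  ∀ π' : FactoredDensity M d, lowerBound S y T π' ≤ lowerBound S y T π

/-- `∫ (∫ log (γ_{0:t} / q_{0:t-1|t}) dq_{0:t-1|t}) dπ_t` for the time-marginal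
`π_t(x, z) = g(x) f(z)` and the reverse-time kernels `q`. -/
def pastObjective (t : ℕ) (g : (Fin d → ℝ) → ℝ≥0∞) (f : Fin M → ℝ≥0∞)
    (q : ReverseKernels M d) : EReal :=
  extIntegral
    (hiddenPathMeasure t (fun x => g (x (Fin.last t)) * q.gCond t x)
      (fun z => f (z (Fin.last t)) * q.fCond t z)) fun p =>
    ENNReal.log (S.unnormPath y t p.1 p.2 / (q.gCond t p.1 * q.fCond t p.2))

/-- `v` is the value at `π_t(x, z) = g(x) f(z)` of the forward value functional at time `t`, that
is, the maximum of `pastObjective` over the reverse-time kernels of the family. For `t = 0` there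
are no kernels involved and `v` is `∫ log γ_0 dπ_0`. -/
def IsForwardValue (t : ℕ) (g : (Fin d → ℝ) → ℝ≥0∞) (f : Fin M → ℝ≥0∞) (v : EReal) : Prop :=
  IsGreatest (Set.range (pastObjective S y t g f)) v

/-- The forward representer `α_t(x, z)` along the reverse-time kernels `q`: `α_0 = γ_0` and
`log α_{t+1} = ∫ log (γ_{t+1|t} α_t / q_{t|t+1}) dq_{t|t+1}`. -/
def forwardRepresenter (q : ReverseKernels M d) : ℕ → (Fin d → ℝ) → Fin M → ℝ≥0∞
  | 0 => fun x z => S.unnormInit y x z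
  | t + 1 => fun x z => EReal.exp <|
      extIntegral (hiddenMeasure (q.gRev t x) (q.fRev t z)) fun p =>
        ENNReal.log (S.unnormTrans y t p.1 p.2 x z * forwardRepresenter q t p.1 p.2 /
          (q.gRev t x p.1 * q.fRev t z p.2))

end Variational

/-- A density on paths `x_{0:T}` in `ℝ^d` is Gauss--Markov: it is, almost everywhere, the density
of a linear Gaussian Markov chain (written in reverse time; by Bayes' rule this is the same as in
forward time). -/
def IsGaussMarkov {d : ℕ} (T : ℕ) (g : (Fin (T + 1) → Fin d → ℝ) → ℝ≥0∞) : Prop :=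
  ∃ (μ : Fin d → ℝ) (C : Matrix (Fin d) (Fin d) ℝ) (A : Fin T → Matrix (Fin d) (Fin d) ℝ)
    (b : Fin T → Fin d → ℝ) (Q : Fin T → Matrix (Fin d) (Fin d) ℝ),
    C.PosDef ∧ (∀ i, (Q i).PosDef) ∧
    ∀ᵐ x : Fin (T + 1) → Fin d → ℝ, g x =
      ENNReal.ofReal (gaussianDensity μ C (x (Fin.last T)) *
        ∏ i : Fin T, gaussianDensity ((A i).mulVec (x i.succ) + b i) (Q i) (x i.castSucc))

end

/-! Fix the discrete factor, with path weights `w`. As a functional of the continuous factor `g`,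
the lower bound is the entropy of `w` plus `∫ g (∑ w log γ - log g)`. By Gibbs' variational
principle this is at most `modeObjective w`, the entropy of `w` plus the log-normalizer of the
geometric average `exp (∑ w log γ)`, with equality only if `g` is that normalized average
(`GibbsData.extIntegral_le_and_eq`). Along each path of modes the formula for `log γ` is quadratic
in the states and couples only neighbours. Completing the square one time at a time therefore turns
the average into a reverse-time linear Gaussian chain (`exists_gaussian_chain`).

Existence is then a finite-dimensional problem. The path weights of Markov chains form a compact
set, `modeObjective` is continuous on the simplex, and forbidden mode paths, on which the bound
would be `-∞`, are excluded by a closed condition. Conversely, an arbitrary posterior must attain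
the Gibbs bound for its own discrete factor. Its continuous path density is thus a Gaussian chain
almost everywhere, and disintegration identifies its kernels almost everywhere.

The Gaussian mean of a quadratic function is its value at the mean plus a constant determined by the
Hessian and the covariance. Inductively, for each mode, the representer is thus either zero or the
exponential of a strictly concave quadratic (`exists_forwardRepresenter_succ`); zero occurs when a
reverse kernel charges a forbidden transition or a mode that is already dead. Normalizing the
constants over the modes gives the Gaussian mixture.

The value statement is dynamic programming. The objective up to `t + 1` is the objective up to `t`
plus a finite term that depends only on the step-`t` kernels and on the marginal at `t + 1`
(`pastObjective_succ`). Cancelling this term carries optimality backwards from `T` to every `t`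
(`IsVariationalPosterior.pastObjective_le`), and the same recursion identifies the optimal value
with the integral of the log-representer. -/

noncomputable section

/-! ### Gaussian densities: normalization and second moments. -/

section Gaussian

variable {d : ℕ}

theorem lintegral_exp_neg_half_dotProduct (d : ℕ) :
    ∫⁻ u : Fin d → ℝ, ENNReal.ofReal (Real.exp (-(1 / 2) * (u ⬝ᵥ u))) =
      ENNReal.ofReal (Real.sqrt ((2 * Real.pi) ^ d)) := by
  have hprod : ∀ u : Fin d → ℝ,
      Real.exp (-(1 / 2) * (u ⬝ᵥ u)) = ∏ i, Real.exp (-(1 / 2) * (u i) ^ 2) := by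
    intro u
    rw [← Real.exp_sum, dotProduct, Finset.mul_sum]
    simp only [pow_two]
  have hint : Integrable (fun u : Fin d → ℝ => ∏ i, Real.exp (-(1 / 2) * (u i) ^ 2)) :=
    Integrable.fintype_prod (f := fun (_ : Fin d) (v : ℝ) => Real.exp (-(1 / 2) * v ^ 2))
      fun _ => integrable_exp_neg_mul_sq (by norm_num)
  simp_rw [hprod]
  rw [← ofReal_integral_eq_lintegral_ofReal hint
    (Filter.Eventually.of_forall fun u => Finset.prod_nonneg fun i _ => (Real.exp_pos _).le),
    integral_fintype_prod_volume_eq_prod (f := fun (_ : Fin d) (v : ℝ) => Real.exp (-(1 / 2) * v ^ 2))]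
  simp only [integral_gaussian, Finset.prod_const, Finset.card_univ, Fintype.card_fin]
  congr 1
  rw [show Real.pi / (1 / 2) = 2 * Real.pi by ring, eq_comm,
    Real.sqrt_eq_iff_mul_self_eq (by positivity) (by positivity), ← mul_pow,
    Real.mul_self_sqrt (by positivity)]

open scoped MatrixOrder in
-- The factorization `Λ = Bᵀ B` makes `x ↦ B x` a linear change of variables that reduces the
-- Gaussian integral to the standard one.
theorem Matrix.PosDef.exists_dotProduct_factor {Λ : Matrix (Fin d) (Fin d) ℝ} (hΛ : Λ.PosDef) :
    ∃ B : Matrix (Fin d) (Fin d) ℝ, B.det ≠ 0 ∧ Λ.det = B.det ^ 2 ∧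
      ∀ x, x ⬝ᵥ Λ.mulVec x = B.mulVec x ⬝ᵥ B.mulVec x := by
  obtain ⟨B, hB⟩ := CStarAlgebra.nonneg_iff_eq_star_mul_self.mp hΛ.posSemidef.nonneg
  rw [Matrix.star_eq_conjTranspose] at hB
  have hdet : Λ.det = B.det ^ 2 := by
    rw [hB, Matrix.det_mul, Matrix.det_conjTranspose, pow_two]; simp
  refine ⟨B, ?_, hdet, fun x => ?_⟩
  · intro h0
    have := hΛ.det_pos
    rw [hdet, h0] at this
    simp at this
  · rw [hB, ← Matrix.mulVec_mulVec, Matrix.dotProduct_mulVec, Matrix.vecMul_conjTranspose]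
    simp

theorem gaussianDensity_pos (μ : Fin d → ℝ) {C : Matrix (Fin d) (Fin d) ℝ} (hC : C.PosDef)
    (x : Fin d → ℝ) : 0 < gaussianDensity μ C x := by
  have := hC.det_pos
  unfold gaussianDensity
  positivity

@[fun_prop]
theorem Continuous.gaussianDensity {X : Type*} [TopologicalSpace X] {μ x : X → Fin d → ℝ}
    (hμ : Continuous μ) (hx : Continuous x) (C : Matrix (Fin d) (Fin d) ℝ) :
    Continuous fun p => gaussianDensity (μ p) C (x p) := by
  unfold _root_.gaussianDensity
  have h1 : Continuous fun p => x p - μ p := hx.sub hμ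
  exact continuous_const.mul (Real.continuous_exp.comp
    (continuous_const.mul (h1.dotProduct (Continuous.matrix_mulVec continuous_const h1))))

/-- Substituting `u = B (x - μ)` with `C⁻¹ = Bᵀ B`, the Jacobian `|det B|⁻¹` is exactly `√(det C)`.
-/
theorem lintegral_gaussianDensity (μ : Fin d → ℝ) {C : Matrix (Fin d) (Fin d) ℝ} (hC : C.PosDef) :
    ∫⁻ x, ENNReal.ofReal (gaussianDensity μ C x) = 1 := by
  obtain ⟨B, hB, hdet, hfac⟩ := hC.inv.exists_dotProduct_factor
  have hCdet : C.det = (B.det ^ 2)⁻¹ := by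
    rw [← hdet, Matrix.det_nonsing_inv, Ring.inverse_eq_inv', inv_inv]
  have hpos := hC.det_pos
  set k : ℝ := (Real.sqrt ((2 * Real.pi) ^ d * C.det))⁻¹ with hk
  have h1 : ∀ x, gaussianDensity μ C x =
      k * Real.exp (-(1 / 2) * (B.mulVec (x - μ) ⬝ᵥ B.mulVec (x - μ))) := by
    intro x; rw [gaussianDensity, hfac]
  have hk0 : 0 ≤ k := by positivity
  simp_rw [h1, ENNReal.ofReal_mul hk0]
  rw [lintegral_const_mul' _ _ ENNReal.ofReal_ne_top,
    lintegral_sub_right_eq_self (fun x => ENNReal.ofReal (Real.exp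
      (-(1 / 2) * (B.mulVec x ⬝ᵥ B.mulVec x)))) μ]
  have hF : Measurable fun u : Fin d → ℝ => ENNReal.ofReal (Real.exp (-(1 / 2) * (u ⬝ᵥ u))) := by
    have : Continuous fun u : Fin d → ℝ => u ⬝ᵥ u := continuous_id.dotProduct continuous_id
    fun_prop
  have h2 : ∫⁻ x : Fin d → ℝ, ENNReal.ofReal (Real.exp
      (-(1 / 2) * (B.mulVec x ⬝ᵥ B.mulVec x))) = ENNReal.ofReal |B.det⁻¹| *
        ENNReal.ofReal (Real.sqrt ((2 * Real.pi) ^ d)) := by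
    rw [← lintegral_exp_neg_half_dotProduct, ← smul_eq_mul, ← lintegral_smul_measure,
      ← Real.map_matrix_volume_pi_eq_smul_volume_pi hB, lintegral_map hF]
    · simp only [Matrix.toLin'_apply]
    · exact (LinearMap.continuous_of_finiteDimensional _).measurable
  rw [h2, ← ENNReal.ofReal_mul (by positivity), ← ENNReal.ofReal_mul hk0, hk, hCdet,
    Real.sqrt_mul (by positivity), Real.sqrt_inv, Real.sqrt_sq_eq_abs, abs_inv]
  have : Real.sqrt ((2 * Real.pi) ^ d) ≠ 0 := by positivity
  have : |B.det| ≠ 0 := by positivity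
  rw [show (Real.sqrt ((2 * Real.pi) ^ d) * |B.det|⁻¹)⁻¹ *
    (|B.det|⁻¹ * Real.sqrt ((2 * Real.pi) ^ d)) = 1 by field_simp]
  simp

theorem integrable_gaussianDensity (μ : Fin d → ℝ) {C : Matrix (Fin d) (Fin d) ℝ}
    (hC : C.PosDef) : Integrable (gaussianDensity μ C) := by
  refine ⟨(Continuous.gaussianDensity continuous_const continuous_id C).aestronglyMeasurable, ?_⟩
  rw [hasFiniteIntegral_iff_ofReal
    (Filter.Eventually.of_forall fun x => (gaussianDensity_pos μ hC x).le),
    lintegral_gaussianDensity μ hC]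
  simp

theorem integral_gaussianDensity (μ : Fin d → ℝ) {C : Matrix (Fin d) (Fin d) ℝ}
    (hC : C.PosDef) : ∫ x, gaussianDensity μ C x = 1 := by
  rw [integral_eq_lintegral_of_nonneg_ae
    (Filter.Eventually.of_forall fun x => (gaussianDensity_pos μ hC x).le)
    (Continuous.gaussianDensity continuous_const continuous_id C).aestronglyMeasurable,
    lintegral_gaussianDensity μ hC]
  simp

theorem Matrix.PosDef.exists_sq_norm_le {Λ : Matrix (Fin d) (Fin d) ℝ} (hΛ : Λ.PosDef) :
    ∃ K : ℝ, 0 < K ∧ ∀ x, ‖x‖ ^ 2 ≤ K * (x ⬝ᵥ Λ.mulVec x) := by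
  obtain ⟨B, hB, -, hfac⟩ := hΛ.exists_dotProduct_factor
  let L : (Fin d → ℝ) →L[ℝ] (Fin d → ℝ) := (Matrix.toLin' B⁻¹).toContinuousLinearMap
  refine ⟨‖L‖ ^ 2 + 1, by positivity, fun x => ?_⟩
  have h1 : L (B.mulVec x) = x := by
    simp only [L, LinearMap.coe_toContinuousLinearMap', Matrix.toLin'_apply, Matrix.mulVec_mulVec]
    rw [Matrix.nonsing_inv_mul _ (isUnit_iff_ne_zero.mpr hB), Matrix.one_mulVec]
  have h2 : ‖x‖ ≤ ‖L‖ * ‖B.mulVec x‖ := by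
    conv_lhs => rw [← h1]
    exact L.le_opNorm _
  have h3 : ∀ u : Fin d → ℝ, ‖u‖ ^ 2 ≤ u ⬝ᵥ u := by
    intro u
    have h0 : 0 ≤ u ⬝ᵥ u := Finset.sum_nonneg fun i _ => mul_self_nonneg _
    have : ‖u‖ ≤ Real.sqrt (u ⬝ᵥ u) := by
      rw [pi_norm_le_iff_of_nonneg (Real.sqrt_nonneg _)]
      intro i
      rw [Real.norm_eq_abs]
      apply Real.abs_le_sqrt
      rw [pow_two]
      exact Finset.single_le_sum (f := fun i => u i * u i) (fun i _ => mul_self_nonneg _)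
        (Finset.mem_univ i)
    calc ‖u‖ ^ 2 ≤ Real.sqrt (u ⬝ᵥ u) ^ 2 := by gcongr
      _ = _ := Real.sq_sqrt h0
  rw [hfac]
  have h4 := h3 (B.mulVec x)
  calc ‖x‖ ^ 2 ≤ (‖L‖ * ‖B.mulVec x‖) ^ 2 := by gcongr
    _ = ‖L‖ ^ 2 * ‖B.mulVec x‖ ^ 2 := by ring
    _ ≤ (‖L‖ ^ 2 + 1) * (B.mulVec x ⬝ᵥ B.mulVec x) := by gcongr; linarith

theorem gaussianDensity_sub (μ : Fin d → ℝ) (C : Matrix (Fin d) (Fin d) ℝ) (x : Fin d → ℝ) :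
    gaussianDensity μ C x = gaussianDensity 0 C (x - μ) := by
  simp [gaussianDensity]

/-- The polynomial factor is absorbed by doubling the covariance: with `s = x ⬝ᵥ C⁻¹ x`, `‖x‖²` is
at most a multiple of `s ≤ 4 exp (s / 4)`, and `exp (s / 4) exp (-s / 2) = exp (-s / 4)` is the
exponential of the density with covariance `2 C`. -/
theorem integrable_sq_norm_mul_gaussianDensity {C : Matrix (Fin d) (Fin d) ℝ} (hC : C.PosDef) :
    Integrable fun x => ‖x‖ ^ 2 * gaussianDensity 0 C x := by
  obtain ⟨K, hK, hle⟩ := hC.inv.exists_sq_norm_le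
  have hC2 : ((2 : ℝ) • C).PosDef := hC.smul (by norm_num)
  set k : ℝ := (Real.sqrt ((2 * Real.pi) ^ d * C.det))⁻¹ with hk
  set k2 : ℝ := (Real.sqrt ((2 * Real.pi) ^ d * ((2 : ℝ) • C).det))⁻¹ with hk2
  have hpos := hC.det_pos
  have hpos2 := hC2.det_pos
  have hk0 : 0 < k := by positivity
  have hk20 : 0 < k2 := by positivity
  refine Integrable.mono' ((integrable_gaussianDensity 0 hC2).const_mul (4 * K * k / k2))
    (((continuous_norm.pow 2).mul
      (Continuous.gaussianDensity continuous_const continuous_id C)).aestronglyMeasurable)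
    (Filter.Eventually.of_forall fun x => ?_)
  have hg := gaussianDensity_pos 0 hC x
  rw [Real.norm_of_nonneg (by positivity)]
  set s := x ⬝ᵥ C⁻¹.mulVec x with hs
  have h1 : gaussianDensity 0 C x = k * Real.exp (-(1 / 2) * s) := by
    simp [gaussianDensity, hk, hs]
  have h2 : gaussianDensity 0 ((2 : ℝ) • C) x = k2 * Real.exp (-(1 / 4) * s) := by
    have : ((2 : ℝ) • C)⁻¹ = (2 : ℝ)⁻¹ • C⁻¹ := by
      refine Matrix.inv_eq_right_inv ?_
      rw [Matrix.smul_mul, Matrix.mul_smul, smul_smul,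
        Matrix.mul_nonsing_inv _ (isUnit_iff_ne_zero.mpr hpos.ne')]
      norm_num
    rw [gaussianDensity, this, sub_zero, Matrix.smul_mulVec, dotProduct_smul, ← hs, ← hk2,
      smul_eq_mul]
    ring_nf
  have h3 : s ≤ 4 * Real.exp (1 / 4 * s) := by
    have := Real.add_one_le_exp (1 / 4 * s); linarith
  rw [h1, h2]
  calc ‖x‖ ^ 2 * (k * Real.exp (-(1 / 2) * s))
      ≤ (K * (4 * Real.exp (1 / 4 * s))) * (k * Real.exp (-(1 / 2) * s)) := by
        gcongr
        exact (hle x).trans (by gcongr)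
    _ = 4 * K * k * (Real.exp (1 / 4 * s) * Real.exp (-(1 / 2) * s)) := by ring
    _ = 4 * K * k * Real.exp (-(1 / 4) * s) := by rw [← Real.exp_add]; ring_nf
    _ = 4 * K * k / k2 * (k2 * Real.exp (-(1 / 4) * s)) := by field_simp

theorem lintegral_sq_enorm_gaussianDensity_lt_top {C : Matrix (Fin d) (Fin d) ℝ}
    (hC : C.PosDef) : ∫⁻ x, ‖x‖ₑ ^ 2 * ENNReal.ofReal (gaussianDensity 0 C x) < ∞ := by
  have h := (integrable_sq_norm_mul_gaussianDensity hC).hasFiniteIntegral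
  refine lt_of_le_of_lt (lintegral_mono fun x => ?_) h
  rw [enorm_mul, enorm_pow, enorm_norm,
    Real.enorm_of_nonneg (gaussianDensity_pos 0 hC x).le]

theorem integral_mul_gaussianDensity_eq_zero (C : Matrix (Fin d) (Fin d) ℝ)
    (l : (Fin d → ℝ) →ₗ[ℝ] ℝ) : ∫ x, l x * gaussianDensity 0 C x = 0 := by
  have h := integral_neg_eq_self (fun x => l x * gaussianDensity 0 C x)
    (volume : Measure (Fin d → ℝ))
  have h2 : ∀ x, l (-x) * gaussianDensity 0 C (-x) = -(l x * gaussianDensity 0 C x) := by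
    intro x
    simp [gaussianDensity, Matrix.mulVec_neg]
  simp_rw [h2, integral_neg] at h
  linarith

theorem enorm_add_sq_le {E : Type*} [NormedAddCommGroup E] (a b : E) :
    ‖a + b‖ₑ ^ 2 ≤ 2 * ‖a‖ₑ ^ 2 + 2 * ‖b‖ₑ ^ 2 := by
  have h : ‖a + b‖ ^ 2 ≤ 2 * ‖a‖ ^ 2 + 2 * ‖b‖ ^ 2 := by
    have := norm_add_le a b
    nlinarith [sq_nonneg (‖a‖ - ‖b‖), norm_nonneg (a + b), norm_nonneg a, norm_nonneg b]
  have e : ∀ v : E, ‖v‖ₑ ^ 2 = ENNReal.ofReal (‖v‖ ^ 2) := by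
    intro v; rw [← ofReal_norm, ENNReal.ofReal_pow (norm_nonneg _)]
  rw [e, e, e, show (2 : ℝ≥0∞) = ENNReal.ofReal 2 by simp, ← ENNReal.ofReal_mul (by norm_num),
    ← ENNReal.ofReal_mul (by norm_num), ← ENNReal.ofReal_add (by positivity) (by positivity)]
  exact ENNReal.ofReal_le_ofReal h

/-- The constant does not depend on `x`, so the bound can be iterated: finite second moments
propagate backwards along a linear Gaussian chain. -/
theorem exists_lintegral_sq_enorm_gaussianDensity_le (A : Matrix (Fin d) (Fin d) ℝ)
    (a : Fin d → ℝ) {C : Matrix (Fin d) (Fin d) ℝ} (hC : C.PosDef) :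
    ∃ K : ℝ≥0∞, K ≠ ∞ ∧ ∀ x : Fin d → ℝ,
      ∫⁻ x', ‖x'‖ₑ ^ 2 * ENNReal.ofReal (gaussianDensity (A.mulVec x + a) C x') ≤
        K * (1 + ‖x‖ₑ ^ 2) := by
  let L : (Fin d → ℝ) →L[ℝ] (Fin d → ℝ) := (Matrix.toLin' A).toContinuousLinearMap
  set V := ∫⁻ x, ‖x‖ₑ ^ 2 * ENNReal.ofReal (gaussianDensity 0 C x) with hV
  have hVtop : V ≠ ∞ := (lintegral_sq_enorm_gaussianDensity_lt_top hC).ne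
  refine ⟨2 * V + 4 * ‖L‖ₑ ^ 2 + 4 * ‖a‖ₑ ^ 2, by finiteness, fun x => ?_⟩
  set m := A.mulVec x + a with hm
  have h1 : ‖m‖ₑ ^ 2 ≤ 2 * (‖L‖ₑ ^ 2 * ‖x‖ₑ ^ 2) + 2 * ‖a‖ₑ ^ 2 := by
    refine (enorm_add_sq_le _ _).trans ?_
    have : ‖A.mulVec x‖ₑ ≤ ‖L‖ₑ * ‖x‖ₑ := L.le_opENorm x
    rw [← mul_pow]
    gcongr
  have hgm : Measurable fun x => ENNReal.ofReal (gaussianDensity 0 C x) :=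
    (Continuous.gaussianDensity continuous_const continuous_id C).measurable.ennreal_ofReal
  calc ∫⁻ x', ‖x'‖ₑ ^ 2 * ENNReal.ofReal (gaussianDensity m C x')
      = ∫⁻ x', ‖x' + m‖ₑ ^ 2 * ENNReal.ofReal (gaussianDensity 0 C x') := by
        rw [← lintegral_add_right_eq_self _ m]
        simp_rw [gaussianDensity_sub m C, add_sub_cancel_right]
    _ ≤ ∫⁻ x', (2 * (‖x'‖ₑ ^ 2 * ENNReal.ofReal (gaussianDensity 0 C x')) +
          2 * ‖m‖ₑ ^ 2 * ENNReal.ofReal (gaussianDensity 0 C x')) := by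
        refine lintegral_mono fun x' => ?_
        dsimp only
        rw [← mul_assoc, ← add_mul]
        gcongr
        exact enorm_add_sq_le _ _
    _ = 2 * V + 2 * ‖m‖ₑ ^ 2 := by
        rw [lintegral_add_right _ (hgm.const_mul _), lintegral_const_mul _ hgm,
          lintegral_const_mul' _ _ (by simp), lintegral_gaussianDensity 0 hC, mul_one]
    _ ≤ 2 * V + 2 * (2 * (‖L‖ₑ ^ 2 * ‖x‖ₑ ^ 2) + 2 * ‖a‖ₑ ^ 2) := by gcongr
    _ ≤ (2 * V + 4 * ‖L‖ₑ ^ 2 + 4 * ‖a‖ₑ ^ 2) * (1 + ‖x‖ₑ ^ 2) := by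
        have : 2 * (2 * (‖L‖ₑ ^ 2 * ‖x‖ₑ ^ 2) + 2 * ‖a‖ₑ ^ 2) =
          4 * ‖L‖ₑ ^ 2 * ‖x‖ₑ ^ 2 + 4 * ‖a‖ₑ ^ 2 := by ring
        rw [this, mul_add, mul_one, add_mul, add_mul]
        calc 2 * V + (4 * ‖L‖ₑ ^ 2 * ‖x‖ₑ ^ 2 + 4 * ‖a‖ₑ ^ 2)
            ≤ 2 * V + (4 * ‖L‖ₑ ^ 2 * ‖x‖ₑ ^ 2 + 4 * ‖a‖ₑ ^ 2) + (4 * ‖L‖ₑ ^ 2 +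
              2 * V * ‖x‖ₑ ^ 2 + 4 * ‖a‖ₑ ^ 2 * ‖x‖ₑ ^ 2) := le_self_add
          _ = _ := by ring

end Gaussian


/-! ### Quadratic functions and completing the square. -/

section Quadratic

variable {V W : Type*} [AddCommGroup V] [Module ℝ V] [AddCommGroup W] [Module ℝ W]

/-- `f` is a quadratic function whose second-order part is `-B v v / 2`. -/
def IsQuadratic (f : V → ℝ) (B : V →ₗ[ℝ] V →ₗ[ℝ] ℝ) : Prop :=
  (∀ u v, B u v = B v u) ∧ ∃ (l : V →ₗ[ℝ] ℝ) (c : ℝ), ∀ v, f v = c + l v - B v v / 2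

/-- `f` is a strictly concave quadratic function. -/
def IsConcaveQuadratic (f : V → ℝ) : Prop :=
  ∃ B, IsQuadratic f B ∧ ∀ v, v ≠ 0 → 0 < B v v

theorem IsQuadratic.add {f g : V → ℝ} {B B' : V →ₗ[ℝ] V →ₗ[ℝ] ℝ} (hf : IsQuadratic f B)
    (hg : IsQuadratic g B') : IsQuadratic (fun v => f v + g v) (B + B') := by
  obtain ⟨hB, l, c, h⟩ := hf
  obtain ⟨hB', l', c', h'⟩ := hg
  refine ⟨fun u v => ?_, l + l', c + c', fun v => ?_⟩
  · simp only [LinearMap.add_apply, hB u v, hB' u v]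
  · simp only [LinearMap.add_apply, h, h']; ring

theorem IsQuadratic.const_mul {f : V → ℝ} {B : V →ₗ[ℝ] V →ₗ[ℝ] ℝ} (hf : IsQuadratic f B)
    (r : ℝ) : IsQuadratic (fun v => r * f v) (r • B) := by
  obtain ⟨hB, l, c, h⟩ := hf
  refine ⟨fun u v => ?_, r • l, r * c, fun v => ?_⟩
  · simp only [LinearMap.smul_apply, hB u v]
  · simp only [LinearMap.smul_apply, smul_eq_mul, h]; ring

theorem isQuadratic_const (r : ℝ) : IsQuadratic (fun _ : V => r) 0 :=
  ⟨fun _ _ => by simp, 0, r, fun v => by simp⟩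

theorem isQuadratic_linear (l : V →ₗ[ℝ] ℝ) : IsQuadratic (fun v : V => l v) 0 :=
  ⟨fun _ _ => by simp, l, 0, fun v => by simp⟩

theorem IsQuadratic.add_const {f : V → ℝ} {B : V →ₗ[ℝ] V →ₗ[ℝ] ℝ} (hf : IsQuadratic f B)
    (r : ℝ) : IsQuadratic (fun v => f v + r) B := by
  simpa using hf.add (isQuadratic_const r)

theorem IsQuadratic.sum {ι : Type*} (s : Finset ι) {f : ι → V → ℝ}
    {B : ι → V →ₗ[ℝ] V →ₗ[ℝ] ℝ} (hf : ∀ i, IsQuadratic (f i) (B i)) :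
    IsQuadratic (fun v => ∑ i ∈ s, f i v) (∑ i ∈ s, B i) := by
  classical
  induction s using Finset.induction_on with
  | empty => simpa using isQuadratic_const (V := V) 0
  | insert a s ha ih =>
    simp only [Finset.sum_insert ha]
    exact (hf a).add ih

theorem IsQuadratic.congr {f g : V → ℝ} {B : V →ₗ[ℝ] V →ₗ[ℝ] ℝ} (hf : IsQuadratic f B)
    (h : ∀ v, g v = f v) : IsQuadratic g B := by
  obtain rfl : g = f := funext h
  exact hf

theorem IsQuadratic.comp_affine {f : V → ℝ} {B : V →ₗ[ℝ] V →ₗ[ℝ] ℝ} (hf : IsQuadratic f B)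
    (L : W →ₗ[ℝ] V) (u : V) : IsQuadratic (fun w => f (L w + u)) (B.compl₁₂ L L) := by
  obtain ⟨hB, l, c, h⟩ := hf
  refine ⟨fun u v => ?_, (l - B u) ∘ₗ L, f u, fun v => ?_⟩
  · simp only [LinearMap.compl₁₂_apply, hB]
  · simp only [h, map_add, LinearMap.add_apply, LinearMap.compl₁₂_apply, LinearMap.comp_apply,
      LinearMap.sub_apply, hB (L v) u]
    ring

/-- Exact Taylor expansion about any `v`, with gradient `l - B v`; the same `l` serves all base
points. -/
theorem IsQuadratic.apply_add {f : V → ℝ} {B : V →ₗ[ℝ] V →ₗ[ℝ] ℝ} (hf : IsQuadratic f B) :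
    ∃ l : V →ₗ[ℝ] ℝ, ∀ v h, f (h + v) = f v + (l h - B v h) - B h h / 2 := by
  obtain ⟨hB, l, c, hl⟩ := hf
  refine ⟨l, fun v h => ?_⟩
  simp only [hl, map_add, LinearMap.add_apply, hB h v]
  ring

theorem isQuadratic_log_gaussianDensity {d : ℕ} {C : Matrix (Fin d) (Fin d) ℝ}
    (hC : C.PosDef) : IsQuadratic (fun x => Real.log (gaussianDensity 0 C x))
      (Matrix.toLinearMap₂' ℝ C⁻¹) := by
  refine ⟨fun u v => ?_, 0, Real.log (Real.sqrt ((2 * Real.pi) ^ d * C.det))⁻¹, fun v => ?_⟩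
  · rw [Matrix.toLinearMap₂'_apply', Matrix.toLinearMap₂'_apply', Matrix.dotProduct_mulVec,
      ← Matrix.mulVec_transpose, dotProduct_comm]
    have := hC.inv.isHermitian
    rw [Matrix.IsHermitian, Matrix.conjTranspose_eq_transpose_of_trivial] at this
    rw [this]
  · have := hC.det_pos
    change Real.log (gaussianDensity 0 C v) = _
    rw [gaussianDensity, Real.log_mul (by positivity) (Real.exp_pos _).ne', Real.log_exp,
      Matrix.toLinearMap₂'_apply']
    simp
    ring

/-- A Gaussian density depends only on argument minus mean, so one statement covers observations
(moving mean, fixed argument), transitions and reverse kernels (both moving). -/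
theorem isQuadratic_log_gaussianDensity_comp {d : ℕ} {C : Matrix (Fin d) (Fin d) ℝ}
    (hC : C.PosDef) {m x : V → Fin d → ℝ} (L : V →ₗ[ℝ] (Fin d → ℝ)) (u : Fin d → ℝ)
    (h : ∀ v, x v - m v = L v + u) :
    IsQuadratic (fun v => Real.log (gaussianDensity (m v) C (x v)))
      ((Matrix.toLinearMap₂' ℝ C⁻¹).compl₁₂ L L) :=
  ((isQuadratic_log_gaussianDensity hC).comp_affine L u).congr fun v => by
    rw [gaussianDensity_sub, h]

theorem Matrix.PosDef.toLinearMap₂'_pos {d : ℕ} {Λ : Matrix (Fin d) (Fin d) ℝ} (hΛ : Λ.PosDef)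
    {x : Fin d → ℝ} (hx : x ≠ 0) : 0 < Matrix.toLinearMap₂' ℝ Λ x x := by
  rw [Matrix.toLinearMap₂'_apply']
  simpa using hΛ.dotProduct_mulVec_pos hx

theorem Matrix.PosDef.toLinearMap₂'_nonneg {d : ℕ} {Λ : Matrix (Fin d) (Fin d) ℝ}
    (hΛ : Λ.PosDef) (x : Fin d → ℝ) : 0 ≤ Matrix.toLinearMap₂' ℝ Λ x x := by
  rcases eq_or_ne x 0 with rfl | hx
  · simp
  · exact (hΛ.toLinearMap₂'_pos hx).le

/-- Completing the square in the first variable of a quadratic function. -/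
theorem IsQuadratic.exists_gaussian_factor {d : ℕ} {q : (Fin d → ℝ) × W → ℝ}
    {B : (Fin d → ℝ) × W →ₗ[ℝ] (Fin d → ℝ) × W →ₗ[ℝ] ℝ} (hq : IsQuadratic q B)
    (hB : ∀ x : Fin d → ℝ, x ≠ 0 → 0 < B (x, 0) (x, 0)) :
    ∃ (A : W →ₗ[ℝ] (Fin d → ℝ)) (a : Fin d → ℝ) (P : Matrix (Fin d) (Fin d) ℝ) (c : ℝ),
      P.PosDef ∧ ∀ x' x, q (x', x) = q (A x + a, x) + c +
        Real.log (gaussianDensity (A x + a) P x') := by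
  obtain ⟨l, hl⟩ := hq.apply_add
  let I : (Fin d → ℝ) →ₗ[ℝ] (Fin d → ℝ) × W := LinearMap.inl ℝ _ _
  let J : W →ₗ[ℝ] (Fin d → ℝ) × W := LinearMap.inr ℝ _ _
  set B₁ : (Fin d → ℝ) →ₗ[ℝ] (Fin d → ℝ) →ₗ[ℝ] ℝ := B.compl₁₂ I I with hB₁
  set Λ : Matrix (Fin d) (Fin d) ℝ := LinearMap.toMatrix₂' ℝ B₁ with hΛdef
  have hΛB : ∀ x y, x ⬝ᵥ Λ.mulVec y = B₁ x y := by
    intro x y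
    rw [← Matrix.toLinearMap₂'_apply', hΛdef, Matrix.toLinearMap₂'_toMatrix']
  have hΛ : Λ.PosDef := by
    refine Matrix.PosDef.of_dotProduct_mulVec_pos ?_ fun x hx => ?_
    · ext i j
      simp [hΛdef, hB₁, hq.1 (I (Pi.single i 1))]
    · rw [star_trivial, hΛB]
      exact hB x hx
  -- the linear functional `x' ↦ l (x', 0) - B (0, x) (x', 0)` as a vector depending on `x`
  let k : W →ₗ[ℝ] (Fin d → ℝ) := LinearMap.pi fun i => B.compl₁₂ J I |>.flip (Pi.single i 1)
  let k₀ : Fin d → ℝ := fun i => l (I (Pi.single i 1))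
  have hunit : IsUnit Λ.det := isUnit_iff_ne_zero.mpr hΛ.det_pos.ne'
  have hone : ∀ i : Fin d, (fun j => if i = j then (1 : ℝ) else 0) = Pi.single i 1 := by
    intro i; ext j; simp [Pi.single_apply, eq_comm]
  have hk : ∀ x h, h ⬝ᵥ k x = B (J x) (I h) := by
    intro x h
    have : B (J x) (I h) = (B.compl₁₂ J I x) h := rfl
    rw [this, LinearMap.pi_apply_eq_sum_univ (B.compl₁₂ J I x) h]
    simp only [dotProduct, smul_eq_mul, hone]
    rfl
  have hk₀ : ∀ h, h ⬝ᵥ k₀ = l (I h) := by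
    intro h
    have : l (I h) = (l ∘ₗ I) h := rfl
    rw [this, LinearMap.pi_apply_eq_sum_univ (l ∘ₗ I) h]
    simp only [dotProduct, smul_eq_mul, hone]
    rfl
  -- For fixed `x` the mean is the maximizer of `q (·, x)`, the covariance is the inverse of the
  -- curvature `Λ`, and the constant removes the normalization of the density.
  refine ⟨-(Matrix.toLin' Λ⁻¹ ∘ₗ k), Λ⁻¹.mulVec k₀,
    Λ⁻¹, -Real.log (Real.sqrt ((2 * Real.pi) ^ d * Λ⁻¹.det))⁻¹, hΛ.inv, fun x' x => ?_⟩
  set m := (-(Matrix.toLin' Λ⁻¹ ∘ₗ k)) x + Λ⁻¹.mulVec k₀ with hm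
  -- First-order condition: the derivative of `q` at `(m, x)` in the direction `(h, 0)` vanishes.
  have hmΛ : ∀ h, B₁ h m = l (I h) - B (J x) (I h) := by
    intro h
    rw [← hΛB, hm]
    simp only [LinearMap.neg_apply, LinearMap.comp_apply, Matrix.toLin'_apply, Matrix.mulVec_add,
      Matrix.mulVec_neg, Matrix.mulVec_mulVec, Matrix.mul_nonsing_inv _ hunit, Matrix.one_mulVec,
      dotProduct_add, dotProduct_neg, hk, hk₀]
    ring
  have h1 := hl (m, x) (I (x' - m))
  have h2 : I (x' - m) + (m, x) = (x', x) := by simp [I]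
  have h3 : B (m, x) (I (x' - m)) = B₁ (x' - m) m + B (J x) (I (x' - m)) := by
    have : ((m, x) : (Fin d → ℝ) × W) = I m + J x := by simp [I, J]
    rw [this, map_add, LinearMap.add_apply]
    congr 1
    rw [hq.1]
    rfl
  rw [h2, h3, hmΛ] at h1
  have hdet := hΛ.inv.det_pos
  rw [h1, gaussianDensity, Real.log_mul (by positivity) (Real.exp_pos _).ne', Real.log_exp,
    Matrix.nonsing_inv_nonsing_inv _ hunit, hΛB]
  change _ - B₁ _ _ / 2 = _
  ring

theorem IsConcaveQuadratic.exists_eq_log_gaussianDensity {d : ℕ} {f : (Fin d → ℝ) → ℝ}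
    (hf : IsConcaveQuadratic f) :
    ∃ (μ : Fin d → ℝ) (C : Matrix (Fin d) (Fin d) ℝ) (c : ℝ), C.PosDef ∧
      ∀ x, f x = c + Real.log (gaussianDensity μ C x) := by
  obtain ⟨B, hB, hpos⟩ := hf
  -- The second factor `ℝ` is a dummy parameter space, evaluated at `0` in the end.
  have h : IsQuadratic (fun p : (Fin d → ℝ) × ℝ => f p.1) _ :=
    (hB.comp_affine (LinearMap.fst ℝ (Fin d → ℝ) ℝ) 0).congr fun v => by simp
  obtain ⟨A, a, P, c, hP, heq⟩ := h.exists_gaussian_factor fun x hx => by simpa using hpos x hx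
  exact ⟨A 0 + a, P, f (A 0 + a) + c, hP, fun x => heq x 0⟩

theorem isConcaveQuadratic_log_gaussianDensity {d : ℕ} (μ : Fin d → ℝ)
    {C : Matrix (Fin d) (Fin d) ℝ} (hC : C.PosDef) :
    IsConcaveQuadratic fun x => Real.log (gaussianDensity μ C x) :=
  ⟨_, isQuadratic_log_gaussianDensity_comp hC LinearMap.id (-μ) fun v => by simp [sub_eq_add_neg],
    fun _ hv => hC.inv.toLinearMap₂'_pos hv⟩

/-- Integrating out the first variable of a strictly concave quadratic function. -/
theorem IsConcaveQuadratic.exists_gaussian_kernel {d : ℕ} {q : (Fin d → ℝ) × (Fin d → ℝ) → ℝ}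
    (hq : IsConcaveQuadratic q) :
    ∃ (A : Matrix (Fin d) (Fin d) ℝ) (a : Fin d → ℝ) (P : Matrix (Fin d) (Fin d) ℝ)
      (β : (Fin d → ℝ) → ℝ), P.PosDef ∧ IsConcaveQuadratic β ∧
      ∀ x' x, q (x', x) = β x + Real.log (gaussianDensity (A.mulVec x + a) P x') := by
  obtain ⟨B, hB, hpos⟩ := hq
  obtain ⟨A, a, P, c, hP, heq⟩ := hB.exists_gaussian_factor fun x hx => hpos _ (by simpa using hx)
  -- Up to a constant, `β x` is the maximum of `q (·, x)`, that is, `q` restricted to an affine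
  -- graph. The linear part of the graph map is injective, so strict concavity survives.
  refine ⟨LinearMap.toMatrix' A, a, P, fun x => q (A x + a, x) + c, hP,
    ⟨B.compl₁₂ (A.prod LinearMap.id) (A.prod LinearMap.id), ?_, ?_⟩, ?_⟩
  · exact ((hB.comp_affine (A.prod LinearMap.id) (a, 0)).add_const c).congr fun x => by simp
  · intro v hv
    rw [LinearMap.compl₁₂_apply]
    exact hpos _ (by simp [hv])
  · intro x' x
    rw [LinearMap.toMatrix'_mulVec]
    exact heq x' x

end Quadratic

/-! ### Growth bounds and Gaussian means of quadratic functions. -/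

section QuadraticBound

variable {V : Type*} [NormedAddCommGroup V] [NormedSpace ℝ V] [FiniteDimensional ℝ V]

theorem IsQuadratic.continuous_and_bound {f : V → ℝ} {B : V →ₗ[ℝ] V →ₗ[ℝ] ℝ}
    (hf : IsQuadratic f B) :
    Continuous f ∧ ∃ K : ℝ, 0 ≤ K ∧ ∀ v, |f v| ≤ K * (1 + ‖v‖ ^ 2) := by
  obtain ⟨-, l, c, h⟩ := hf
  let l' : V →L[ℝ] ℝ := l.toContinuousLinearMap
  let B' : V →L[ℝ] V →L[ℝ] ℝ :=
    ((LinearMap.toContinuousLinearMap : (V →ₗ[ℝ] ℝ) ≃ₗ[ℝ] (V →L[ℝ] ℝ)).toLinearMap ∘ₗ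
      B).toContinuousLinearMap
  have h' : ∀ v, f v = c + l' v - B' v v / 2 := h
  refine ⟨?_, |c| + ‖l'‖ + ‖B'‖, by positivity, fun v => ?_⟩
  · have : f = fun v => c + l' v - B' v v / 2 := funext h'
    rw [this]
    fun_prop
  · have h1 : |l' v| ≤ ‖l'‖ * ‖v‖ := l'.le_opNorm v
    have h2 : |B' v v| ≤ ‖B'‖ * ‖v‖ * ‖v‖ := B'.le_opNorm₂ v v
    have h3 : |f v| ≤ |c| + |l' v| + |B' v v| := by
      rw [h']
      have := abs_sub (c + l' v) (B' v v / 2)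
      have h4 := abs_add_le c (l' v)
      rw [abs_div, abs_two] at this
      linarith [abs_nonneg (B' v v)]
    have h5 : ‖v‖ ≤ 1 + ‖v‖ ^ 2 := by nlinarith [sq_nonneg (‖v‖ - 1)]
    calc |f v| ≤ |c| * 1 + ‖l'‖ * ‖v‖ + ‖B'‖ * ‖v‖ ^ 2 := by
          rw [mul_one, pow_two, ← mul_assoc]; linarith
      _ ≤ |c| * (1 + ‖v‖ ^ 2) + ‖l'‖ * (1 + ‖v‖ ^ 2) + ‖B'‖ * (1 + ‖v‖ ^ 2) := by
          gcongr
          · nlinarith [sq_nonneg ‖v‖]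
          · linarith
      _ = _ := by ring

theorem IsQuadratic.continuous {f : V → ℝ} {B : V →ₗ[ℝ] V →ₗ[ℝ] ℝ}
    (hf : IsQuadratic f B) : Continuous f := hf.continuous_and_bound.1

theorem IsQuadratic.exists_enorm_le {f : V → ℝ} {B : V →ₗ[ℝ] V →ₗ[ℝ] ℝ}
    (hf : IsQuadratic f B) : ∃ K : ℝ≥0∞, K ≠ ∞ ∧ ∀ v, ‖f v‖ₑ ≤ K * (1 + ‖v‖ₑ ^ 2) := by
  obtain ⟨-, K, hK, hle⟩ := hf.continuous_and_bound
  refine ⟨ENNReal.ofReal K, ENNReal.ofReal_ne_top, fun v => ?_⟩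
  rw [← ofReal_norm, ← ofReal_norm, ← ENNReal.ofReal_pow (norm_nonneg v), ← ENNReal.ofReal_one,
    ← ENNReal.ofReal_add zero_le_one (by positivity), ← ENNReal.ofReal_mul hK]
  exact ENNReal.ofReal_le_ofReal (hle v)

theorem IsQuadratic.integrable_mul_gaussianDensity_zero {d : ℕ} {f : (Fin d → ℝ) → ℝ}
    {B : (Fin d → ℝ) →ₗ[ℝ] (Fin d → ℝ) →ₗ[ℝ] ℝ} (hf : IsQuadratic f B)
    {P : Matrix (Fin d) (Fin d) ℝ} (hP : P.PosDef) :
    Integrable fun x => f x * gaussianDensity 0 P x := by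
  obtain ⟨hc, K, hK, hle⟩ := hf.continuous_and_bound
  have h1 := ((integrable_gaussianDensity 0 hP).add
    (integrable_sq_norm_mul_gaussianDensity hP)).const_mul K
  refine h1.mono' (hc.mul (Continuous.gaussianDensity continuous_const continuous_id
    P)).aestronglyMeasurable (Filter.Eventually.of_forall fun x => ?_)
  have hg := gaussianDensity_pos 0 hP x
  rw [norm_mul, Real.norm_of_nonneg hg.le, Real.norm_eq_abs]
  calc |f x| * gaussianDensity 0 P x ≤ K * (1 + ‖x‖ ^ 2) * gaussianDensity 0 P x := by
        gcongr; exact hle x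
    _ = _ := by simp only [Pi.add_apply]; ring

/-- The Gaussian mean of a quadratic function. -/
theorem exists_integral_quadratic_mul_gaussianDensity {d : ℕ}
    (B : (Fin d → ℝ) →ₗ[ℝ] (Fin d → ℝ) →ₗ[ℝ] ℝ) {P : Matrix (Fin d) (Fin d) ℝ}
    (hP : P.PosDef) : ∃ K : ℝ, ∀ (f : (Fin d → ℝ) → ℝ) (m : Fin d → ℝ), IsQuadratic f B →
      Integrable (fun x => f x * gaussianDensity m P x) ∧
        ∫ x, f x * gaussianDensity m P x = f m + K := by
  -- After centring at `m` the linear term integrates to zero by symmetry. Only the second-order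
  -- term remains, and it involves neither `f` nor `m`; `B` may be indefinite.
  refine ⟨∫ h, -(1 / 2) * B h h * gaussianDensity 0 P h, fun f m hf => ?_⟩
  obtain ⟨l, hl⟩ := hf.apply_add
  have e1 : ∀ x, f x * gaussianDensity m P x =
      (fun h => f (h + m) * gaussianDensity 0 P h) (x - m) := by
    intro x; simp [gaussianDensity_sub m]
  have hshift : IsQuadratic (fun h => f (h + m)) _ := hf.comp_affine LinearMap.id m
  have hsq : IsQuadratic (fun h => -(1 / 2) * B h h) B :=
    ⟨hf.1, 0, 0, fun v => by simp; ring⟩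
  have e2 : ∀ h, f (h + m) * gaussianDensity 0 P h =
      (f m * gaussianDensity 0 P h + (l - B m) h * gaussianDensity 0 P h) +
        -(1 / 2) * B h h * gaussianDensity 0 P h := by
    intro h
    rw [hl, LinearMap.sub_apply]; ring
  simp_rw [e1]
  refine ⟨(hshift.integrable_mul_gaussianDensity_zero hP).comp_sub_right m, ?_⟩
  rw [integral_sub_right_eq_self (fun h => f (h + m) * gaussianDensity 0 P h) m]
  simp_rw [e2]
  have i1 := (integrable_gaussianDensity 0 hP).const_mul (f m)
  have i2 := (isQuadratic_linear (l - B m)).integrable_mul_gaussianDensity_zero hP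
  have i3 := hsq.integrable_mul_gaussianDensity_zero hP
  have i12 : Integrable fun x => f m * gaussianDensity 0 P x +
      (l - B m) x * gaussianDensity 0 P x := i1.add i2
  rw [integral_add i12 i3, integral_add i1 i2, integral_const_mul,
    integral_gaussianDensity 0 hP, integral_mul_gaussianDensity_eq_zero]
  ring

end QuadraticBound


/-! ### Averages of log path densities have Gauss–Markov form. -/

section Chain

theorem IsConcaveQuadratic.comp_injective {V W : Type*} [AddCommGroup V] [Module ℝ V]
    [AddCommGroup W] [Module ℝ W] {f : V → ℝ} (hf : IsConcaveQuadratic f) (L : W →ₗ[ℝ] V)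
    (hL : Function.Injective L) (u : V) : IsConcaveQuadratic fun w => f (L w + u) := by
  obtain ⟨B, hB, hpos⟩ := hf
  exact ⟨_, hB.comp_affine L u, fun w hw =>
    hpos _ ((map_ne_zero_iff L hL).mpr hw)⟩

theorem IsConcaveQuadratic.add_const {V : Type*} [AddCommGroup V] [Module ℝ V] {f : V → ℝ}
    (hf : IsConcaveQuadratic f) (r : ℝ) : IsConcaveQuadratic fun v => f v + r := by
  obtain ⟨B, hB, hpos⟩ := hf
  exact ⟨B, hB.add_const r, hpos⟩

theorem IsConcaveQuadratic.congr {V : Type*} [AddCommGroup V] [Module ℝ V] {f g : V → ℝ}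
    (hf : IsConcaveQuadratic f) (h : ∀ v, g v = f v) : IsConcaveQuadratic g := by
  obtain rfl : g = f := funext h
  exact hf

theorem Finset.sum_mul_pos_of_sum_eq_one {ι : Type*} [Fintype ι] {w r : ι → ℝ}
    (hw : ∀ i, 0 ≤ w i) (hw1 : ∑ i, w i = 1) (hr : ∀ i, 0 < r i) : 0 < ∑ i, w i * r i := by
  refine Finset.sum_pos' (fun i _ => mul_nonneg (hw i) (hr i).le) ?_
  by_contra! h
  have : ∑ i, w i = 0 := Finset.sum_eq_zero fun i hi => by
    have h1 := h i hi
    nlinarith [hw i, hr i, mul_nonneg (hw i) (hr i).le]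
  linarith

/-- `f` is a concave quadratic function of a transition `(x', x)`, strictly so in `x`. -/
def IsTransitionQuadratic {V W : Type*} [AddCommGroup V] [Module ℝ V] [AddCommGroup W]
    [Module ℝ W] (f : V × W → ℝ) : Prop :=
  ∃ B, IsQuadratic f B ∧ (∀ v, 0 ≤ B v v) ∧ ∀ x, x ≠ 0 → 0 < B (0, x) (0, x)

/-- The two sources of strictness complement each other: a direction with nonzero first component is
seen by `f i`, one with zero first component by `g i`. Some weight is positive since they sum to
one. -/
theorem isConcaveQuadratic_weighted_sum {V W ι : Type*} [AddCommGroup V] [Module ℝ V]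
    [AddCommGroup W] [Module ℝ W] [Fintype ι] {w : ι → ℝ} (hw : ∀ i, 0 ≤ w i)
    (hw1 : ∑ i, w i = 1) {f : ι → V → ℝ} {g : ι → V × W → ℝ}
    (hf : ∀ i, IsConcaveQuadratic (f i)) (hg : ∀ i, IsTransitionQuadratic (g i)) :
    IsConcaveQuadratic fun p : V × W => ∑ i, w i * (f i p.1 + g i p) := by
  choose B hB hBpos using hf
  choose B' hB' hB'nonneg hB'pos using hg
  have h1 : ∀ i, IsQuadratic (fun p : V × W => f i p.1)
      ((B i).compl₁₂ (LinearMap.fst ℝ V W) (LinearMap.fst ℝ V W)) := fun i =>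
    ((hB i).comp_affine (LinearMap.fst ℝ V W) 0).congr fun v => by simp
  refine ⟨_, IsQuadratic.sum Finset.univ fun i => ((h1 i).add (hB' i)).const_mul (w i),
    fun v hv => ?_⟩
  simp only [LinearMap.coe_sum, Finset.sum_apply, LinearMap.smul_apply, LinearMap.add_apply,
    LinearMap.compl₁₂_apply, LinearMap.fst_apply, smul_eq_mul]
  refine Finset.sum_mul_pos_of_sum_eq_one hw hw1 fun i => ?_
  by_cases h : v.1 = 0
  · have h2 : v = (0, v.2) := Prod.ext h rfl
    have h3 : v.2 ≠ 0 := fun h' => hv (Prod.ext h h')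
    have h4 := hB'pos i _ h3
    rw [← h2] at h4
    simpa [h] using h4
  · linarith [hBpos i _ h, hB'nonneg i v]

namespace JumpGaussMarkov

variable {M d m : ℕ} (S : JumpGaussMarkov M d m) (y : ℕ → Fin m → ℝ)

/-- The real logarithm of the initial unnormalized density. -/
def logInit (x : Fin d → ℝ) (z : Fin M) : ℝ :=
  Real.log (S.obsLik 0 x z (y 0)) +
    (Real.log (S.modeInit z).toReal + Real.log (S.stateInit z x))

/-- The real logarithm of the unnormalized transition density. -/
def logTrans (t : ℕ) (x' : Fin d → ℝ) (z' : Fin M) (x : Fin d → ℝ) (z : Fin M) : ℝ :=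
  Real.log (S.obsLik (t + 1) x z (y (t + 1))) +
    (Real.log (S.modeTrans t z' z).toReal + Real.log (S.stateTrans t x' z' x))

/-- The real logarithm of the unnormalized path density. -/
def logPath (t : ℕ) (x : Fin (t + 1) → Fin d → ℝ) (z : Fin (t + 1) → Fin M) : ℝ :=
  S.logInit y (x 0) (z 0) +
    ∑ i : Fin t, S.logTrans y i (x i.castSucc) (z i.castSucc) (x i.succ) (z i.succ)

/-- The paths of modes of positive prior probability. -/
def ModePossible (t : ℕ) (z : Fin (t + 1) → Fin M) : Prop :=
  S.modeInit (z 0) ≠ 0 ∧ ∀ i : Fin t, S.modeTrans i (z i.castSucc) (z i.succ) ≠ 0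

theorem logPath_succ (t : ℕ) (x : Fin (t + 2) → Fin d → ℝ) (z : Fin (t + 2) → Fin M) :
    S.logPath y (t + 1) x z = S.logPath y t (Fin.init x) (Fin.init z) +
      S.logTrans y t (x (Fin.last t).castSucc) (z (Fin.last t).castSucc) (x (Fin.last (t + 1)))
        (z (Fin.last (t + 1))) := by
  simp only [logPath, Fin.sum_univ_castSucc, Fin.init, Fin.castSucc_zero, Fin.val_castSucc,
    Fin.val_last, Fin.succ_last, Fin.succ_castSucc]
  ring

theorem unnormPath_succ (t : ℕ) (x : Fin (t + 2) → Fin d → ℝ) (z : Fin (t + 2) → Fin M) :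
    S.unnormPath y (t + 1) x z = S.unnormPath y t (Fin.init x) (Fin.init z) *
      S.unnormTrans y t (x (Fin.last t).castSucc) (z (Fin.last t).castSucc) (x (Fin.last (t + 1)))
        (z (Fin.last (t + 1))) := by
  simp only [unnormPath, Fin.prod_univ_castSucc, Fin.init, Fin.castSucc_zero, Fin.val_castSucc,
    Fin.val_last, Fin.succ_last, Fin.succ_castSucc, mul_assoc]

theorem modePossible_succ (t : ℕ) (z : Fin (t + 2) → Fin M) :
    S.ModePossible (t + 1) z ↔ S.ModePossible t (Fin.init z) ∧
      S.modeTrans t (z (Fin.last t).castSucc) (z (Fin.last (t + 1))) ≠ 0 := by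
  simp only [ModePossible, Fin.forall_fin_succ', Fin.init, Fin.castSucc_zero, Fin.val_castSucc,
    Fin.val_last, Fin.succ_last, Fin.succ_castSucc, and_assoc]

theorem exists_modePossible (t : ℕ) : ∃ z, S.ModePossible t z := by
  induction t with
  | zero =>
    obtain ⟨z, hz⟩ := S.modeInit.support_nonempty
    exact ⟨fun _ => z, (S.modeInit.mem_support_iff z).mp hz, fun i => i.elim0⟩
  | succ t ih =>
    obtain ⟨z, hz⟩ := ih
    obtain ⟨z', hz'⟩ := (S.modeTrans t (z (Fin.last t))).support_nonempty
    refine ⟨Fin.snoc z z', (S.modePossible_succ t _).mpr ⟨?_, ?_⟩⟩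
    · rwa [Fin.init_snoc]
    · rw [Fin.snoc_castSucc, Fin.snoc_last]
      exact (PMF.mem_support_iff _ _).mp hz'

/-- The hypothesis is needed because `Real.log 0 = 0`: at forbidden modes `logInit` is still a
finite quadratic while the density vanishes. The same holds for `logTrans` and `logPath`, which lets
quadratic arguments run over all modes. -/
theorem unnormInit_eq_exp (x : Fin d → ℝ) {z : Fin M} (hz : S.modeInit z ≠ 0) :
    S.unnormInit y x z = ENNReal.ofReal (Real.exp (S.logInit y x z)) := by
  have h1 : 0 < S.obsLik 0 x z (y 0) := gaussianDensity_pos _ (S.obsCov_posDef 0 z) _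
  have h2 : 0 < S.stateInit z x := gaussianDensity_pos _ (S.initCov_posDef z) _
  have h3 : 0 < (S.modeInit z).toReal := ENNReal.toReal_pos hz (PMF.apply_ne_top _ _)
  rw [logInit, Real.exp_add, Real.exp_add, Real.exp_log h1, Real.exp_log h2, Real.exp_log h3,
    ENNReal.ofReal_mul h1.le, ENNReal.ofReal_mul h3.le, ENNReal.ofReal_toReal
    (PMF.apply_ne_top _ _), unnormInit]

theorem unnormTrans_eq_exp (t : ℕ) (x' x : Fin d → ℝ) {z' z : Fin M}
    (hz : S.modeTrans t z' z ≠ 0) :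
    S.unnormTrans y t x' z' x z = ENNReal.ofReal (Real.exp (S.logTrans y t x' z' x z)) := by
  have h1 : 0 < S.obsLik (t + 1) x z (y (t + 1)) := gaussianDensity_pos _ (S.obsCov_posDef _ z) _
  have h2 : 0 < S.stateTrans t x' z' x := gaussianDensity_pos _ (S.transCov_posDef t z') _
  have h3 : 0 < (S.modeTrans t z' z).toReal := ENNReal.toReal_pos hz (PMF.apply_ne_top _ _)
  rw [logTrans, Real.exp_add, Real.exp_add, Real.exp_log h1, Real.exp_log h2, Real.exp_log h3,
    ENNReal.ofReal_mul h1.le, ENNReal.ofReal_mul h3.le, ENNReal.ofReal_toReal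
    (PMF.apply_ne_top _ _), unnormTrans]

theorem unnormPath_eq_exp (t : ℕ) (x : Fin (t + 1) → Fin d → ℝ) {z : Fin (t + 1) → Fin M}
    (hz : S.ModePossible t z) :
    S.unnormPath y t x z = ENNReal.ofReal (Real.exp (S.logPath y t x z)) := by
  rw [unnormPath, logPath, Real.exp_add, ENNReal.ofReal_mul (Real.exp_pos _).le, Real.exp_sum,
    ENNReal.ofReal_prod_of_nonneg fun _ _ => (Real.exp_pos _).le, S.unnormInit_eq_exp y _ hz.1]
  congr 1
  exact Finset.prod_congr rfl fun i _ => S.unnormTrans_eq_exp y _ _ _ (hz.2 i)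

theorem unnormPath_eq_zero (t : ℕ) (x : Fin (t + 1) → Fin d → ℝ) {z : Fin (t + 1) → Fin M}
    (hz : ¬ S.ModePossible t z) : S.unnormPath y t x z = 0 := by
  rw [unnormPath]
  by_cases h : S.modeInit (z 0) = 0
  · simp [unnormInit, h]
  · have : ∃ i : Fin t, S.modeTrans i (z i.castSucc) (z i.succ) = 0 := by
      by_contra! h'
      exact hz ⟨h, h'⟩
    obtain ⟨i, hi⟩ := this
    rw [Finset.prod_eq_zero (Finset.mem_univ i), mul_zero]
    simp [unnormTrans, hi]

/-- The observation term is only semidefinite. Strictness in the new state comes from the positive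
definite transition noise when the old state's displacement is zero. -/
theorem isTransitionQuadratic_logTrans (t : ℕ) (z' z : Fin M) :
    IsTransitionQuadratic fun p : (Fin d → ℝ) × (Fin d → ℝ) => S.logTrans y t p.1 z' p.2 z := by
  let L₁ : (Fin d → ℝ) × (Fin d → ℝ) →ₗ[ℝ] (Fin m → ℝ) :=
    -(Matrix.toLin' (S.obsMat (t + 1) z) ∘ₗ LinearMap.snd ℝ _ _)
  let L₂ : (Fin d → ℝ) × (Fin d → ℝ) →ₗ[ℝ] (Fin d → ℝ) :=
    LinearMap.snd ℝ _ _ - (Matrix.toLin' (S.transMat t z') ∘ₗ LinearMap.fst ℝ _ _)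
  have h1 := isQuadratic_log_gaussianDensity_comp (S.obsCov_posDef (t + 1) z)
    (m := fun p : (Fin d → ℝ) × (Fin d → ℝ) =>
      (S.obsMat (t + 1) z).mulVec p.2 + S.obsShift (t + 1) z)
    (x := fun _ => y (t + 1)) L₁ (y (t + 1) - S.obsShift (t + 1) z) fun v => by
      simp only [L₁, LinearMap.neg_apply, LinearMap.comp_apply, LinearMap.snd_apply,
        Matrix.toLin'_apply]
      abel
  have h2 := isQuadratic_log_gaussianDensity_comp (S.transCov_posDef t z')
    (m := fun p : (Fin d → ℝ) × (Fin d → ℝ) =>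
      (S.transMat t z').mulVec p.1 + S.transShift t z')
    (x := fun p => p.2) L₂ (-S.transShift t z') fun v => by
      simp only [L₂, LinearMap.sub_apply, LinearMap.comp_apply, LinearMap.snd_apply,
        LinearMap.fst_apply, Matrix.toLin'_apply]
      abel
  refine ⟨_, h1.add ((isQuadratic_const _).add h2), fun v => ?_, fun x hx => ?_⟩
  · simp only [zero_add, LinearMap.add_apply, LinearMap.compl₁₂_apply]
    exact add_nonneg ((S.obsCov_posDef _ _).inv.toLinearMap₂'_nonneg _)
      ((S.transCov_posDef _ _).inv.toLinearMap₂'_nonneg _)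
  · simp only [zero_add, LinearMap.add_apply, LinearMap.compl₁₂_apply]
    refine add_pos_of_nonneg_of_pos ((S.obsCov_posDef _ _).inv.toLinearMap₂'_nonneg _)
      ((S.transCov_posDef _ _).inv.toLinearMap₂'_pos ?_)
    simpa [L₂] using hx

theorem isConcaveQuadratic_logInit (z : Fin M) :
    IsConcaveQuadratic fun x => S.logInit y x z := by
  have h1 := isQuadratic_log_gaussianDensity_comp (S.obsCov_posDef 0 z)
    (m := fun x : (Fin d → ℝ) => (S.obsMat 0 z).mulVec x + S.obsShift 0 z)
    (x := fun _ => y 0) (-(Matrix.toLin' (S.obsMat 0 z))) (y 0 - S.obsShift 0 z) fun v => by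
      simp only [LinearMap.neg_apply, Matrix.toLin'_apply]
      abel
  obtain ⟨B, hB, hpos⟩ := isConcaveQuadratic_log_gaussianDensity (S.initMean z)
    (S.initCov_posDef z)
  refine ⟨_, h1.add ((isQuadratic_const _).add hB), fun v hv => ?_⟩
  simp only [zero_add, LinearMap.add_apply, LinearMap.compl₁₂_apply]
  exact add_pos_of_nonneg_of_pos ((S.obsCov_posDef _ _).inv.toLinearMap₂'_nonneg _) (hpos v hv)

theorem exists_isQuadratic_logPath (t : ℕ) (z : Fin (t + 1) → Fin M) :
    ∃ B, IsQuadratic (fun x => S.logPath y t x z) B := by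
  obtain ⟨B, hB, -⟩ := S.isConcaveQuadratic_logInit y (z 0)
  have h : ∀ i : Fin t, ∃ B', IsQuadratic (fun x : Fin (t + 1) → Fin d → ℝ =>
      S.logTrans y i (x i.castSucc) (z i.castSucc) (x i.succ) (z i.succ)) B' := by
    intro i
    obtain ⟨B', hB', -⟩ := S.isTransitionQuadratic_logTrans y i (z i.castSucc) (z i.succ)
    exact ⟨_, (hB'.comp_affine ((LinearMap.proj i.castSucc).prod (LinearMap.proj i.succ))
      0).congr fun x => by simp⟩
  choose B' hB' using h
  have h0 : IsQuadratic (fun x : Fin (t + 1) → Fin d → ℝ => S.logInit y (x 0) (z 0)) _ :=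
    (hB.comp_affine (LinearMap.proj 0) 0).congr fun x => by simp
  exact ⟨_, h0.add (IsQuadratic.sum Finset.univ hB')⟩

/-- An average of log densities over mode paths is the log density of a Gauss--Markov chain. -/
theorem exists_gaussian_chain {ι : Type*} [Fintype ι] {w : ι → ℝ} (hw : ∀ i, 0 ≤ w i)
    (hw1 : ∑ i, w i = 1) (t : ℕ) (ζ : ι → Fin (t + 1) → Fin M) :
    ∃ (β : (Fin d → ℝ) → ℝ) (A : ℕ → Matrix (Fin d) (Fin d) ℝ) (a : ℕ → Fin d → ℝ)
      (P : ℕ → Matrix (Fin d) (Fin d) ℝ), IsConcaveQuadratic β ∧ (∀ s, (P s).PosDef) ∧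
      ∀ x : Fin (t + 1) → Fin d → ℝ, ∑ i, w i * S.logPath y t x (ζ i) = β (x (Fin.last t)) +
        ∑ s : Fin t, Real.log (gaussianDensity ((A s).mulVec (x s.succ) + a s) (P s)
          (x s.castSucc)) := by
  induction t with
  | zero =>
    refine ⟨fun x => ∑ i, w i * S.logInit y x (ζ i 0), 0, 0, 1, ?_, fun s => Matrix.PosDef.one,
      fun x => ?_⟩
    · choose B hB hpos using fun i => S.isConcaveQuadratic_logInit y (ζ i 0)
      refine ⟨_, IsQuadratic.sum Finset.univ fun i => (hB i).const_mul (w i), fun v hv => ?_⟩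
      simp only [LinearMap.coe_sum, Finset.sum_apply, LinearMap.smul_apply, smul_eq_mul]
      exact Finset.sum_mul_pos_of_sum_eq_one hw hw1 fun i => hpos i v hv
    · simp [logPath]
  | succ t ih =>
    -- The index set and the weights stay fixed while the paths are truncated, so no marginalization
    -- of `w` is needed.
    obtain ⟨β, A, a, P, hβ, hP, heq⟩ := ih fun i => Fin.init (ζ i)
    have hq := isConcaveQuadratic_weighted_sum hw hw1 (fun _ => hβ) fun i =>
      S.isTransitionQuadratic_logTrans y t (ζ i (Fin.last t).castSucc) (ζ i (Fin.last (t + 1)))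
    -- The old remainder `β` and the averaged new transition form a strictly concave quadratic in
    -- the pair of states. Splitting off the older state yields the next reverse kernel and a new
    -- remainder.
    obtain ⟨A', a', P', β', hP', hβ', heq'⟩ := hq.exists_gaussian_kernel
    refine ⟨β', Function.update A t A', Function.update a t a', Function.update P t P', hβ',
      fun s => ?_, fun x => ?_⟩
    · rcases eq_or_ne s t with rfl | hs
      · simpa using hP'
      · simpa [hs] using hP s
    · have h1 := heq (Fin.init x)
      have h2 := heq' (x (Fin.last t).castSucc) (x (Fin.last (t + 1)))
      simp only [mul_add, Finset.sum_add_distrib, ← Finset.sum_mul, hw1, one_mul] at h2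
      simp only [logPath_succ, mul_add, Finset.sum_add_distrib, h1, Fin.sum_univ_castSucc,
        Fin.val_castSucc, Fin.val_last, Fin.succ_last, Fin.succ_castSucc, Function.update_self,
        Fin.init]
      have h3 : ∀ s : Fin t, (s : ℕ) ≠ t := fun s => s.2.ne
      simp only [ne_eq, h3, not_false_eq_true, Function.update_of_ne]
      linarith

end JumpGaussMarkov

end Chain


/-! ### Measures with a product density on states and modes. -/

section FactoredMeasure

variable {X Z : Type*} [MeasurableSpace X] [MeasurableSpace Z] [Finite Z]
  [MeasurableSingletonClass Z] {μ : Measure X}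

/-- The measure on `X × Z` with density `g(x) f(z)` with respect to `μ` times counting measure. -/
def factoredMeasure (μ : Measure X) (g : X → ℝ≥0∞) (f : Z → ℝ≥0∞) : Measure (X × Z) :=
  (μ.prod Measure.count).withDensity fun p => g p.1 * f p.2

theorem lintegral_factoredMeasure [Fintype Z] [SFinite μ] {g : X → ℝ≥0∞} (hg : Measurable g)
    (f : Z → ℝ≥0∞) {F : X × Z → ℝ≥0∞} (hF : Measurable F) :
    ∫⁻ p, F p ∂factoredMeasure μ g f = ∑ z, f z * ∫⁻ x, g x * F (x, z) ∂μ := by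
  have hf : Measurable f := measurable_of_finite f
  rw [factoredMeasure, lintegral_withDensity_eq_lintegral_mul _ (by fun_prop) hF,
    lintegral_prod_symm _ (by fun_prop), lintegral_count, tsum_fintype]
  refine Finset.sum_congr rfl fun z _ => ?_
  rw [← lintegral_const_mul _ (by fun_prop)]
  simp only [Pi.mul_apply]
  refine lintegral_congr fun x => ?_
  ring

/-- `Φ` need not be measurable: the exceptional set is covered by finitely many products of a null
set with a singleton. -/
theorem ae_factoredMeasure {g : X → ℝ≥0∞} (hg : Measurable g) (f : Z → ℝ≥0∞)
    {Φ : X × Z → Prop} (h : ∀ z, f z ≠ 0 → ∀ᵐ x ∂μ, g x ≠ 0 → Φ (x, z)) :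
    ∀ᵐ p ∂factoredMeasure μ g f, Φ p := by
  have hf : Measurable f := measurable_of_finite f
  rw [factoredMeasure, ae_withDensity_iff (by fun_prop)]
  have h' : ∀ z, ∀ᵐ x ∂μ, g x * f z ≠ 0 → Φ (x, z) := by
    intro z
    by_cases hz : f z = 0
    · simp [hz]
    · filter_upwards [h z hz] with x hx hne
      exact hx (left_ne_zero_of_mul hne)
  rw [ae_iff]
  refine measure_mono_null (t := ⋃ z, {x | ¬ (g x * f z ≠ 0 → Φ (x, z))} ×ˢ {z}) ?_ ?_
  · rintro ⟨x, z⟩ hx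
    simp only [Set.mem_iUnion, Set.mem_prod, Set.mem_singleton_iff]
    exact ⟨z, hx, rfl⟩
  · refine measure_iUnion_null fun z => ?_
    rw [Measure.prod_prod, ae_iff.mp (h' z), zero_mul]

theorem isProbabilityMeasure_factoredMeasure [Fintype Z] [SFinite μ] {g : X → ℝ≥0∞} (hg : Measurable g)
    (hg1 : ∫⁻ x, g x ∂μ = 1) {f : Z → ℝ≥0∞} (hf1 : ∑ z, f z = 1) :
    IsProbabilityMeasure (factoredMeasure μ g f) := by
  refine ⟨?_⟩
  rw [← lintegral_one, lintegral_factoredMeasure hg f measurable_const]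
  simp [hg1, hf1]

theorem hiddenPathMeasure_eq {M d t : ℕ} (g : (Fin (t + 1) → Fin d → ℝ) → ℝ≥0∞)
    (f : (Fin (t + 1) → Fin M) → ℝ≥0∞) :
    hiddenPathMeasure t g f = factoredMeasure volume g f := rfl

theorem hiddenMeasure_eq {M d : ℕ} (g : (Fin d → ℝ) → ℝ≥0∞) (f : Fin M → ℝ≥0∞) :
    hiddenMeasure g f = factoredMeasure volume g f := rfl

end FactoredMeasure

/-! ### Splitting off the last coordinate of a path. -/

section PathSplit

variable {E : Type*} [MeasureSpace E] [SigmaFinite (volume : Measure E)] {n : ℕ}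

@[fun_prop]
theorem Measurable.fin_snoc {E : Type*} [MeasurableSpace E] {X : Type*} [MeasurableSpace X] {u : X → Fin n → E} {v : X → E}
    (hu : Measurable u) (hv : Measurable v) :
    Measurable fun x => (Fin.snoc (u x) (v x) : Fin (n + 1) → E) := by
  refine measurable_pi_iff.mpr fun i => ?_
  refine Fin.lastCases ?_ (fun i => ?_) i
  · simpa using hv
  · simpa using hu.eval (a := i)

@[fun_prop]
theorem Measurable.fin_init {E : Type*} [MeasurableSpace E] {X : Type*} [MeasurableSpace X]
    {u : X → Fin (n + 1) → E} (hu : Measurable u) :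
    Measurable fun x => (Fin.init (u x) : Fin n → E) :=
  measurable_pi_iff.mpr fun i => hu.eval (a := i.castSucc)

theorem measurePreserving_fin_snoc (E : Type*) [MeasureSpace E]
    [SigmaFinite (volume : Measure E)] (n : ℕ) :
    MeasurePreserving (fun p : E × (Fin n → E) => (Fin.snoc p.2 p.1 : Fin (n + 1) → E)) := by
  have h := (volume_preserving_piFinSuccAbove (fun _ : Fin (n + 1) => E) (Fin.last n)).symm
  have e : (fun p : E × (Fin n → E) => (Fin.snoc p.2 p.1 : Fin (n + 1) → E)) =
      (MeasurableEquiv.piFinSuccAbove (fun _ : Fin (n + 1) => E) (Fin.last n)).symm := by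
    funext p
    exact (Fin.insertNth_last' p.1 p.2).symm
  rw [e]
  exact h

theorem lintegral_pi_fin_succ {F : (Fin (n + 1) → E) → ℝ≥0∞} (hF : Measurable F) :
    ∫⁻ x, F x = ∫⁻ a : E, ∫⁻ p : Fin n → E, F (Fin.snoc p a) := by
  rw [← (measurePreserving_fin_snoc E n).lintegral_comp hF, Measure.volume_eq_prod,
    lintegral_prod _ (by fun_prop)]

theorem ae_pi_fin_succ {Φ : (Fin (n + 1) → E) → Prop} (h : ∀ᵐ x, Φ x) :
    ∀ᵐ a : E, ∀ᵐ p : Fin n → E, Φ (Fin.snoc p a) :=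
  Measure.ae_ae_of_ae_prod ((measurePreserving_fin_snoc E n).quasiMeasurePreserving.ae h)

theorem sum_pi_fin_succ {Z A : Type*} [Fintype Z] [AddCommMonoid A] (F : (Fin (n + 1) → Z) → A) :
    ∑ z, F z = ∑ c : Z, ∑ r : Fin n → Z, F (Fin.snoc r c) := by
  rw [← Fintype.sum_prod_type', ← (Fin.snocEquiv fun _ : Fin (n + 1) => Z).sum_comp]
  rfl

end PathSplit

/-! ### Laws of reverse-time chains and their marginals. -/

namespace ReverseKernels

variable {M d : ℕ} (q : ReverseKernels M d)

@[fun_prop]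
theorem measurable_gRev_comp {X : Type*} [MeasurableSpace X] (t : ℕ) {u v : X → Fin d → ℝ}
    (hu : Measurable u) (hv : Measurable v) : Measurable fun x => q.gRev t (u x) (v x) :=
  (q.gRev_measurable t).comp (hu.prodMk hv)

@[fun_prop]
theorem measurable_gCond (t : ℕ) : Measurable (q.gCond t) :=
  Finset.measurable_prod _ fun i _ => q.measurable_gRev_comp i (measurable_pi_apply _)
    (measurable_pi_apply _)

theorem gCond_succ (t : ℕ) (x : Fin (t + 2) → Fin d → ℝ) :
    q.gCond (t + 1) x = q.gRev t (x (Fin.last (t + 1))) (x (Fin.last t).castSucc) *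
      q.gCond t (Fin.init x) := by
  simp only [gCond, Fin.prod_univ_castSucc, Fin.init, Fin.val_castSucc,
    Fin.val_last, Fin.succ_last, Fin.succ_castSucc]
  rw [mul_comm]

theorem fCond_succ (t : ℕ) (z : Fin (t + 2) → Fin M) :
    q.fCond (t + 1) z = q.fRev t (z (Fin.last (t + 1))) (z (Fin.last t).castSucc) *
      q.fCond t (Fin.init z) := by
  simp only [fCond, Fin.prod_univ_castSucc, Fin.init, Fin.val_castSucc,
    Fin.val_last, Fin.succ_last, Fin.succ_castSucc]
  rw [mul_comm]

theorem gCond_snoc (t : ℕ) (p : Fin (t + 1) → Fin d → ℝ) (a : Fin d → ℝ) :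
    q.gCond (t + 1) (Fin.snoc p a) = q.gRev t a (p (Fin.last t)) * q.gCond t p := by
  rw [gCond_succ, Fin.init_snoc, Fin.snoc_last, Fin.snoc_castSucc]

theorem fCond_snoc (t : ℕ) (r : Fin (t + 1) → Fin M) (c : Fin M) :
    q.fCond (t + 1) (Fin.snoc r c) = q.fRev t c (r (Fin.last t)) * q.fCond t r := by
  rw [fCond_succ, Fin.init_snoc, Fin.snoc_last, Fin.snoc_castSucc]

theorem lintegral_gChain_zero {g : (Fin d → ℝ) → ℝ≥0∞} (hg : Measurable g)
    {F : (Fin 1 → Fin d → ℝ) → ℝ≥0∞} (hF : Measurable F) :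
    ∫⁻ x : Fin 1 → Fin d → ℝ, g (x (Fin.last 0)) * q.gCond 0 x * F x =
      ∫⁻ a, g a * F (fun _ => a) := by
  rw [lintegral_pi_fin_succ (by fun_prop)]
  refine lintegral_congr fun a => ?_
  have h : ∀ p : Fin 0 → Fin d → ℝ, (Fin.snoc p a : Fin 1 → Fin d → ℝ) = fun _ => a := by
    intro p; funext i; obtain rfl : i = Fin.last 0 := Fin.ext (by omega)
    exact Fin.snoc_last _ _
  simp [h, gCond, volume_pi]

theorem lintegral_gChain_succ (t : ℕ) {g : (Fin d → ℝ) → ℝ≥0∞} (hg : Measurable g)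
    {F : (Fin (t + 2) → Fin d → ℝ) → ℝ≥0∞} (hF : Measurable F) :
    ∫⁻ x : Fin (t + 2) → Fin d → ℝ, g (x (Fin.last (t + 1))) * q.gCond (t + 1) x * F x =
      ∫⁻ a, g a * ∫⁻ p : Fin (t + 1) → Fin d → ℝ,
        q.gRev t a (p (Fin.last t)) * q.gCond t p * F (Fin.snoc p a) := by
  rw [lintegral_pi_fin_succ (by fun_prop)]
  refine lintegral_congr fun a => ?_
  rw [← lintegral_const_mul _ (by fun_prop)]
  refine lintegral_congr fun p => ?_
  rw [Fin.snoc_last, gCond_snoc]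
  ring

/-- Given the final state `a`, the rest is a shorter chain with final density `gRev t a`. This is
why the final density is an arbitrary `g` here and in the other chain lemmas. -/
theorem lintegral_gChain (t : ℕ) {g : (Fin d → ℝ) → ℝ≥0∞} (hg : Measurable g)
    (hg1 : ∫⁻ x, g x = 1) :
    ∫⁻ x : Fin (t + 1) → Fin d → ℝ, g (x (Fin.last t)) * q.gCond t x = 1 := by
  induction t generalizing g with
  | zero =>
    have := q.lintegral_gChain_zero hg (F := 1) measurable_const
    simpa [hg1] using this
  | succ t ih =>
    have := q.lintegral_gChain_succ t hg (F := 1) measurable_const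
    simp only [Pi.one_apply, mul_one] at this
    rw [this]
    simp_rw [fun a => ih (g := q.gRev t a) (by fun_prop) (q.gRev_lintegral t a), mul_one, hg1]

theorem sum_fChain_succ (t : ℕ) (f : Fin M → ℝ≥0∞) (F : (Fin (t + 2) → Fin M) → ℝ≥0∞) :
    ∑ z : Fin (t + 2) → Fin M, f (z (Fin.last (t + 1))) * q.fCond (t + 1) z * F z =
      ∑ c, f c * ∑ r : Fin (t + 1) → Fin M,
        q.fRev t c (r (Fin.last t)) * q.fCond t r * F (Fin.snoc r c) := by
  rw [sum_pi_fin_succ]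
  refine Finset.sum_congr rfl fun c _ => ?_
  rw [Finset.mul_sum]
  refine Finset.sum_congr rfl fun r _ => ?_
  rw [Fin.snoc_last, fCond_snoc]
  ring

theorem _root_.PMF.sum_eq_one {ι : Type*} [Fintype ι] (p : PMF ι) : ∑ i, p i = 1 :=
  (tsum_fintype _).symm.trans p.tsum_coe

theorem sum_fChain (t : ℕ) {f : Fin M → ℝ≥0∞} (hf1 : ∑ z, f z = 1) :
    ∑ z : Fin (t + 1) → Fin M, f (z (Fin.last t)) * q.fCond t z = 1 := by
  induction t generalizing f with
  | zero =>
    rw [← hf1, ← (Equiv.funUnique (Fin 1) (Fin M)).symm.sum_comp]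
    refine Finset.sum_congr rfl fun a _ => ?_
    simp only [fCond, Finset.univ_eq_empty, Finset.prod_empty, mul_one]
    rfl
  | succ t ih =>
    have := q.sum_fChain_succ t f 1
    simp only [Pi.one_apply, mul_one] at this
    rw [this]
    simp_rw [fun c => ih (f := q.fRev t c) (PMF.sum_eq_one _), mul_one, hf1]

/-- The law on hidden paths up to time `t` with final law `g(x) f(z)` and the reverse-time
kernels `q`. -/
def chainMeasure (t : ℕ) (g : (Fin d → ℝ) → ℝ≥0∞) (f : Fin M → ℝ≥0∞) :
    Measure ((Fin (t + 1) → Fin d → ℝ) × (Fin (t + 1) → Fin M)) :=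
  hiddenPathMeasure t (fun x => g (x (Fin.last t)) * q.gCond t x)
    (fun z => f (z (Fin.last t)) * q.fCond t z)

theorem lintegral_chainMeasure (t : ℕ) {g : (Fin d → ℝ) → ℝ≥0∞} (hg : Measurable g)
    (f : Fin M → ℝ≥0∞) {F : (Fin (t + 1) → Fin d → ℝ) × (Fin (t + 1) → Fin M) → ℝ≥0∞}
    (hF : Measurable F) :
    ∫⁻ p, F p ∂q.chainMeasure t g f = ∑ z, f (z (Fin.last t)) * q.fCond t z *
      ∫⁻ x : Fin (t + 1) → Fin d → ℝ, g (x (Fin.last t)) * q.gCond t x * F (x, z) := by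
  rw [chainMeasure, hiddenPathMeasure_eq]
  exact lintegral_factoredMeasure (μ := volume)
    (g := fun x : Fin (t + 1) → Fin d → ℝ => g (x (Fin.last t)) * q.gCond t x) (by fun_prop)
    (fun z : Fin (t + 1) → Fin M => f (z (Fin.last t)) * q.fCond t z) hF

theorem _root_.lintegral_hiddenMeasure {g : (Fin d → ℝ) → ℝ≥0∞} (hg : Measurable g)
    (f : Fin M → ℝ≥0∞) {F : (Fin d → ℝ) × Fin M → ℝ≥0∞} (hF : Measurable F) :
    ∫⁻ p, F p ∂hiddenMeasure g f = ∑ z, f z * ∫⁻ x, g x * F (x, z) :=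
  lintegral_factoredMeasure hg f hF

theorem lintegral_chainMeasure_zero {g : (Fin d → ℝ) → ℝ≥0∞} (hg : Measurable g)
    (f : Fin M → ℝ≥0∞) {F : (Fin 1 → Fin d → ℝ) × (Fin 1 → Fin M) → ℝ≥0∞}
    (hF : Measurable F) :
    ∫⁻ p, F p ∂q.chainMeasure 0 g f =
      ∫⁻ p, F (fun _ => p.1, fun _ => p.2) ∂hiddenMeasure g f := by
  rw [lintegral_chainMeasure q 0 hg f hF, lintegral_hiddenMeasure hg f (by fun_prop),
    ← (Equiv.funUnique (Fin 1) (Fin M)).symm.sum_comp]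
  refine Finset.sum_congr rfl fun z _ => ?_
  rw [q.lintegral_gChain_zero hg (F := fun x => F (x, _)) (by fun_prop)]
  simp only [fCond, Finset.univ_eq_empty, Finset.prod_empty, mul_one]
  rfl

theorem lintegral_chainMeasure_succ (t : ℕ) {g : (Fin d → ℝ) → ℝ≥0∞} (hg : Measurable g)
    (f : Fin M → ℝ≥0∞) {F : (Fin (t + 2) → Fin d → ℝ) × (Fin (t + 2) → Fin M) → ℝ≥0∞}
    (hF : Measurable F) :
    ∫⁻ p, F p ∂q.chainMeasure (t + 1) g f =
      ∑ c, f c * ∫⁻ a, g a *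
        ∫⁻ p, F (Fin.snoc p.1 a, Fin.snoc p.2 c) ∂q.chainMeasure t (q.gRev t a) (q.fRev t c) := by
  rw [lintegral_chainMeasure q _ hg f hF, sum_fChain_succ q t f fun z =>
    ∫⁻ x : Fin (t + 2) → Fin d → ℝ, g (x (Fin.last (t + 1))) * q.gCond (t + 1) x * F (x, z)]
  refine Finset.sum_congr rfl fun c _ => ?_
  congr 1
  have h1 : ∀ a, ∫⁻ p, F (Fin.snoc p.1 a, Fin.snoc p.2 c)
      ∂q.chainMeasure t (q.gRev t a) (q.fRev t c) = ∑ r : Fin (t + 1) → Fin M,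
        q.fRev t c (r (Fin.last t)) * q.fCond t r * ∫⁻ p : Fin (t + 1) → Fin d → ℝ,
          q.gRev t a (p (Fin.last t)) * q.gCond t p * F (Fin.snoc p a, Fin.snoc r c) := by
    intro a
    exact q.lintegral_chainMeasure t (by fun_prop) _ (by fun_prop)
  simp_rw [h1, Finset.mul_sum]
  have hm : ∀ r : Fin (t + 1) → Fin M, Measurable fun a => ∫⁻ p : Fin (t + 1) → Fin d → ℝ,
      q.gRev t a (p (Fin.last t)) * q.gCond t p * F (Fin.snoc p a, Fin.snoc r c) := by
    intro r
    refine Measurable.lintegral_prod_right' (f := fun (s : (Fin d → ℝ) × (Fin (t + 1) → Fin d → ℝ)) => q.gRev t s.1 (s.2 (Fin.last t)) * q.gCond t s.2 * F (Fin.snoc s.2 s.1, Fin.snoc r c)) ?_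
    fun_prop
  rw [lintegral_finsetSum]
  swap
  · exact fun r _ => hg.mul ((hm r).const_mul _)
  refine Finset.sum_congr rfl fun r _ => ?_
  rw [q.lintegral_gChain_succ t hg (F := fun x => F (x, Fin.snoc r c)) (by fun_prop),
    ← lintegral_const_mul]
  swap
  · exact hg.mul (hm r)
  refine lintegral_congr fun a => ?_
  ring

theorem isProbabilityMeasure_chainMeasure (t : ℕ) {g : (Fin d → ℝ) → ℝ≥0∞} (hg : Measurable g)
    (hg1 : ∫⁻ x, g x = 1) {f : Fin M → ℝ≥0∞} (hf1 : ∑ z, f z = 1) :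
    IsProbabilityMeasure (q.chainMeasure t g f) := by
  rw [chainMeasure, hiddenPathMeasure_eq]
  exact isProbabilityMeasure_factoredMeasure (μ := volume)
    (g := fun x : Fin (t + 1) → Fin d → ℝ => g (x (Fin.last t)) * q.gCond t x) (by fun_prop)
    (q.lintegral_gChain t hg hg1) (q.sum_fChain t hf1)

theorem lintegral_chainMeasure_last (t : ℕ) {g : (Fin d → ℝ) → ℝ≥0∞} (hg : Measurable g)
    (f : Fin M → ℝ≥0∞) {F : (Fin d → ℝ) × Fin M → ℝ≥0∞} (hF : Measurable F) :
    ∫⁻ p, F (p.1 (Fin.last t), p.2 (Fin.last t)) ∂q.chainMeasure t g f =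
      ∫⁻ p, F p ∂hiddenMeasure g f := by
  cases t with
  | zero => exact q.lintegral_chainMeasure_zero hg f (by fun_prop)
  | succ t =>
    rw [q.lintegral_chainMeasure_succ t hg f (by fun_prop), lintegral_hiddenMeasure hg f hF]
    simp only [Fin.snoc_last, lintegral_const]
    refine Finset.sum_congr rfl fun c _ => ?_
    congr 1
    refine lintegral_congr fun a => ?_
    have := q.isProbabilityMeasure_chainMeasure t (g := q.gRev t a) (by fun_prop)
      (q.gRev_lintegral t a) (f := q.fRev t c) (PMF.sum_eq_one _)
    rw [measure_univ, mul_one]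

theorem lintegral_chainMeasure_last_two (t : ℕ) {g : (Fin d → ℝ) → ℝ≥0∞} (hg : Measurable g)
    (f : Fin M → ℝ≥0∞) {F : ((Fin d → ℝ) × Fin M) × ((Fin d → ℝ) × Fin M) → ℝ≥0∞}
    (hF : Measurable F) :
    ∫⁻ p, F ((p.1 (Fin.last (t + 1)), p.2 (Fin.last (t + 1))),
        (p.1 (Fin.last t).castSucc, p.2 (Fin.last t).castSucc)) ∂q.chainMeasure (t + 1) g f =
      ∑ c, f c * ∫⁻ a, g a * ∫⁻ p', F ((a, c), p') ∂hiddenMeasure (q.gRev t a) (q.fRev t c) := by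
  rw [q.lintegral_chainMeasure_succ t hg f (by fun_prop)]
  simp only [Fin.snoc_last, Fin.snoc_castSucc]
  refine Finset.sum_congr rfl fun c _ => ?_
  congr 1
  refine lintegral_congr fun a => ?_
  rw [q.lintegral_chainMeasure_last t (g := q.gRev t a) (by fun_prop) (q.fRev t c)
    (F := fun p' => F ((a, c), p')) (by fun_prop)]

/-- The continuous marginal at time `t`, given the continuous marginal `g` at time `t + 1`. -/
def gStep (t : ℕ) (g : (Fin d → ℝ) → ℝ≥0∞) : (Fin d → ℝ) → ℝ≥0∞ :=
  fun x' => ∫⁻ x, q.gRev t x x' * g x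

/-- The discrete marginal at time `t`, given the discrete marginal `f` at time `t + 1`. -/
def fStep (t : ℕ) (f : Fin M → ℝ≥0∞) : Fin M → ℝ≥0∞ :=
  fun z' => ∑ z, q.fRev t z z' * f z

theorem measurable_gStep (t : ℕ) {g : (Fin d → ℝ) → ℝ≥0∞} (hg : Measurable g) :
    Measurable (q.gStep t g) := by
  refine Measurable.lintegral_prod_right'
    (f := fun s : (Fin d → ℝ) × (Fin d → ℝ) => q.gRev t s.2 s.1 * g s.2) ?_
  fun_prop

theorem lintegral_gStep_mul (t : ℕ) {g : (Fin d → ℝ) → ℝ≥0∞} (hg : Measurable g)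
    {F : (Fin d → ℝ) → ℝ≥0∞} (hF : Measurable F) :
    ∫⁻ x', q.gStep t g x' * F x' = ∫⁻ x, g x * ∫⁻ x', q.gRev t x x' * F x' := by
  simp only [gStep]
  simp_rw [fun x' => (lintegral_mul_const (μ := volume) (F x')
    (f := fun x => q.gRev t x x' * g x) (by fun_prop)).symm,
    fun x => (lintegral_const_mul (μ := volume) (g x)
    (f := fun x' => q.gRev t x x' * F x') (by fun_prop)).symm]
  rw [lintegral_lintegral_swap (by fun_prop)]
  refine lintegral_congr fun x => lintegral_congr fun x' => ?_
  ring

theorem lintegral_gStep (t : ℕ) {g : (Fin d → ℝ) → ℝ≥0∞} (hg : Measurable g)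
    (hg1 : ∫⁻ x, g x = 1) : ∫⁻ x', q.gStep t g x' = 1 := by
  have := q.lintegral_gStep_mul t hg (F := 1) measurable_const
  simpa [q.gRev_lintegral, hg1] using this

theorem sum_fStep (t : ℕ) {f : Fin M → ℝ≥0∞} (hf1 : ∑ z, f z = 1) :
    ∑ z', q.fStep t f z' = 1 := by
  simp only [fStep]
  rw [Finset.sum_comm]
  simp_rw [← Finset.sum_mul, PMF.sum_eq_one, one_mul, hf1]

/-- Forgetting the final state leaves a chain of the same product form, since states and modes
evolve independently and their marginals step back separately. -/
theorem lintegral_chainMeasure_init (t : ℕ) {g : (Fin d → ℝ) → ℝ≥0∞} (hg : Measurable g)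
    (f : Fin M → ℝ≥0∞) {F : (Fin (t + 1) → Fin d → ℝ) × (Fin (t + 1) → Fin M) → ℝ≥0∞}
    (hF : Measurable F) :
    ∫⁻ p, F (Fin.init p.1, Fin.init p.2) ∂q.chainMeasure (t + 1) g f =
      ∫⁻ p, F p ∂q.chainMeasure t (q.gStep t g) (q.fStep t f) := by
  rw [q.lintegral_chainMeasure_succ t hg f (by fun_prop),
    q.lintegral_chainMeasure t (q.measurable_gStep t hg) _ hF]
  have h1 : ∀ c a, ∫⁻ p, F (Fin.init (Fin.snoc p.1 a : Fin (t + 2) → Fin d → ℝ),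
      Fin.init (Fin.snoc p.2 c : Fin (t + 2) → Fin M))
      ∂q.chainMeasure t (q.gRev t a) (q.fRev t c) = ∑ r : Fin (t + 1) → Fin M,
        q.fRev t c (r (Fin.last t)) * q.fCond t r * ∫⁻ p : Fin (t + 1) → Fin d → ℝ,
          q.gRev t a (p (Fin.last t)) * q.gCond t p * F (p, r) := by
    intro c a
    simp only [Fin.init_snoc]
    exact q.lintegral_chainMeasure t (by fun_prop) _ hF
  simp_rw [h1]
  have hm : ∀ r : Fin (t + 1) → Fin M, Measurable fun a => ∫⁻ p : Fin (t + 1) → Fin d → ℝ,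
      q.gRev t a (p (Fin.last t)) * q.gCond t p * F (p, r) := by
    intro r
    refine Measurable.lintegral_prod_right' (f := fun (s : (Fin d → ℝ) ×
      (Fin (t + 1) → Fin d → ℝ)) => q.gRev t s.1 (s.2 (Fin.last t)) * q.gCond t s.2 *
        F (s.2, r)) ?_
    fun_prop
  have h2 : ∀ r : Fin (t + 1) → Fin M, ∫⁻ x : Fin (t + 1) → Fin d → ℝ,
      q.gStep t g (x (Fin.last t)) * q.gCond t x * F (x, r) =
      ∫⁻ a, g a * ∫⁻ p : Fin (t + 1) → Fin d → ℝ,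
        q.gRev t a (p (Fin.last t)) * q.gCond t p * F (p, r) := by
    intro r
    simp only [gStep]
    have e1 : ∀ x : Fin (t + 1) → Fin d → ℝ,
        (∫⁻ a, q.gRev t a (x (Fin.last t)) * g a) * q.gCond t x * F (x, r) =
        ∫⁻ a, q.gRev t a (x (Fin.last t)) * g a * (q.gCond t x * F (x, r)) := by
      intro x
      rw [lintegral_mul_const _ (by fun_prop), mul_assoc]
    have e2 : ∀ a, g a * ∫⁻ p : Fin (t + 1) → Fin d → ℝ,
        q.gRev t a (p (Fin.last t)) * q.gCond t p * F (p, r) =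
        ∫⁻ p : Fin (t + 1) → Fin d → ℝ,
          g a * (q.gRev t a (p (Fin.last t)) * q.gCond t p * F (p, r)) := by
      intro a
      rw [lintegral_const_mul _ (by fun_prop)]
    simp_rw [e1, e2]
    rw [lintegral_lintegral_swap (by fun_prop)]
    refine lintegral_congr fun x => lintegral_congr fun x' => ?_
    ring
  simp_rw [h2]
  have h3 : ∀ c, f c * ∫⁻ a, g a * ∑ r : Fin (t + 1) → Fin M,
        q.fRev t c (r (Fin.last t)) * q.fCond t r * ∫⁻ p : Fin (t + 1) → Fin d → ℝ,
          q.gRev t a (p (Fin.last t)) * q.gCond t p * F (p, r) =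
      ∑ r : Fin (t + 1) → Fin M, f c * (q.fRev t c (r (Fin.last t)) * q.fCond t r *
        ∫⁻ a, g a * ∫⁻ p : Fin (t + 1) → Fin d → ℝ,
          q.gRev t a (p (Fin.last t)) * q.gCond t p * F (p, r)) := by
    intro c
    rw [← Finset.mul_sum]
    congr 1
    simp_rw [Finset.mul_sum]
    rw [lintegral_finsetSum]
    swap
    · exact fun r _ => hg.mul ((hm r).const_mul _)
    refine Finset.sum_congr rfl fun r _ => ?_
    rw [← lintegral_const_mul]
    swap
    · exact hg.mul (hm r)
    refine lintegral_congr fun a => ?_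
    ring
  simp_rw [h3]
  rw [Finset.sum_comm]
  refine Finset.sum_congr rfl fun r _ => ?_
  simp only [fStep, Finset.sum_mul]
  refine Finset.sum_congr rfl fun c _ => ?_
  ring

end ReverseKernels


/-! ### Calculus of the extended integral. -/

section ExtIntegral

variable {Ω : Type*} [MeasurableSpace Ω] {μ : Measure Ω}

theorem extIntegral_congr_ae {F G : Ω → EReal} (h : F =ᵐ[μ] G) :
    extIntegral μ F = extIntegral μ G := by
  unfold extIntegral
  congr 2
  · exact lintegral_congr_ae (h.mono fun ω hω => by simp only [hω])
  · exact lintegral_congr_ae (h.mono fun ω hω => by simp only [hω])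

theorem ENNReal.coe_sub_coe_eq_toReal {a b : ℝ≥0∞} (ha : a ≠ ∞) (hb : b ≠ ∞) :
    (a : EReal) - (b : EReal) = ((a.toReal - b.toReal : ℝ) : EReal) := by
  lift a to NNReal using ha
  lift b to NNReal using hb
  rfl

theorem EReal.toENNReal_neg_coe (x : ℝ) : (-(x : EReal)).toENNReal = ENNReal.ofReal (-x) := by
  rw [← EReal.coe_neg, EReal.real_coe_toENNReal]

theorem extIntegral_coe {f : Ω → ℝ} (hf : Integrable f μ) :
    extIntegral μ (fun ω => (f ω : EReal)) = ((∫ ω, f ω ∂μ : ℝ) : EReal) := by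
  unfold extIntegral
  simp only [EReal.real_coe_toENNReal, EReal.toENNReal_neg_coe]
  have hneg : ∫⁻ ω, ENNReal.ofReal (-f ω) ∂μ ≠ ∞ := hf.neg.lintegral_lt_top.ne
  rw [ENNReal.coe_sub_coe_eq_toReal hf.lintegral_lt_top.ne hneg,
    integral_eq_lintegral_pos_part_sub_lintegral_neg_part hf]

/-- Subtracting `⊤` gives `⊥` in `EReal` whatever the minuend, so nothing is required of the
positive part. -/
theorem extIntegral_eq_bot {F : Ω → EReal} (h : ∫⁻ ω, (-F ω).toENNReal ∂μ = ∞) :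
    extIntegral μ F = ⊥ := by
  rw [extIntegral, h]
  exact EReal.sub_top _

theorem extIntegral_comp {Ω' : Type*} [MeasurableSpace Ω'] {ν : Measure Ω'} {T : Ω → Ω'}
    (h : ∀ G : Ω' → ℝ≥0∞, Measurable G → ∫⁻ ω, G (T ω) ∂μ = ∫⁻ ω, G ω ∂ν) {F : Ω' → EReal}
    (hF : Measurable F) : extIntegral μ (fun ω => F (T ω)) = extIntegral ν F := by
  unfold extIntegral
  rw [h _ hF.ereal_toENNReal, h (fun ω => (-F ω).toENNReal) hF.neg.ereal_toENNReal]

/-- The additivity `a + b = (a + b)` in terms of positive and negative parts, arranged without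
subtraction so that it remains true at `a = ±∞`. -/
theorem EReal.toENNReal_add_coe_identity (a : EReal) (b : ℝ) :
    (a + b).toENNReal + (-a).toENNReal + ENNReal.ofReal (-b) =
      (-(a + b)).toENNReal + a.toENNReal + ENNReal.ofReal b := by
  have h : ∀ x : ℝ, ENNReal.ofReal x = ENNReal.ofReal (max x 0) := by
    intro x
    rcases le_total x 0 with hx | hx
    · rw [max_eq_right hx, ENNReal.ofReal_of_nonpos hx, ENNReal.ofReal_zero]
    · rw [max_eq_left hx]
  induction a with
  | bot => simp
  | top => simp
  | coe a =>
    rw [← EReal.coe_add, EReal.real_coe_toENNReal, EReal.toENNReal_neg_coe,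
      EReal.toENNReal_neg_coe, EReal.real_coe_toENNReal, h, h (-a), h (-b), h (-(a + b)), h a, h b,
      ← ENNReal.ofReal_add (by positivity) (by positivity),
      ← ENNReal.ofReal_add (by positivity) (by positivity),
      ← ENNReal.ofReal_add (by positivity) (by positivity),
      ← ENNReal.ofReal_add (by positivity) (by positivity)]
    congr 1
    have key : ∀ x : ℝ, max x 0 - max (-x) 0 = x := by
      intro x
      rcases le_total x 0 with hx | hx
      · rw [max_eq_right hx, max_eq_left (by linarith)]; ring
      · rw [max_eq_left hx, max_eq_right (by linarith)]; ring
    linarith [key (a + b), key a, key b]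

theorem EReal.eq_add_coe_add_coe_neg (a : EReal) (b : ℝ) : a = a + b + ((-b : ℝ) : EReal) := by
  rw [add_assoc, ← EReal.coe_add, add_neg_cancel, EReal.coe_zero, add_zero]

theorem EReal.neg_add_coe (a : EReal) (b : ℝ) : -(a + b) = -a + ((-b : ℝ) : EReal) := by
  rw [EReal.neg_add (by simp) (by simp), EReal.coe_neg, sub_eq_add_neg]

/-- No integrability of `A` is needed. The inequalities `h1` to `h4` show that the positive and
negative parts of `A` and of `A + b` have finite integrals simultaneously; infinite cases agree by
convention, and the finite case follows from `hid`. -/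
theorem extIntegral_add_coe {A : Ω → EReal} (hA : Measurable A) {b : Ω → ℝ}
    (hb : Integrable b μ) :
    extIntegral μ (fun ω => A ω + b ω) = extIntegral μ A + ((∫ ω, b ω ∂μ : ℝ) : EReal) := by
  have hbp : AEMeasurable (fun ω => ENNReal.ofReal (b ω)) μ := hb.aemeasurable.ennreal_ofReal
  have hbn : AEMeasurable (fun ω => ENNReal.ofReal (-b ω)) μ :=
    hb.aemeasurable.neg.ennreal_ofReal
  have hAp : Measurable fun ω => (A ω).toENNReal := hA.ereal_toENNReal
  have hAn : Measurable fun ω => (-A ω).toENNReal := hA.neg.ereal_toENNReal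
  rw [integral_eq_lintegral_pos_part_sub_lintegral_neg_part hb]
  have fbp := hb.lintegral_lt_top.ne
  have fbn := hb.neg.lintegral_lt_top.ne
  have hid := lintegral_congr (μ := μ) fun ω => EReal.toENNReal_add_coe_identity (A ω) (b ω)
  rw [lintegral_add_right' _ hbn, lintegral_add_right _ hAn, lintegral_add_right' _ hbp,
    lintegral_add_right _ hAp] at hid
  have h1 : ∫⁻ ω, (A ω + b ω).toENNReal ∂μ ≤
      ∫⁻ ω, (A ω).toENNReal ∂μ + ∫⁻ ω, ENNReal.ofReal (b ω) ∂μ := by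
    rw [← lintegral_add_left hAp]
    exact lintegral_mono fun ω => EReal.toENNReal_add_le
  have h2 : ∫⁻ ω, (-(A ω + b ω)).toENNReal ∂μ ≤
      ∫⁻ ω, (-A ω).toENNReal ∂μ + ∫⁻ ω, ENNReal.ofReal (-b ω) ∂μ := by
    rw [← lintegral_add_left hAn]
    refine lintegral_mono fun ω => ?_
    rw [EReal.neg_add_coe]
    exact EReal.toENNReal_add_le
  have h3 : ∫⁻ ω, (A ω).toENNReal ∂μ ≤
      ∫⁻ ω, (A ω + b ω).toENNReal ∂μ + ∫⁻ ω, ENNReal.ofReal (-b ω) ∂μ := by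
    rw [← lintegral_add_right' _ hbn]
    refine lintegral_mono fun ω => ?_
    conv_lhs => rw [EReal.eq_add_coe_add_coe_neg (A ω) (b ω)]
    exact EReal.toENNReal_add_le
  have h4 : ∫⁻ ω, (-A ω).toENNReal ∂μ ≤
      ∫⁻ ω, (-(A ω + b ω)).toENNReal ∂μ + ∫⁻ ω, ENNReal.ofReal (b ω) ∂μ := by
    rw [← lintegral_add_right' _ hbp]
    refine lintegral_mono fun ω => ?_
    dsimp only
    conv_lhs => rw [EReal.eq_add_coe_add_coe_neg (A ω) (b ω), EReal.neg_add_coe, neg_neg]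
    exact EReal.toENNReal_add_le
  unfold extIntegral
  simp only [Pi.neg_apply] at fbn
  revert hid h1 h2 h3 h4 fbp fbn
  generalize ∫⁻ ω, (A ω + b ω).toENNReal ∂μ = P
  generalize ∫⁻ ω, (-(A ω + b ω)).toENNReal ∂μ = N
  generalize ∫⁻ ω, (A ω).toENNReal ∂μ = ap
  generalize ∫⁻ ω, (-A ω).toENNReal ∂μ = an
  generalize ∫⁻ ω, ENNReal.ofReal (b ω) ∂μ = bp
  generalize ∫⁻ ω, ENNReal.ofReal (-b ω) ∂μ = bn
  intro fbp fbn hid h1 h2 h3 h4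
  by_cases han : an = ∞
  · have hN : N = ∞ := by
      by_contra hN
      rw [han] at h4
      exact (ENNReal.add_lt_top.mpr ⟨lt_top_iff_ne_top.mpr hN, lt_top_iff_ne_top.mpr fbp⟩).not_ge h4
    rw [han, hN, EReal.coe_ennreal_top, EReal.sub_top, EReal.sub_top, EReal.bot_add]
  have hN : N ≠ ∞ := ne_top_of_le_ne_top (by finiteness) h2
  by_cases hap : ap = ∞
  · have hP : P = ∞ := by
      by_contra hP
      rw [hap] at h3
      exact (ENNReal.add_lt_top.mpr ⟨lt_top_iff_ne_top.mpr hP, lt_top_iff_ne_top.mpr fbn⟩).not_ge h3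
    rw [hap, hP, EReal.coe_ennreal_top, EReal.top_sub (by simpa using hN),
      EReal.top_sub (by simpa using han), EReal.top_add_coe]
  have hP : P ≠ ∞ := ne_top_of_le_ne_top (by finiteness) h1
  rw [ENNReal.coe_sub_coe_eq_toReal hP hN, ENNReal.coe_sub_coe_eq_toReal hap han,
    ← EReal.coe_add, EReal.coe_eq_coe_iff]
  have := congrArg ENNReal.toReal hid
  rw [ENNReal.toReal_add (by finiteness) fbn, ENNReal.toReal_add hP han,
    ENNReal.toReal_add (by finiteness) fbp, ENNReal.toReal_add hN hap] at this
  linarith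

end ExtIntegral


/-! ### The Gibbs variational principle for one factor of a product density. -/

section Gibbs

set_option linter.unusedSectionVars false

variable {X Z : Type*} [MeasurableSpace X] [MeasurableSpace Z] [Fintype Z]
  [MeasurableSingletonClass Z] {μ : Measure X} [SFinite μ]

theorem measurable_prod_of_finite {Y : Type*} [MeasurableSpace Y] {F : X × Z → Y}
    (h : ∀ z, Measurable fun x => F (x, z)) : Measurable F :=
  measurable_from_prod_countable_left h

/-- The slice over `z` has positive mass `w z`, and there the negative part is infinite. -/
theorem extIntegral_factoredMeasure_eq_bot {g : X → ℝ≥0∞} (hg : Measurable g)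
    (hg1 : ∫⁻ x, g x ∂μ = 1) {w : Z → ℝ≥0∞} {F : X × Z → EReal} {z : Z} (hz : w z ≠ 0)
    (h : ∀ᵐ x ∂μ, F (x, z) = ⊥) : extIntegral (factoredMeasure μ g w) F = ⊥ := by
  have hs : MeasurableSet {p : X × Z | p.2 = z} := measurable_snd (measurableSet_singleton z)
  have hpos : factoredMeasure μ g w {p : X × Z | p.2 = z} ≠ 0 := by
    rw [← lintegral_indicator_one hs, lintegral_factoredMeasure hg w (measurable_one.indicator hs)]
    intro h0
    have := Finset.sum_eq_zero_iff.mp h0 z (Finset.mem_univ z)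
    simp [hg1, hz] at this
  have hae : ∀ᵐ p ∂(factoredMeasure μ g w).restrict {p : X × Z | p.2 = z},
      (-F p).toENNReal = ∞ := by
    rw [ae_restrict_iff' hs]
    refine ae_factoredMeasure hg w fun z' _ => ?_
    filter_upwards [h] with x hx _ hz'
    obtain rfl : z' = z := hz'
    simp [hx]
  refine extIntegral_eq_bot (top_le_iff.mp ?_)
  calc (∞ : ℝ≥0∞) = ∫⁻ _ in {p : X × Z | p.2 = z}, ∞ ∂factoredMeasure μ g w := by
        rw [setLIntegral_const, ENNReal.top_mul hpos]
    _ = ∫⁻ p in {p : X × Z | p.2 = z}, (-F p).toENNReal ∂factoredMeasure μ g w :=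
        lintegral_congr_ae (hae.mono fun p hp => hp.symm)
    _ ≤ _ := setLIntegral_le_lintegral _ _

theorem extIntegral_factoredMeasure_coe {g : X → ℝ≥0∞} (hg : Measurable g) {w : Z → ℝ≥0∞}
    (hw : ∀ z, w z ≠ ∞) {R : X → Z → ℝ} (hR : ∀ z, Measurable fun x => R x z)
    (hint : ∀ z, w z ≠ 0 → Integrable (fun x => R x z) (μ.withDensity g)) :
    extIntegral (factoredMeasure μ g w) (fun p => (R p.1 p.2 : EReal)) =
      ((∑ z, (w z).toReal * ∫ x, R x z ∂μ.withDensity g : ℝ) : EReal) := by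
  have hmeas : Measurable fun p : X × Z => R p.1 p.2 := measurable_prod_of_finite hR
  have hform : ∀ r : ℝ → ℝ, Measurable r →
      (∫⁻ p, ENNReal.ofReal (r (R p.1 p.2)) ∂factoredMeasure μ g w) =
        ∑ z, w z * ∫⁻ x, ENNReal.ofReal (r (R x z)) ∂μ.withDensity g := by
    intro r hr
    rw [lintegral_factoredMeasure hg w (F := fun p => ENNReal.ofReal (r (R p.1 p.2)))
      (hr.comp hmeas).ennreal_ofReal]
    refine Finset.sum_congr rfl fun z _ => ?_
    have hmz : Measurable fun x => ENNReal.ofReal (r (R x z)) := (hr.comp (hR z)).ennreal_ofReal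
    rw [lintegral_withDensity_eq_lintegral_mul _ hg hmz]
    rfl
  unfold extIntegral
  simp only [EReal.real_coe_toENNReal, EReal.toENNReal_neg_coe]
  rw [hform (fun r => r) measurable_id, hform (fun r => -r) measurable_neg]
  have fp : ∀ z, w z * ∫⁻ x, ENNReal.ofReal (R x z) ∂μ.withDensity g ≠ ∞ := by
    intro z
    by_cases hz : w z = 0
    · simp [hz]
    · exact ENNReal.mul_ne_top (hw z) (hint z hz).lintegral_lt_top.ne
  have fn : ∀ z, w z * ∫⁻ x, ENNReal.ofReal (-R x z) ∂μ.withDensity g ≠ ∞ := by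
    intro z
    by_cases hz : w z = 0
    · simp [hz]
    · exact ENNReal.mul_ne_top (hw z) (hint z hz).neg.lintegral_lt_top.ne
  rw [ENNReal.coe_sub_coe_eq_toReal (ENNReal.sum_ne_top.mpr fun z _ => fp z)
    (ENNReal.sum_ne_top.mpr fun z _ => fn z), EReal.coe_eq_coe_iff,
    ENNReal.toReal_sum fun z _ => fp z, ENNReal.toReal_sum fun z _ => fn z,
    ← Finset.sum_sub_distrib]
  refine Finset.sum_congr rfl fun z _ => ?_
  by_cases hz : w z = 0
  · simp [hz]
  · rw [integral_eq_lintegral_pos_part_sub_lintegral_neg_part (hint z hz), ENNReal.toReal_mul,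
      ENNReal.toReal_mul]
    ring

/-- The Shannon entropy of a finitely supported law. -/
def shannonEntropy (w : Z → ℝ≥0∞) : ℝ := ∑ z, Real.negMulLog (w z).toReal

/-- The real logarithm of the ratio of `exp L` to the product density `g w`. -/
def logRatio (g : X → ℝ≥0∞) (w : Z → ℝ≥0∞) (L : X → Z → ℝ) (x : X) (z : Z) : ℝ :=
  L x z - Real.log (g x).toReal - Real.log (w z).toReal

/-- The setting of the Gibbs variational principle: a probability density `g`, a finitely supported
law `w`, and a positive integrand whose logarithm has the normalized geometric average
`exp (∑ z, w z * L x z - c)`. -/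
structure GibbsData (μ : Measure X) (g : X → ℝ≥0∞) (w : Z → ℝ≥0∞) (γ : X → Z → ℝ≥0∞)
    (L : X → Z → ℝ) (c : ℝ) : Prop where
  measurable_density : Measurable g
  lintegral_density : ∫⁻ x, g x ∂μ = 1
  sum_weight : ∑ z, w z = 1
  measurable_log : ∀ z, Measurable fun x => L x z
  eq_exp : ∀ z, w z ≠ 0 → ∀ x, γ x z = ENNReal.ofReal (Real.exp (L x z))
  normalized : ∫⁻ x, ENNReal.ofReal (Real.exp (∑ z, (w z).toReal * L x z - c)) ∂μ = 1

namespace GibbsData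

variable {g : X → ℝ≥0∞} {w : Z → ℝ≥0∞} {γ : X → Z → ℝ≥0∞} {L : X → Z → ℝ} {c : ℝ}
  (h : GibbsData μ g w γ L c)

include h

theorem weight_ne_top (z : Z) : w z ≠ ∞ := by
  refine ne_top_of_le_ne_top ENNReal.one_ne_top ?_
  rw [← h.sum_weight]
  exact Finset.single_le_sum (fun _ _ => zero_le) (Finset.mem_univ z)

theorem sum_toReal_weight : ∑ z, (w z).toReal = 1 := by
  rw [← ENNReal.toReal_sum fun z _ => h.weight_ne_top z, h.sum_weight, ENNReal.toReal_one]

theorem ae_lt_top : ∀ᵐ x ∂μ, g x < ∞ :=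
  MeasureTheory.ae_lt_top h.measurable_density (by rw [h.lintegral_density]; simp)

theorem isProbabilityMeasure : IsProbabilityMeasure (μ.withDensity g) :=
  ⟨by rw [withDensity_apply _ MeasurableSet.univ, setLIntegral_univ, h.lintegral_density]⟩

theorem integrand_ae_eq : (fun p : X × Z => ENNReal.log (γ p.1 p.2 / (g p.1 * w p.2)))
    =ᵐ[factoredMeasure μ g w]
      fun p => ((L p.1 p.2 - Real.log (g p.1).toReal - Real.log (w p.2).toReal : ℝ) : EReal) := by
  refine ae_factoredMeasure h.measurable_density w fun z hz => ?_
  filter_upwards [h.ae_lt_top] with x hx h0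
  have hg : 0 < (g x).toReal := ENNReal.toReal_pos h0 hx.ne
  have hw : 0 < (w z).toReal := ENNReal.toReal_pos hz (h.weight_ne_top z)
  rw [h.eq_exp z hz x]
  conv_lhs => rw [← ENNReal.ofReal_toReal hx.ne, ← ENNReal.ofReal_toReal (h.weight_ne_top z)]
  rw [← ENNReal.ofReal_mul hg.le, ← ENNReal.ofReal_div_of_pos (by positivity),
    ENNReal.log_ofReal_of_pos (by positivity), Real.log_div (Real.exp_pos _).ne' (by positivity),
    Real.log_exp, Real.log_mul hg.ne' hw.ne']
  congr 1
  ring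

theorem measurable_average : Measurable fun x => ∑ z, (w z).toReal * L x z :=
  Finset.measurable_sum _ fun z _ => (h.measurable_log z).const_mul _

/-- Averaging over modes splits the integrand into a log-ratio of two probability densities on `X`,
whose mean under `g` is minus a relative entropy, and a constant, which becomes the optimal value.
-/
theorem sum_log_ratio (x : X) : ∑ z, (w z).toReal * logRatio g w L x z =
      (∑ z, (w z).toReal * L x z - c - Real.log (g x).toReal) + (shannonEntropy w + c) := by
  have : ∀ z, (w z).toReal * logRatio g w L x z =
      (w z).toReal * L x z - (w z).toReal * Real.log (g x).toReal + Real.negMulLog (w z).toReal := by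
    intro z; rw [Real.negMulLog, logRatio]; ring
  simp only [this, Finset.sum_add_distrib, Finset.sum_sub_distrib, ← Finset.sum_mul,
    h.sum_toReal_weight, shannonEntropy]
  ring

/-- Multiplying by `g` turns the integrand into the normalized average restricted to `{g ≠ 0}`;
dropping the rest leaves an inequality. -/
theorem lintegral_exp_log_ratio_le :
    ∫⁻ x, ENNReal.ofReal (Real.exp (∑ z, (w z).toReal * L x z - c - Real.log (g x).toReal))
      ∂μ.withDensity g ≤ 1 := by
  have hm := h.measurable_average
  have hgm := h.measurable_density
  rw [lintegral_withDensity_eq_lintegral_mul _ hgm (by fun_prop), ← h.normalized]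
  refine lintegral_mono_ae ?_
  filter_upwards [h.ae_lt_top] with x hx
  rw [Pi.mul_apply]
  by_cases h0 : g x = 0
  · simp [h0]
  have hg : 0 < (g x).toReal := ENNReal.toReal_pos h0 hx.ne
  nth_rewrite 1 [← ENNReal.ofReal_toReal hx.ne]
  rw [← ENNReal.ofReal_mul hg.le, Real.exp_sub _ (Real.log (g x).toReal), Real.exp_log hg,
    mul_div_cancel₀ _ hg.ne']

/-- With `r` the log-ratio, integrate `exp r - 1 - r ≥ 0` under `g`. A vanishing integral of `r`
forces `r = 0` almost everywhere on `{g ≠ 0}`. -/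
theorem integral_log_ratio_nonpos
    (hint : Integrable (fun x => ∑ z, (w z).toReal * L x z - c - Real.log (g x).toReal)
      (μ.withDensity g)) :
    ∫ x, (∑ z, (w z).toReal * L x z - c - Real.log (g x).toReal) ∂μ.withDensity g ≤ 0 ∧
    (∫ x, (∑ z, (w z).toReal * L x z - c - Real.log (g x).toReal) ∂μ.withDensity g = 0 →
      g =ᵐ[μ] fun x => ENNReal.ofReal (Real.exp (∑ z, (w z).toReal * L x z - c))) := by
  have hle := h.lintegral_exp_log_ratio_le
  have hprob := h.isProbabilityMeasure
  have hm := h.measurable_average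
  have hgm := h.measurable_density
  set r : X → ℝ := fun x => ∑ z, (w z).toReal * L x z - c - Real.log (g x).toReal with hr
  have hrm : Measurable r := by fun_prop
  have hexp : Integrable (fun x => Real.exp (r x)) (μ.withDensity g) := by
    refine ⟨hrm.exp.aestronglyMeasurable, ?_⟩
    rw [hasFiniteIntegral_iff_ofReal (Filter.Eventually.of_forall fun x => (Real.exp_pos _).le)]
    exact hle.trans_lt ENNReal.one_lt_top
  have hexp1 : ∫ x, Real.exp (r x) ∂μ.withDensity g ≤ 1 := by
    rw [integral_eq_lintegral_of_nonneg_ae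
      (Filter.Eventually.of_forall fun x => (Real.exp_pos _).le) hrm.exp.aestronglyMeasurable]
    exact ENNReal.toReal_le_of_le_ofReal zero_le_one (by simpa using hle)
  have hdiff : Integrable (fun x => Real.exp (r x) - 1 - r x) (μ.withDensity g) :=
    (hexp.sub (integrable_const 1)).sub hint
  have hnonneg : ∀ x, 0 ≤ Real.exp (r x) - 1 - r x := fun x => by
    linarith [Real.add_one_le_exp (r x)]
  have hval : ∫ x, (Real.exp (r x) - 1 - r x) ∂μ.withDensity g =
      ∫ x, Real.exp (r x) ∂μ.withDensity g - 1 - ∫ x, r x ∂μ.withDensity g := by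
    have h1 : Integrable (fun x => Real.exp (r x) - 1) (μ.withDensity g) :=
      hexp.sub (integrable_const 1)
    rw [integral_sub h1 hint, integral_sub hexp (integrable_const 1)]
    simp
  have hpos : 0 ≤ ∫ x, (Real.exp (r x) - 1 - r x) ∂μ.withDensity g := integral_nonneg hnonneg
  refine ⟨by linarith, fun h0 => ?_⟩
  have hz : ∫ x, (Real.exp (r x) - 1 - r x) ∂μ.withDensity g = 0 := by linarith
  rw [integral_eq_zero_iff_of_nonneg hnonneg hdiff] at hz
  have hz' : ∀ᵐ x ∂μ, g x ≠ 0 →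
      g x = ENNReal.ofReal (Real.exp (∑ z, (w z).toReal * L x z - c)) := by
    rw [Filter.EventuallyEq, ae_withDensity_iff hgm] at hz
    filter_upwards [hz, h.ae_lt_top] with x hx hfin hne
    have hg : 0 < (g x).toReal := ENNReal.toReal_pos hne hfin.ne
    have h1 := hx hne
    have h2 : r x = 0 := by
      by_contra hne'
      have := Real.add_one_lt_exp hne'
      simp only [Pi.zero_apply] at h1
      linarith
    have h3 : ∑ z, (w z).toReal * L x z - c = Real.log (g x).toReal := by
      simp only [hr] at h2; linarith
    rw [h3, Real.exp_log hg, ENNReal.ofReal_toReal hfin.ne]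
  -- Equality is known only where `g ≠ 0`, which gives `g ≤` target everywhere; both have total mass
  -- one, so they agree.
  refine ae_eq_of_ae_le_of_lintegral_le ?_ (by rw [h.lintegral_density]; simp)
    ((hm.sub_const c).exp.ennreal_ofReal.aemeasurable)
    (by rw [h.lintegral_density, h.normalized])
  filter_upwards [hz'] with x hx
  by_cases h0 : g x = 0
  · simp [h0]
  · exact (hx h0).le

theorem measurable_logRatio (z : Z) : Measurable fun x => logRatio g w L x z := by
  have h1 := h.measurable_log z
  have h2 := h.measurable_density
  unfold logRatio
  fun_prop

/-- Positive parts come for free: `r ≤ exp r`, and `exp r` is integrable. Finite negative parts for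
the charged modes therefore make the average integrable, and then each mode's term, which together
with its negative part is dominated by a sum of nonnegative terms. -/
theorem integrable_logRatio
    (hfin : ∀ z, w z ≠ 0 → ∫⁻ x, ENNReal.ofReal (-logRatio g w L x z) ∂μ.withDensity g ≠ ∞) :
    Integrable (fun x => ∑ z, (w z).toReal * L x z - c - Real.log (g x).toReal)
      (μ.withDensity g) ∧
    ∀ z, w z ≠ 0 → Integrable (fun x => logRatio g w L x z) (μ.withDensity g) := by
  have hgm := h.measurable_density
  have hprob := h.isProbabilityMeasure
  have hm := h.measurable_average
  have hR := h.measurable_logRatio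
  have hsum : ∀ x, ∑ z, (w z).toReal * logRatio g w L x z = _ := h.sum_log_ratio
  have hexple := h.lintegral_exp_log_ratio_le
  obtain ⟨r, hr⟩ : ∃ r : X → ℝ,
    r = fun x => ∑ z, (w z).toReal * L x z - c - Real.log (g x).toReal := ⟨_, rfl⟩
  have hrm : Measurable r := by rw [hr]; fun_prop
  have hwtop := h.weight_ne_top
  generalize shannonEntropy w + c = e at hsum
  replace hsum : ∀ x, ∑ z, (w z).toReal * logRatio g w L x z = r x + e := by rw [hr]; exact hsum
  replace hexple : ∫⁻ x, ENNReal.ofReal (Real.exp (r x)) ∂μ.withDensity g ≤ 1 := by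
    rw [hr]; exact hexple
  rw [← hr]
  generalize logRatio g w L = R at *
  clear hr hm
  -- `N` is the weighted sum of the negative parts, the integrable function from which all lower
  -- bounds below are taken.
  obtain ⟨N, hN⟩ : ∃ N : X → ℝ, ∀ x, N x = ∑ z, (w z).toReal * max (-R x z) 0 :=
    ⟨_, fun _ => rfl⟩
  have hNint : Integrable N (μ.withDensity g) := by
    rw [funext hN]
    refine integrable_finsetSum _ fun z _ => ?_
    by_cases hz : w z = 0
    · simp [hz]
    have hmz : Measurable fun x => max (-R x z) 0 := (hR z).neg.max measurable_const
    have hmz0 : ∀ x, 0 ≤ max (-R x z) 0 := fun x => le_max_right _ _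
    refine Integrable.const_mul ⟨hmz.aestronglyMeasurable, ?_⟩ _
    rw [hasFiniteIntegral_iff_ofReal (Filter.Eventually.of_forall hmz0)]
    refine lt_of_eq_of_lt (lintegral_congr fun x => ?_) (lt_top_iff_ne_top.mpr (hfin z hz))
    rcases le_total (-R x z) 0 with h | h
    · rw [max_eq_right h, ENNReal.ofReal_of_nonpos h, ENNReal.ofReal_zero]
    · rw [max_eq_left h]
  have hneg : ∀ x z, -((w z).toReal * R x z) ≤ (w z).toReal * max (-R x z) 0 := by
    intro x z
    rw [← mul_neg]
    exact mul_le_mul_of_nonneg_left (le_max_left _ _) ENNReal.toReal_nonneg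
  have hnn : ∀ x z, 0 ≤ (w z).toReal * max (-R x z) 0 := fun x z =>
    mul_nonneg ENNReal.toReal_nonneg (le_max_right _ _)
  have hN0 : ∀ x, 0 ≤ N x := fun x => by
    rw [hN]; exact Finset.sum_nonneg fun z _ => hnn x z
  have hGN : ∀ x, -(r x + e) ≤ N x := by
    intro x
    rw [← hsum, ← Finset.sum_neg_distrib, hN]
    exact Finset.sum_le_sum fun z _ => hneg x z
  have hexp : Integrable (fun x => Real.exp (r x)) (μ.withDensity g) := by
    refine ⟨hrm.exp.aestronglyMeasurable, ?_⟩
    rw [hasFiniteIntegral_iff_ofReal (Filter.Eventually.of_forall fun x => (Real.exp_pos _).le)]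
    exact hexple.trans_lt ENNReal.one_lt_top
  have hrint : Integrable r (μ.withDensity g) := by
    refine Integrable.mono' ((hexp.add hNint).add (integrable_const |e|))
      hrm.aestronglyMeasurable (Filter.Eventually.of_forall fun x => ?_)
    simp only [Pi.add_apply]
    rw [Real.norm_eq_abs, abs_le]
    have h1 := Real.add_one_le_exp (r x)
    have h2 := hGN x
    have h3 := neg_abs_le e
    have h4 := le_abs_self e
    have h5 := Real.exp_pos (r x)
    have h6 := hN0 x
    constructor <;> linarith
  refine ⟨hrint, fun z hz => ?_⟩
  have hwz : 0 < (w z).toReal := ENNReal.toReal_pos hz (hwtop z)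
  have hmul : Integrable (fun x => (w z).toReal * R x z) (μ.withDensity g) := by
    refine Integrable.mono' ((hrint.abs.add (hNint.const_mul 2)).add (integrable_const |e|))
      ((hR z).const_mul _).aestronglyMeasurable (Filter.Eventually.of_forall fun x => ?_)
    simp only [Pi.add_apply]
    rw [Real.norm_eq_abs, abs_le]
    have h2 : (w z).toReal * max (-R x z) 0 ≤ N x := by
      rw [hN]
      exact Finset.single_le_sum (f := fun z => (w z).toReal * max (-R x z) 0)
        (fun z _ => hnn x z) (Finset.mem_univ z)
    have h3 : ∑ z', (w z').toReal * (R x z' + max (-R x z') 0) = r x + e + N x := by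
      simp only [mul_add, Finset.sum_add_distrib, hsum, hN]
    have h4 : (w z).toReal * (R x z + max (-R x z) 0) ≤ r x + e + N x := by
      rw [← h3]
      refine Finset.single_le_sum (f := fun z => (w z).toReal * (R x z + max (-R x z) 0))
        (fun z _ => mul_nonneg ENNReal.toReal_nonneg ?_) (Finset.mem_univ z)
      linarith [le_max_left (-R x z) 0]
    have h5 := hnn x z
    have h6 := le_abs_self (r x)
    have h7 := le_abs_self e
    have h8 := abs_nonneg (r x)
    have h9 := abs_nonneg e
    have h10 := hneg x z
    have h11 := hN0 x
    rw [mul_add] at h4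
    constructor <;> linarith
  refine (hmul.const_mul (w z).toReal⁻¹).congr (Filter.Eventually.of_forall fun x => ?_)
  exact inv_mul_cancel_left₀ hwz.ne' _

/-- If some charged mode has an infinite negative part, the value is `⊥` and equality is impossible.
Otherwise everything is integrable and the real-valued inequality applies. -/
theorem extIntegral_le_and_eq :
    extIntegral (factoredMeasure μ g w) (fun p => ENNReal.log (γ p.1 p.2 / (g p.1 * w p.2))) ≤
        ((shannonEntropy w + c : ℝ) : EReal) ∧
    (extIntegral (factoredMeasure μ g w) (fun p => ENNReal.log (γ p.1 p.2 / (g p.1 * w p.2))) =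
        ((shannonEntropy w + c : ℝ) : EReal) →
      g =ᵐ[μ] fun x => ENNReal.ofReal (Real.exp (∑ z, (w z).toReal * L x z - c))) := by
  have hgm := h.measurable_density
  have hR := h.measurable_logRatio
  have hprob := h.isProbabilityMeasure
  have hcongr : extIntegral (factoredMeasure μ g w)
      (fun p => ENNReal.log (γ p.1 p.2 / (g p.1 * w p.2))) =
      extIntegral (factoredMeasure μ g w) (fun p => (logRatio g w L p.1 p.2 : EReal)) :=
    extIntegral_congr_ae h.integrand_ae_eq
  rw [hcongr]
  by_cases hfin : ∀ z, w z ≠ 0 →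
      ∫⁻ x, ENNReal.ofReal (-logRatio g w L x z) ∂μ.withDensity g ≠ ∞
  · obtain ⟨hrint, hRint⟩ := h.integrable_logRatio hfin
    have hval : ∑ z, (w z).toReal * ∫ x, logRatio g w L x z ∂μ.withDensity g =
        ∫ x, (∑ z, (w z).toReal * L x z - c - Real.log (g x).toReal) ∂μ.withDensity g +
          (shannonEntropy w + c) := by
      have h1 : ∀ z, Integrable (fun x => (w z).toReal * logRatio g w L x z)
          (μ.withDensity g) := by
        intro z
        by_cases hz : w z = 0
        · simp [hz]
        · exact (hRint z hz).const_mul _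
      simp_rw [← integral_const_mul]
      rw [← integral_finsetSum _ fun z _ => h1 z, integral_congr_ae
        (Filter.Eventually.of_forall h.sum_log_ratio), integral_add hrint (integrable_const _)]
      simp
    rw [extIntegral_factoredMeasure_coe hgm h.weight_ne_top hR hRint, hval]
    obtain ⟨hle, heq⟩ := h.integral_log_ratio_nonpos hrint
    refine ⟨EReal.coe_le_coe_iff.mpr (by linarith), fun h0 => heq ?_⟩
    have := EReal.coe_eq_coe_iff.mp h0
    linarith
  · push Not at hfin
    obtain ⟨z, hz, hinf⟩ := hfin
    have hbot : extIntegral (factoredMeasure μ g w)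
        (fun p => (logRatio g w L p.1 p.2 : EReal)) = ⊥ := by
      refine extIntegral_eq_bot ?_
      simp only [EReal.toENNReal_neg_coe]
      have hmeas : Measurable fun p : X × Z => logRatio g w L p.1 p.2 :=
        measurable_prod_of_finite hR
      rw [lintegral_factoredMeasure hgm w
        (F := fun p => ENNReal.ofReal (-logRatio g w L p.1 p.2)) hmeas.neg.ennreal_ofReal,
        ENNReal.sum_eq_top]
      refine ⟨z, Finset.mem_univ _, ?_⟩
      have hmz : Measurable fun x => ENNReal.ofReal (-logRatio g w L x z) :=
        (hR z).neg.ennreal_ofReal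
      rw [lintegral_withDensity_eq_lintegral_mul _ hgm hmz] at hinf
      exact (congrArg (w z * ·) hinf).trans (ENNReal.mul_top hz)
    rw [hbot]
    exact ⟨bot_le, fun h => absurd h (EReal.bot_ne_coe _)⟩

theorem extIntegral_eq
    (hg : g =ᵐ[μ] fun x => ENNReal.ofReal (Real.exp (∑ z, (w z).toReal * L x z - c)))
    (hL : ∀ z, Integrable (fun x => L x z) (μ.withDensity g)) :
    extIntegral (factoredMeasure μ g w) (fun p => ENNReal.log (γ p.1 p.2 / (g p.1 * w p.2))) =
      ((shannonEntropy w + c : ℝ) : EReal) := by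
  have hgm := h.measurable_density
  have hLm := h.measurable_log
  have hm := h.measurable_average
  have hprob := h.isProbabilityMeasure
  rw [extIntegral_congr_ae h.integrand_ae_eq]
  have hlog : ∀ᵐ x ∂μ.withDensity g,
      Real.log (g x).toReal = ∑ z, (w z).toReal * L x z - c := by
    have := (withDensity_absolutelyContinuous μ g).ae_le hg
    filter_upwards [this] with x hx
    rw [hx, ENNReal.toReal_ofReal (Real.exp_pos _).le, Real.log_exp]
  have hlogint : Integrable (fun x => Real.log (g x).toReal) (μ.withDensity g) := by
    have : Integrable (fun x => ∑ z, (w z).toReal * L x z - c) (μ.withDensity g) :=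
      (integrable_finsetSum _ fun z _ => (hL z).const_mul _).sub (integrable_const c)
    exact this.congr (hlog.mono fun x hx => hx.symm)
  have hRint : ∀ z, Integrable (fun x => logRatio g w L x z) (μ.withDensity g) :=
    fun z => ((hL z).sub hlogint).sub (integrable_const _)
  have := extIntegral_factoredMeasure_coe hgm h.weight_ne_top h.measurable_logRatio
    fun z _ => hRint z
  refine Eq.trans this ?_
  rw [EReal.coe_eq_coe_iff]
  simp_rw [← integral_const_mul]
  rw [← integral_finsetSum _ fun z _ => (hRint z).const_mul _]
  simp_rw [h.sum_log_ratio]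
  have h2 : ∀ᵐ x ∂μ.withDensity g, ∑ z, (w z).toReal * L x z - c - Real.log (g x).toReal +
      (shannonEntropy w + c) = shannonEntropy w + c := by
    filter_upwards [hlog] with x hx
    rw [hx]; ring
  rw [integral_congr_ae h2]
  simp

end GibbsData

end Gibbs


/-! ### Second moments along chains, and Gaussian chains as family members. -/

section Moments

variable {M d : ℕ}

namespace ReverseKernels

variable (q : ReverseKernels M d)

/-- `K` is uniform in the final density `g`, so the induction may use it for `gRev t a` with every
`a` at once. -/
theorem exists_lintegral_gChain_sq_enorm_le
    (hq : ∀ t, ∃ K : ℝ≥0∞, K ≠ ∞ ∧ ∀ x, ∫⁻ x', q.gRev t x x' * ‖x'‖ₑ ^ 2 ≤ K * (1 + ‖x‖ₑ ^ 2))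
    (t : ℕ) : ∃ K : ℝ≥0∞, K ≠ ∞ ∧ ∀ g : (Fin d → ℝ) → ℝ≥0∞, Measurable g → ∫⁻ x, g x = 1 →
      ∫⁻ x : Fin (t + 1) → Fin d → ℝ, g (x (Fin.last t)) * q.gCond t x * ∑ s, ‖x s‖ₑ ^ 2 ≤
        K * (1 + ∫⁻ x, g x * ‖x‖ₑ ^ 2) := by
  induction t with
  | zero =>
    refine ⟨1, ENNReal.one_ne_top, fun g hg _ => ?_⟩
    rw [q.lintegral_gChain_zero hg (F := fun x => ∑ s, ‖x s‖ₑ ^ 2) (by fun_prop)]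
    simp
  | succ t ih =>
    obtain ⟨K, hK, hle⟩ := ih
    obtain ⟨K', hK', hle'⟩ := hq t
    refine ⟨K + K * K' + 1, by finiteness, fun g hg hg1 => ?_⟩
    rw [q.lintegral_gChain_succ t hg (F := fun x => ∑ s, ‖x s‖ₑ ^ 2) (by fun_prop)]
    have hin : ∀ a, ∫⁻ p : Fin (t + 1) → Fin d → ℝ, q.gRev t a (p (Fin.last t)) * q.gCond t p *
        ∑ s, ‖(Fin.snoc p a : Fin (t + 2) → Fin d → ℝ) s‖ₑ ^ 2 ≤
          (K + K * K') + (K * K' + 1) * ‖a‖ₑ ^ 2 := by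
      intro a
      have h0 : ∀ p : Fin (t + 1) → Fin d → ℝ,
          ∑ s, ‖(Fin.snoc p a : Fin (t + 2) → Fin d → ℝ) s‖ₑ ^ 2 =
            ∑ s, ‖p s‖ₑ ^ 2 + ‖a‖ₑ ^ 2 := by
        intro p
        rw [Fin.sum_univ_castSucc]
        simp only [Fin.snoc_castSucc, Fin.snoc_last]
      simp_rw [h0]
      have h1 := hle (q.gRev t a) (by fun_prop) (q.gRev_lintegral t a)
      have h2 := q.lintegral_gChain t (g := q.gRev t a) (by fun_prop) (q.gRev_lintegral t a)
      calc ∫⁻ p : Fin (t + 1) → Fin d → ℝ, q.gRev t a (p (Fin.last t)) * q.gCond t p *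
            (∑ s, ‖p s‖ₑ ^ 2 + ‖a‖ₑ ^ 2)
          = (∫⁻ p : Fin (t + 1) → Fin d → ℝ, q.gRev t a (p (Fin.last t)) * q.gCond t p *
              ∑ s, ‖p s‖ₑ ^ 2) + ‖a‖ₑ ^ 2 := by
            simp_rw [mul_add]
            rw [lintegral_add_right _ (by fun_prop), lintegral_mul_const _ (by fun_prop), h2,
              one_mul]
        _ ≤ K * (1 + K' * (1 + ‖a‖ₑ ^ 2)) + ‖a‖ₑ ^ 2 := by
            gcongr
            exact h1.trans (by gcongr; exact hle' a)
        _ = _ := by ring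
    calc _ ≤ ∫⁻ a, g a * ((K + K * K') + (K * K' + 1) * ‖a‖ₑ ^ 2) := by
          gcongr with a
          exact hin a
      _ = (K + K * K') + (K * K' + 1) * ∫⁻ a, g a * ‖a‖ₑ ^ 2 := by
          simp_rw [mul_add]
          rw [lintegral_add_right _ (by fun_prop)]
          have : ∀ a, g a * ((K * K' + 1) * ‖a‖ₑ ^ 2) = (K * K' + 1) * (g a * ‖a‖ₑ ^ 2) := by
            intro a; ring
          simp_rw [this]
          rw [lintegral_const_mul _ (by fun_prop), lintegral_add_right _ (by fun_prop),
            lintegral_mul_const _ hg, lintegral_mul_const _ hg, hg1, one_mul, one_mul]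
      _ ≤ (K + K * K' + 1) * (1 + ∫⁻ a, g a * ‖a‖ₑ ^ 2) := by
          set I := ∫⁻ a, g a * ‖a‖ₑ ^ 2
          calc K + K * K' + (K * K' + 1) * I ≤ K + K * K' + (K * K' + 1) * I + (1 + K * I) :=
                le_self_add
            _ = _ := by ring

end ReverseKernels

theorem sq_enorm_pi_le_sum {t d : ℕ} (x : Fin (t + 1) → Fin d → ℝ) :
    ‖x‖ₑ ^ 2 ≤ ∑ s, ‖x s‖ₑ ^ 2 := by
  obtain ⟨i, -, hi⟩ := Finset.exists_mem_eq_sup Finset.univ Finset.univ_nonempty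
    fun s => ‖x s‖₊
  have : ‖x‖ₑ = ‖x i‖ₑ := by
    rw [enorm_eq_nnnorm, enorm_eq_nnnorm, Pi.nnnorm_def, hi]
  rw [this]
  exact Finset.single_le_sum (f := fun s => ‖x s‖ₑ ^ 2) (fun _ _ => zero_le) (Finset.mem_univ i)

theorem IsQuadratic.integrable_withDensity {V : Type*} [NormedAddCommGroup V] [NormedSpace ℝ V]
    [FiniteDimensional ℝ V] [MeasurableSpace V] [BorelSpace V] {μ : Measure V} {f : V → ℝ}
    {B : V →ₗ[ℝ] V →ₗ[ℝ] ℝ} (hf : IsQuadratic f B) {g : V → ℝ≥0∞} (hg : Measurable g)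
    (hg1 : ∫⁻ x, g x ∂μ ≠ ∞) (hg2 : ∫⁻ x, g x * ‖x‖ₑ ^ 2 ∂μ ≠ ∞) :
    Integrable f (μ.withDensity g) := by
  obtain ⟨K, hK, hle⟩ := hf.exists_enorm_le
  have hm : Measurable fun x : V => K * (1 + ‖x‖ₑ ^ 2) := by fun_prop
  refine ⟨hf.continuous.aestronglyMeasurable, (lintegral_mono hle).trans_lt ?_⟩
  rw [lintegral_withDensity_eq_lintegral_mul _ hg hm]
  have : (g * fun x : V => K * (1 + ‖x‖ₑ ^ 2) : V → ℝ≥0∞) =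
      fun x => K * (g x + g x * ‖x‖ₑ ^ 2) := by
    funext x; simp only [Pi.mul_apply]; ring
  rw [this]
  rw [lintegral_const_mul' _ _ hK, lintegral_add_left hg]
  exact ENNReal.mul_lt_top (lt_top_iff_ne_top.mpr hK)
    (ENNReal.add_lt_top.mpr ⟨lt_top_iff_ne_top.mpr hg1, lt_top_iff_ne_top.mpr hg2⟩)

end Moments

/-- The parameters of a linear Gaussian Markov chain, written in reverse time. -/
structure GaussianChain (d : ℕ) where
  mean : Fin d → ℝ
  cov : Matrix (Fin d) (Fin d) ℝ
  cov_posDef : cov.PosDef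
  gain : ℕ → Matrix (Fin d) (Fin d) ℝ
  shift : ℕ → Fin d → ℝ
  noise : ℕ → Matrix (Fin d) (Fin d) ℝ
  noise_posDef : ∀ t, (noise t).PosDef

namespace GaussianChain

variable {M d : ℕ} (G : GaussianChain d)

/-- The density of the state at time `t` given the state at time `t + 1`. -/
def kernel (t : ℕ) (x x' : Fin d → ℝ) : ℝ :=
  gaussianDensity ((G.gain t).mulVec x + G.shift t) (G.noise t) x'

/-- The density of a path. -/
def pathDensity (T : ℕ) (x : Fin (T + 1) → Fin d → ℝ) : ℝ :=
  gaussianDensity G.mean G.cov (x (Fin.last T)) *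
    ∏ i : Fin T, G.kernel i (x i.succ) (x i.castSucc)

theorem kernel_pos (t : ℕ) (x x' : Fin d → ℝ) : 0 < G.kernel t x x' :=
  gaussianDensity_pos _ (G.noise_posDef t) _

theorem pathDensity_pos (T : ℕ) (x : Fin (T + 1) → Fin d → ℝ) : 0 < G.pathDensity T x :=
  mul_pos (gaussianDensity_pos _ G.cov_posDef _) (Finset.prod_pos fun _ _ => G.kernel_pos _ _ _)

theorem continuous_kernel (t : ℕ) : Continuous (Function.uncurry (G.kernel t)) := by
  unfold Function.uncurry kernel
  exact Continuous.gaussianDensity ((Continuous.matrix_mulVec continuous_const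
    continuous_fst).add continuous_const) continuous_snd _

/-- The member of the variational family with the continuous factor of a Gaussian chain. -/
def toFactored (fLast : PMF (Fin M)) (fRev : ℕ → Fin M → PMF (Fin M)) : FactoredDensity M d where
  fRev := fRev
  gRev t x x' := ENNReal.ofReal (G.kernel t x x')
  gRev_measurable t := (G.continuous_kernel t).measurable.ennreal_ofReal
  gRev_lintegral t _ := lintegral_gaussianDensity _ (G.noise_posDef t)
  fLast := fLast
  gLast x := ENNReal.ofReal (gaussianDensity G.mean G.cov x)
  gLast_measurable :=
    (Continuous.gaussianDensity continuous_const continuous_id _).measurable.ennreal_ofReal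
  gLast_lintegral := lintegral_gaussianDensity _ G.cov_posDef

variable (fLast : PMF (Fin M)) (fRev : ℕ → Fin M → PMF (Fin M))

theorem toFactored_fLast : (G.toFactored fLast fRev).fLast = fLast := rfl

theorem toFactored_fRev : (G.toFactored fLast fRev).fRev = fRev := rfl

theorem toFactored_gPath (T : ℕ) (x : Fin (T + 1) → Fin d → ℝ) :
    (G.toFactored fLast fRev).gPath T x = ENNReal.ofReal (G.pathDensity T x) := by
  rw [pathDensity, ENNReal.ofReal_mul (gaussianDensity_pos _ G.cov_posDef _).le,
    ENNReal.ofReal_prod_of_nonneg fun _ _ => (G.kernel_pos _ _ _).le]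
  rfl

theorem exists_lintegral_kernel_sq_enorm_le (t : ℕ) : ∃ K : ℝ≥0∞, K ≠ ∞ ∧ ∀ x,
    ∫⁻ x', ENNReal.ofReal (G.kernel t x x') * ‖x'‖ₑ ^ 2 ≤ K * (1 + ‖x‖ₑ ^ 2) := by
  obtain ⟨K, hK, hle⟩ := exists_lintegral_sq_enorm_gaussianDensity_le (G.gain t) (G.shift t)
    (G.noise_posDef t)
  exact ⟨K, hK, fun x => by simpa only [mul_comm, kernel] using hle x⟩

theorem lintegral_last_sq_enorm_ne_top :
    ∫⁻ x, ENNReal.ofReal (gaussianDensity G.mean G.cov x) * ‖x‖ₑ ^ 2 ≠ ∞ := by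
  obtain ⟨K, hK, hle⟩ := exists_lintegral_sq_enorm_gaussianDensity_le 0 G.mean G.cov_posDef
  have := hle 0
  simp only [Matrix.zero_mulVec, zero_add] at this
  refine ne_top_of_le_ne_top ?_ ((le_of_eq ?_).trans this)
  · simpa using hK
  · simp only [mul_comm]

theorem lintegral_pathDensity (T : ℕ) :
    ∫⁻ x, ENNReal.ofReal (G.pathDensity T x) = 1 := by
  -- A single dummy mode turns the chain into a member of the family, so that the normalization of
  -- reverse-time chains applies.
  let π : FactoredDensity 1 d := G.toFactored (PMF.pure 0) fun _ _ => PMF.pure 0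
  have h := π.lintegral_gChain T π.gLast_measurable π.gLast_lintegral
  simp_rw [← G.toFactored_gPath (PMF.pure (0 : Fin 1)) fun _ _ => PMF.pure 0]
  exact h

theorem lintegral_pathDensity_sq_enorm_ne_top (T : ℕ) :
    ∫⁻ x : Fin (T + 1) → Fin d → ℝ, ENNReal.ofReal (G.pathDensity T x) * ‖x‖ₑ ^ 2 ≠ ∞ := by
  let π : FactoredDensity 1 d := G.toFactored (PMF.pure 0) fun _ _ => PMF.pure 0
  obtain ⟨K, hK, hle⟩ := π.exists_lintegral_gChain_sq_enorm_le
    G.exists_lintegral_kernel_sq_enorm_le T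
  have h := hle π.gLast π.gLast_measurable π.gLast_lintegral
  have hlast : ∫⁻ x, π.gLast x * ‖x‖ₑ ^ 2 ≠ ∞ := G.lintegral_last_sq_enorm_ne_top
  refine ne_top_of_le_ne_top (by finiteness) (le_trans (lintegral_mono fun x => ?_) h)
  rw [← G.toFactored_gPath (PMF.pure (0 : Fin 1)) fun _ _ => PMF.pure 0]
  exact mul_le_mul_right (sq_enorm_pi_le_sum x) _

end GaussianChain

/-! ### The lower bound with the continuous factor optimized out. -/

namespace JumpGaussMarkov

variable {M d m : ℕ} (S : JumpGaussMarkov M d m) (y : ℕ → Fin m → ℝ)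

/-- The log-normalizer of the geometric average of the path densities with weights `w`. -/
def logNormalizer (T : ℕ) (w : (Fin (T + 1) → Fin M) → ℝ) : ℝ :=
  Real.log (∫ x : Fin (T + 1) → Fin d → ℝ, Real.exp (∑ z, w z * S.logPath y T x z))

theorem exists_gaussianChain (T : ℕ) {w : (Fin (T + 1) → Fin M) → ℝ}
    (hw : w ∈ stdSimplex ℝ (Fin (T + 1) → Fin M)) : ∃ G : GaussianChain d,
      (∀ x, Real.exp (∑ z, w z * S.logPath y T x z - S.logNormalizer y T w) = G.pathDensity T x) ∧
      Integrable (fun x => Real.exp (∑ z, w z * S.logPath y T x z)) ∧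
      0 < ∫ x, Real.exp (∑ z, w z * S.logPath y T x z) := by
  obtain ⟨β, A, a, P, hβ, hP, heq⟩ := S.exists_gaussian_chain y hw.1 hw.2 T fun z => z
  obtain ⟨μ, C, c, hC, hβeq⟩ := hβ.exists_eq_log_gaussianDensity
  let G : GaussianChain d := ⟨μ, C, hC, A, a, P, hP⟩
  have h1 : ∀ x, Real.exp (∑ z, w z * S.logPath y T x z) = Real.exp c * G.pathDensity T x := by
    intro x
    rw [heq, hβeq, add_assoc, Real.exp_add, Real.exp_add, Real.exp_sum,
      Real.exp_log (gaussianDensity_pos _ hC _)]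
    congr 2
    exact Finset.prod_congr rfl fun i _ => Real.exp_log (G.kernel_pos _ _ _)
  have hcont : Continuous (G.pathDensity T) := by
    refine Continuous.mul (Continuous.gaussianDensity continuous_const (continuous_apply _) _)
      (continuous_finsetProd _ fun i _ => ?_)
    exact (G.continuous_kernel i).comp
      (g := Function.uncurry (G.kernel i)) (f := fun x : Fin (T + 1) → Fin d → ℝ =>
        (x i.succ, x i.castSucc)) ((continuous_apply _).prodMk (continuous_apply _))
  have hint : Integrable (G.pathDensity T) := by
    refine ⟨hcont.aestronglyMeasurable, ?_⟩
    rw [hasFiniteIntegral_iff_ofReal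
      (Filter.Eventually.of_forall fun x => (G.pathDensity_pos T x).le), G.lintegral_pathDensity]
    exact ENNReal.one_lt_top
  have hval : ∫ x, G.pathDensity T x = 1 := by
    rw [integral_eq_lintegral_of_nonneg_ae
      (Filter.Eventually.of_forall fun x => (G.pathDensity_pos T x).le)
      hcont.aestronglyMeasurable, G.lintegral_pathDensity, ENNReal.toReal_one]
  -- The chain density has mass one, so the additive constant left by completing squares is the
  -- log-normalizer.
  have hnorm : S.logNormalizer y T w = c := by
    simp_rw [logNormalizer, h1]
    rw [integral_const_mul, hval, mul_one, Real.log_exp]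
  refine ⟨G, fun x => ?_, ?_, ?_⟩
  · rw [hnorm, Real.exp_sub, h1, mul_div_cancel_left₀ _ (Real.exp_pos c).ne']
  · simp_rw [h1]
    exact hint.const_mul _
  · simp_rw [h1]
    rw [integral_const_mul, hval, mul_one]
    exact Real.exp_pos c

/-- The value of the lower bound at the best continuous factor for the mode path weights `w`. -/
def modeObjective (T : ℕ) (w : (Fin (T + 1) → Fin M) → ℝ) : ℝ :=
  ∑ z, Real.negMulLog (w z) + S.logNormalizer y T w

@[fun_prop]
theorem continuous_logPath (T : ℕ) (z : Fin (T + 1) → Fin M) :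
    Continuous fun x => S.logPath y T x z := by
  obtain ⟨B, hB⟩ := S.exists_isQuadratic_logPath y T z
  exact hB.continuous

theorem measurable_unnormPath (T : ℕ) (z : Fin (T + 1) → Fin M) :
    Measurable fun x => S.unnormPath y T x z := by
  by_cases hz : S.ModePossible T z
  · simp_rw [fun x => S.unnormPath_eq_exp y T x hz]
    fun_prop
  · simp_rw [fun x => S.unnormPath_eq_zero y T x hz]
    fun_prop

end JumpGaussMarkov

namespace FactoredDensity

variable {M d m : ℕ} (S : JumpGaussMarkov M d m) (y : ℕ → Fin m → ℝ) (T : ℕ)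
  (π : FactoredDensity M d)

theorem measurable_gPath : Measurable (π.gPath T) := by
  have := π.gLast_measurable
  unfold gPath
  fun_prop

theorem lintegral_gPath : ∫⁻ x, π.gPath T x = 1 :=
  π.lintegral_gChain T π.gLast_measurable π.gLast_lintegral

theorem fPath_congr {π π' : FactoredDensity M d} (hLast : π.fLast = π'.fLast)
    (hRev : π.fRev = π'.fRev) (T : ℕ) : π.fPath T = π'.fPath T := by
  funext z
  simp only [fPath, ReverseKernels.fCond, hLast, hRev]

theorem sum_fPath : ∑ z, π.fPath T z = 1 := π.sum_fChain T (PMF.sum_eq_one _)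

theorem fPath_ne_top (z : Fin (T + 1) → Fin M) : π.fPath T z ≠ ∞ := by
  refine ne_top_of_le_ne_top ENNReal.one_ne_top ?_
  rw [← π.sum_fPath T]
  exact Finset.single_le_sum (fun _ _ => zero_le) (Finset.mem_univ z)

theorem toReal_fPath_mem : (fun z => (π.fPath T z).toReal) ∈ stdSimplex ℝ (Fin (T + 1) → Fin M) :=
  ⟨fun _ => ENNReal.toReal_nonneg, by
    rw [← ENNReal.toReal_sum fun z _ => π.fPath_ne_top T z, π.sum_fPath, ENNReal.toReal_one]⟩

/-- The mode paths charged by `π` have positive prior probability. -/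
def SupportPossible : Prop := ∀ z, π.fPath T z ≠ 0 → S.ModePossible T z

theorem lowerBound_eq_bot (h : ¬ π.SupportPossible S T) : lowerBound S y T π = ⊥ := by
  unfold SupportPossible at h
  push Not at h
  obtain ⟨z, hz, hnot⟩ := h
  rw [lowerBound, hiddenPathMeasure_eq]
  refine extIntegral_factoredMeasure_eq_bot (π.measurable_gPath T) (π.lintegral_gPath T) hz
    (Filter.Eventually.of_forall fun x => ?_)
  simp only [S.unnormPath_eq_zero y T x hnot, ENNReal.zero_div, ENNReal.log_zero]

variable {S T π} in
theorem gibbsData (h : π.SupportPossible S T) :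
    GibbsData volume (π.gPath T) (π.fPath T) (S.unnormPath y T) (S.logPath y T)
      (S.logNormalizer y T fun z => (π.fPath T z).toReal) where
  measurable_density := π.measurable_gPath T
  lintegral_density := π.lintegral_gPath T
  sum_weight := π.sum_fPath T
  measurable_log z := (S.continuous_logPath y T z).measurable
  eq_exp z hz x := S.unnormPath_eq_exp y T x (h z hz)
  normalized := by
    obtain ⟨G, hG, -⟩ := S.exists_gaussianChain y T (π.toReal_fPath_mem T)
    simp_rw [hG]
    exact G.lintegral_pathDensity T

variable {S T π} in
-- The Gibbs principle on whole paths, with the mode path as finite variable. Its equality case is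
-- what makes the continuous factor of a posterior Gaussian.
theorem lowerBound_le (h : π.SupportPossible S T) :
    lowerBound S y T π ≤ (S.modeObjective y T fun z => (π.fPath T z).toReal : ℝ) ∧
    (lowerBound S y T π = (S.modeObjective y T fun z => (π.fPath T z).toReal : ℝ) →
      ∃ G : GaussianChain d, ∀ᵐ x, π.gPath T x = ENNReal.ofReal (G.pathDensity T x)) := by
  obtain ⟨h1, h2⟩ := (π.gibbsData y h).extIntegral_le_and_eq
  refine ⟨h1, fun h3 => ?_⟩
  obtain ⟨G, hG, -⟩ := S.exists_gaussianChain y T (π.toReal_fPath_mem T)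
  refine ⟨G, (h2 h3).mono fun x hx => ?_⟩
  rw [hx, ← hG]

theorem exists_lowerBound_eq (fLast : PMF (Fin M)) (fRev : ℕ → Fin M → PMF (Fin M)) :
    ∃ π : FactoredDensity M d, π.fLast = fLast ∧ π.fRev = fRev ∧ (π.SupportPossible S T →
      lowerBound S y T π = (S.modeObjective y T fun z => (π.fPath T z).toReal : ℝ)) := by
  obtain ⟨G₀⟩ : Nonempty (GaussianChain d) :=
    ⟨⟨0, 1, Matrix.PosDef.one, 0, 0, 1, fun _ => Matrix.PosDef.one⟩⟩
  -- The optimal chain depends on the mode path weights, which involve only the discrete factor; any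
  -- chain `G₀` serves to write them down.
  obtain ⟨G, hG, -⟩ := S.exists_gaussianChain y T ((G₀.toFactored fLast fRev).toReal_fPath_mem T)
  have hLast := G.toFactored_fLast fLast fRev
  have hRev := G.toFactored_fRev fLast fRev
  rw [fPath_congr (π' := G.toFactored fLast fRev)
    ((G₀.toFactored_fLast fLast fRev).trans hLast.symm)
    ((G₀.toFactored_fRev fLast fRev).trans hRev.symm)] at hG
  refine ⟨G.toFactored fLast fRev, hLast, hRev, fun h => ?_⟩
  have hd := gibbsData y h
  refine hd.extIntegral_eq (Filter.Eventually.of_forall fun x => ?_) fun z => ?_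
  · rw [G.toFactored_gPath, ← hG]
  · obtain ⟨B, hB⟩ := S.exists_isQuadratic_logPath y T z
    refine hB.integrable_withDensity hd.measurable_density ?_ ?_
    · rw [hd.lintegral_density]; exact ENNReal.one_ne_top
    · simp_rw [G.toFactored_gPath]
      exact G.lintegral_pathDensity_sq_enorm_ne_top T

end FactoredDensity


/-! ### Existence of a variational posterior. -/

section Existence

variable {M d m : ℕ}

theorem exists_pmf_toReal_eq {ι : Type*} [Fintype ι] {p : ι → ℝ} (hp : p ∈ stdSimplex ℝ ι) :
    ∃ P : PMF ι, ∀ a, (P a).toReal = p a := by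
  refine ⟨PMF.ofFintype (fun a => ENNReal.ofReal (p a)) ?_, fun a => ?_⟩
  · rw [← ENNReal.ofReal_sum_of_nonneg fun a _ => hp.1 a, hp.2, ENNReal.ofReal_one]
  · rw [PMF.ofFintype_apply, ENNReal.toReal_ofReal (hp.1 a)]

theorem PMF.toReal_mem_stdSimplex {ι : Type*} [Fintype ι] (P : PMF ι) :
    (fun a => (P a).toReal) ∈ stdSimplex ℝ ι :=
  ⟨fun _ => ENNReal.toReal_nonneg, by
    rw [← ENNReal.toReal_sum fun z _ => P.apply_ne_top z, P.sum_eq_one, ENNReal.toReal_one]⟩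

/-- The path weights of a reverse-time Markov chain of modes with the given parameters. -/
def chainWeight (T : ℕ) (θ : (Fin M → ℝ) × (Fin T → Fin M → Fin M → ℝ))
    (z : Fin (T + 1) → Fin M) : ℝ :=
  θ.1 (z (Fin.last T)) * ∏ i, θ.2 i (z i.succ) (z i.castSucc)

/-- The parameters of reverse-time Markov chains of modes. -/
def chainParameters (M T : ℕ) : Set ((Fin M → ℝ) × (Fin T → Fin M → Fin M → ℝ)) :=
  stdSimplex ℝ (Fin M) ×ˢ
    Set.univ.pi fun _ => Set.univ.pi fun _ => stdSimplex ℝ (Fin M)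

/-- The path weights of all reverse-time Markov chains of modes. -/
def markovWeights (M T : ℕ) : Set ((Fin (T + 1) → Fin M) → ℝ) :=
  chainWeight T '' chainParameters M T

/-- The path weights depend polynomially on parameters that range over a product of simplices. -/
theorem isCompact_markovWeights (M T : ℕ) : IsCompact (markovWeights M T) := by
  refine IsCompact.image ?_ ?_
  · exact (isCompact_stdSimplex ℝ _).prod (isCompact_univ_pi fun _ =>
      isCompact_univ_pi fun _ => isCompact_stdSimplex ℝ _)
  · unfold chainWeight
    fun_prop

theorem FactoredDensity.toReal_fPath (T : ℕ) (π : FactoredDensity M d)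
    (z : Fin (T + 1) → Fin M) : (π.fPath T z).toReal = (π.fLast (z (Fin.last T))).toReal *
      ∏ i : Fin T, (π.fRev i (z i.succ) (z i.castSucc)).toReal := by
  rw [fPath, ENNReal.toReal_mul, ReverseKernels.fCond, ENNReal.toReal_prod]

theorem FactoredDensity.toReal_fPath_mem_markovWeights (T : ℕ) (π : FactoredDensity M d) :
    (fun z => (π.fPath T z).toReal) ∈ markovWeights M T := by
  refine ⟨(fun z => (π.fLast z).toReal, fun i z z' => (π.fRev i z z').toReal),
    ⟨PMF.toReal_mem_stdSimplex _, fun i _ z _ => PMF.toReal_mem_stdSimplex _⟩, ?_⟩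
  funext z
  rw [π.toReal_fPath T, chainWeight]

theorem exists_pmf_of_mem_markovWeights {T : ℕ} {w : (Fin (T + 1) → Fin M) → ℝ}
    (hw : w ∈ markovWeights M T) : ∃ (fLast : PMF (Fin M)) (fRev : ℕ → Fin M → PMF (Fin M)),
      ∀ π : FactoredDensity M d, π.fLast = fLast → π.fRev = fRev →
        (fun z => (π.fPath T z).toReal) = w := by
  obtain ⟨θ, ⟨h1, h2⟩, rfl⟩ := hw
  obtain ⟨P, hP⟩ := exists_pmf_toReal_eq h1
  choose Q hQ using fun i z => exists_pmf_toReal_eq (h2 i trivial z trivial)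
  -- Kernels at times `t ≥ T` do not enter the path weights; `P` is an arbitrary filler.
  refine ⟨P, fun t z => if h : t < T then Q ⟨t, h⟩ z else P, fun π hf hr => ?_⟩
  funext z
  rw [π.toReal_fPath T, chainWeight, hf, hP, hr]
  congr 1
  refine Finset.prod_congr rfl fun i _ => ?_
  simp only [i.2, dite_true, Fin.eta, hQ]

theorem markovWeights_subset (d M T : ℕ) :
    markovWeights M T ⊆ stdSimplex ℝ (Fin (T + 1) → Fin M) := by
  intro w hw
  obtain ⟨P, Q, h⟩ := exists_pmf_of_mem_markovWeights (d := d) hw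
  have G : GaussianChain d := ⟨0, 1, Matrix.PosDef.one, 0, 0, 1, fun _ => Matrix.PosDef.one⟩
  rw [← h (G.toFactored P Q) rfl rfl]
  exact FactoredDensity.toReal_fPath_mem T _

/-- A deterministic path is a Markov chain with Dirac kernels. On a path of positive prior
probability it supplies a competitor with finite lower bound. -/
theorem pi_single_mem_markovWeights {T : ℕ} (z : Fin (T + 1) → Fin M) :
    (Pi.single z 1 : (Fin (T + 1) → Fin M) → ℝ) ∈ markovWeights M T := by
  refine ⟨(Pi.single (z (Fin.last T)) 1, fun i _ => Pi.single (z i.castSucc) 1),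
    ⟨single_mem_stdSimplex ℝ _, fun i _ _ _ => single_mem_stdSimplex ℝ _⟩, ?_⟩
  funext r
  rw [chainWeight]
  by_cases h : r = z
  · subst h; simp
  · rw [Pi.single_eq_of_ne h]
    have : ∃ i, r i ≠ z i := by
      by_contra! h'
      exact h (funext h')
    obtain ⟨i, hi⟩ := this
    rcases Fin.eq_castSucc_or_eq_last i with ⟨j, rfl⟩ | rfl
    · rw [Finset.prod_eq_zero (Finset.mem_univ j), mul_zero]
      exact Pi.single_eq_of_ne hi _
    · dsimp only
      rw [Pi.single_eq_of_ne hi, zero_mul]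

namespace JumpGaussMarkov

variable (S : JumpGaussMarkov M d m) (y : ℕ → Fin m → ℝ)

theorem exp_average_le {ι : Type*} [Fintype ι] {w : ι → ℝ} (hw : w ∈ stdSimplex ℝ ι)
    (L : ι → ℝ) : Real.exp (∑ z, w z * L z) ≤ ∑ z, Real.exp (L z) := by
  have h := convexOn_exp.map_sum_le (t := Finset.univ) (w := w) (p := L) (fun z _ => hw.1 z) hw.2
    fun _ _ => Set.mem_univ _
  simp only [smul_eq_mul] at h
  refine h.trans (Finset.sum_le_sum fun z _ => ?_)
  exact mul_le_of_le_one_left (Real.exp_pos _).le (mem_Icc_of_mem_stdSimplex hw z).2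

/-- Dominated convergence for the normalizer. By Jensen's inequality and weights at most one, the
sum of all `exp (logPath)` dominates uniformly in `w`; each summand is integrable, being the case of
a vertex of the simplex. -/
theorem continuousOn_modeObjective (T : ℕ) :
    ContinuousOn (S.modeObjective y T) (stdSimplex ℝ (Fin (T + 1) → Fin M)) := by
  unfold modeObjective
  refine ContinuousOn.add (Continuous.continuousOn ?_) ?_
  · exact continuous_finsetSum _ fun z _ => Real.continuous_negMulLog.comp (continuous_apply z)
  · unfold logNormalizer
    refine ContinuousOn.log ?_ fun w hw => ?_
    · refine continuousOn_of_dominated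
        (bound := fun x => ∑ z, Real.exp (S.logPath y T x z)) ?_ ?_ ?_ ?_
      · intro w _
        exact Continuous.aestronglyMeasurable (by fun_prop)
      · intro w hw
        refine Filter.Eventually.of_forall fun x => ?_
        rw [Real.norm_eq_abs, abs_of_pos (Real.exp_pos _)]
        exact exp_average_le hw _
      · refine integrable_finsetSum _ fun z _ => ?_
        obtain ⟨-, -, hint, -⟩ := S.exists_gaussianChain y T (single_mem_stdSimplex ℝ z)
        refine hint.congr (Filter.Eventually.of_forall fun x => ?_)
        simp [Pi.single_apply]
      · refine Filter.Eventually.of_forall fun x => Continuous.continuousOn ?_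
        fun_prop
    · obtain ⟨-, -, -, hpos⟩ := S.exists_gaussianChain y T hw
      exact hpos.ne'

end JumpGaussMarkov

theorem exists_isVariationalPosterior (T : ℕ) (S : JumpGaussMarkov M d m) (y : ℕ → Fin m → ℝ) :
    ∃ π : FactoredDensity M d, IsVariationalPosterior S y T π := by
  -- Continuity of `modeObjective` does not see forbidden paths, since `logPath` stays finite there.
  -- They are excluded by hand, which is a closed condition on the weights.
  let K : Set ((Fin (T + 1) → Fin M) → ℝ) :=
    markovWeights M T ∩ {w | ∀ z, ¬ S.ModePossible T z → w z = 0}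
  have hclosed : IsClosed {w : (Fin (T + 1) → Fin M) → ℝ | ∀ z, ¬ S.ModePossible T z → w z = 0} := by
    simp only [Set.ofPred_forall]
    exact isClosed_iInter fun z => isClosed_iInter fun _ =>
      isClosed_eq (continuous_apply z) continuous_const
  have hK : IsCompact K := (isCompact_markovWeights M T).inter_right hclosed
  have hne : K.Nonempty := by
    obtain ⟨z, hz⟩ := S.exists_modePossible T
    refine ⟨_, pi_single_mem_markovWeights z, fun r hr => Pi.single_eq_of_ne ?_ _⟩
    rintro rfl
    exact hr hz
  obtain ⟨w, hw, hmax⟩ := hK.exists_isMaxOn hne ((S.continuousOn_modeObjective y T).mono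
    (Set.inter_subset_left.trans (markovWeights_subset d M T)))
  obtain ⟨P, Q, hPQ⟩ := exists_pmf_of_mem_markovWeights (d := d) hw.1
  obtain ⟨π, hP, hQ, hπ⟩ := FactoredDensity.exists_lowerBound_eq S y T P Q
  have hwπ := hPQ π hP hQ
  have hsupp : π.SupportPossible S T := by
    intro z hz
    by_contra hnot
    have h0 : (π.fPath T z).toReal = 0 := (congrFun hwπ z).trans (hw.2 z hnot)
    exact (ENNReal.toReal_pos hz (π.fPath_ne_top T z)).ne' h0
  refine ⟨π, fun π' => ?_⟩
  by_cases hs : π'.SupportPossible S T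
  · rw [hπ hsupp, hwπ]
    refine (FactoredDensity.lowerBound_le y hs).1.trans (EReal.coe_le_coe_iff.mpr ?_)
    refine hmax ⟨π'.toReal_fPath_mem_markovWeights T, fun z hz => ?_⟩
    by_contra hne0
    exact hz (hs z fun h0 => hne0 (by simp only [h0, ENNReal.toReal_zero]))
  · rw [FactoredDensity.lowerBound_eq_bot S y T π' hs]
    exact bot_le

end Existence


/-! ### Structure of an arbitrary posterior. -/

section Optimality

variable {M d m : ℕ}

/-- The kernels and the final density of a reverse-time Markov density are determined, up to null
sets, by the density of the path. -/
theorem ReverseKernels.ae_eq_of_gChain_ae_eq (q q' : ReverseKernels M d)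
    (hpos : ∀ t x x', q'.gRev t x x' ≠ 0) (htop : ∀ t x x', q'.gRev t x x' ≠ ∞) (t : ℕ)
    {g g' : (Fin d → ℝ) → ℝ≥0∞} (hg : Measurable g) (hg' : Measurable g')
    (hg1 : ∫⁻ x, g x = 1) (hg1' : ∫⁻ x, g' x = 1) (hpos' : ∀ x, g' x ≠ 0)
    (htop' : ∀ x, g' x ≠ ∞)
    (h : ∀ᵐ x : Fin (t + 1) → Fin d → ℝ,
      g (x (Fin.last t)) * q.gCond t x = g' (x (Fin.last t)) * q'.gCond t x) :
    g =ᵐ[volume] g' ∧ ∀ s < t, ∀ᵐ x, q.gRev s x =ᵐ[volume] q'.gRev s x := by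
  induction t generalizing g g' with
  | zero =>
    refine ⟨?_, fun s hs => absurd hs (Nat.not_lt_zero s)⟩
    filter_upwards [ae_pi_fin_succ h] with a ha
    obtain ⟨p, hp⟩ := ha.exists
    simpa only [Fin.snoc_last, gCond, Finset.univ_eq_empty, Finset.prod_empty, mul_one] using hp
  | succ t ih =>
    have h1 : ∀ᵐ a, g a = g' a ∧ ∀ᵐ p : Fin (t + 1) → Fin d → ℝ,
        q.gRev t a (p (Fin.last t)) * q.gCond t p =
          q'.gRev t a (p (Fin.last t)) * q'.gCond t p := by
      filter_upwards [ae_pi_fin_succ h] with a ha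
      simp only [Fin.snoc_last, gCond_snoc] at ha
      -- Integrating out the past leaves the final densities at `a`. Once these agree, the positive
      -- finite factor `g' a` cancels and the shorter chains can be compared.
      have h2 := lintegral_congr_ae ha
      rw [lintegral_const_mul _ (by fun_prop), lintegral_const_mul _ (by fun_prop),
        q.lintegral_gChain t (g := q.gRev t a) (by fun_prop) (q.gRev_lintegral t a),
        q'.lintegral_gChain t (g := q'.gRev t a) (by fun_prop) (q'.gRev_lintegral t a),
        mul_one, mul_one] at h2
      refine ⟨h2, ha.mono fun p hp => ?_⟩
      rw [h2] at hp
      exact (ENNReal.mul_right_inj (hpos' a) (htop' a)).mp hp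
    have h2 : ∀ᵐ a, q.gRev t a =ᵐ[volume] q'.gRev t a ∧
        ∀ s < t, ∀ᵐ x, q.gRev s x =ᵐ[volume] q'.gRev s x :=
      h1.mono fun a ha => ih (by fun_prop) (by fun_prop) (q.gRev_lintegral t a)
        (q'.gRev_lintegral t a) (hpos t a) (htop t a) ha.2
    refine ⟨h1.mono fun a ha => ha.1, fun s hs => ?_⟩
    rcases (Nat.lt_succ_iff.mp hs).lt_or_eq with hs | rfl
    -- For `s < t` the conclusion does not involve the final state, so a single good `a` suffices.
    · obtain ⟨a, ha⟩ := h2.exists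
      exact ha.2 s hs
    · exact h2.mono fun a ha => ha.1

theorem FactoredDensity.ae_eq_of_gPath_ae_eq (π : FactoredDensity M d) (T : ℕ)
    (G : GaussianChain d) (h : ∀ᵐ x, π.gPath T x = ENNReal.ofReal (G.pathDensity T x)) :
    (∀ᵐ x, π.gLast x = ENNReal.ofReal (gaussianDensity G.mean G.cov x)) ∧
    ∀ s < T, ∀ᵐ x, ∀ᵐ x', π.gRev s x x' = ENNReal.ofReal (G.kernel s x x') := by
  have hne : ∀ t x x', (G.toFactored π.fLast π.fRev).gRev t x x' ≠ 0 := fun t x x' =>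
    (ENNReal.ofReal_pos.mpr (G.kernel_pos t x x')).ne'
  have hne' : ∀ x, (G.toFactored π.fLast π.fRev).gLast x ≠ 0 := fun x =>
    (ENNReal.ofReal_pos.mpr (gaussianDensity_pos _ G.cov_posDef x)).ne'
  have heq : ∀ᵐ x, π.gPath T x = (G.toFactored π.fLast π.fRev).gPath T x :=
    h.mono fun x hx => hx.trans (G.toFactored_gPath _ _ T x).symm
  exact ReverseKernels.ae_eq_of_gChain_ae_eq π.toReverseKernels
    (G.toFactored π.fLast π.fRev).toReverseKernels hne (fun _ _ _ => ENNReal.ofReal_ne_top) T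
    π.gLast_measurable (G.toFactored π.fLast π.fRev).gLast_measurable π.gLast_lintegral
    (G.toFactored π.fLast π.fRev).gLast_lintegral hne' (fun _ => ENNReal.ofReal_ne_top) heq

variable {S : JumpGaussMarkov M d m} {y : ℕ → Fin m → ℝ} {T : ℕ} {π : FactoredDensity M d}

theorem exists_lowerBound_ne_bot (T : ℕ) (S : JumpGaussMarkov M d m) (y : ℕ → Fin m → ℝ) :
    ∃ π : FactoredDensity M d, lowerBound S y T π ≠ ⊥ := by
  obtain ⟨z, hz⟩ := S.exists_modePossible T
  obtain ⟨P, Q, hPQ⟩ := exists_pmf_of_mem_markovWeights (d := d) (pi_single_mem_markovWeights z)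
  obtain ⟨π, hP, hQ, hπ⟩ := FactoredDensity.exists_lowerBound_eq S y T P Q
  refine ⟨π, ?_⟩
  rw [hπ fun r hr => ?_]
  · exact EReal.coe_ne_bot _
  · have h := congrFun (hPQ π hP hQ) r
    by_cases hrz : r = z
    · rwa [hrz]
    · rw [Pi.single_eq_of_ne hrz] at h
      exact absurd h (ENNReal.toReal_pos hr (π.fPath_ne_top T r)).ne'

theorem IsVariationalPosterior.supportPossible (h : IsVariationalPosterior S y T π) :
    π.SupportPossible S T := by
  by_contra hs
  obtain ⟨π', hπ'⟩ := exists_lowerBound_ne_bot T S y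
  have := h π'
  rw [FactoredDensity.lowerBound_eq_bot S y T π hs, le_bot_iff] at this
  exact hπ' this

/-- The posterior competes with the member having the same discrete factor and the best continuous
one. Hence it attains the Gibbs bound, and the equality case applies. -/
theorem IsVariationalPosterior.exists_gaussianChain (h : IsVariationalPosterior S y T π) :
    ∃ G : GaussianChain d, ∀ᵐ x, π.gPath T x = ENNReal.ofReal (G.pathDensity T x) := by
  have hs := h.supportPossible
  obtain ⟨hle, hG⟩ := FactoredDensity.lowerBound_le y hs
  refine hG (le_antisymm hle ?_)
  obtain ⟨π', hP, hQ, hπ'⟩ := FactoredDensity.exists_lowerBound_eq S y T π.fLast π.fRev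
  have hf := FactoredDensity.fPath_congr hP hQ T
  rw [← hf, ← hπ' fun z hz => hs z (by rwa [hf] at hz)]
  exact h π'

theorem GaussianChain.isGaussMarkov {G : GaussianChain d} {g : (Fin (T + 1) → Fin d → ℝ) → ℝ≥0∞}
    (h : ∀ᵐ x, g x = ENNReal.ofReal (G.pathDensity T x)) : IsGaussMarkov T g :=
  ⟨G.mean, G.cov, fun i => G.gain i, fun i => G.shift i, fun i => G.noise i, G.cov_posDef,
    fun i => G.noise_posDef i, h⟩

namespace FactoredDensity

variable (π) (T)

theorem fMarg_self : π.fMarg T T = fun z => π.fLast z := by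
  rw [fMarg, Nat.sub_self, fMargBack]

theorem gMarg_self : π.gMarg T T = π.gLast := by
  rw [gMarg, Nat.sub_self, gMargBack]

variable {T} {t : ℕ}

theorem fMarg_of_lt (ht : t < T) : π.fMarg T t = π.fStep t (π.fMarg T (t + 1)) := by
  obtain ⟨k, rfl⟩ : ∃ k, T = t + (k + 1) := ⟨T - t - 1, by omega⟩
  have h1 : t + (k + 1) - t = k + 1 := by omega
  have h2 : t + (k + 1) - (t + 1) = k := by omega
  have h3 : t + (k + 1) - (k + 1) = t := by omega
  rw [fMarg, fMarg, h1, h2, fMargBack, h3]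
  rfl

theorem gMarg_of_lt (ht : t < T) : π.gMarg T t = π.gStep t (π.gMarg T (t + 1)) := by
  obtain ⟨k, rfl⟩ : ∃ k, T = t + (k + 1) := ⟨T - t - 1, by omega⟩
  have h1 : t + (k + 1) - t = k + 1 := by omega
  have h2 : t + (k + 1) - (t + 1) = k := by omega
  have h3 : t + (k + 1) - (k + 1) = t := by omega
  rw [gMarg, gMarg, h1, h2, gMargBack, h3]
  rfl

theorem sum_fMarg (ht : t ≤ T) : ∑ z, π.fMarg T t z = 1 := by
  induction ht using Nat.decreasingInduction with
  | self => rw [fMarg_self]; exact PMF.sum_eq_one _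
  | of_succ t ht ih => rw [fMarg_of_lt π ht]; exact π.sum_fStep t ih

theorem measurable_gMarg (ht : t ≤ T) : Measurable (π.gMarg T t) := by
  induction ht using Nat.decreasingInduction with
  | self => rw [gMarg_self]; exact π.gLast_measurable
  | of_succ t ht ih => rw [gMarg_of_lt π ht]; exact π.measurable_gStep t ih

theorem lintegral_gMarg (ht : t ≤ T) : ∫⁻ x, π.gMarg T t x = 1 := by
  induction ht using Nat.decreasingInduction with
  | self => rw [gMarg_self]; exact π.gLast_lintegral
  | of_succ t ht ih =>
    rw [gMarg_of_lt π ht]; exact π.lintegral_gStep t (π.measurable_gMarg ht) ih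

theorem exists_fRev_ne_zero (ht : t < T) {z' : Fin M} (hz' : π.fMarg T t z' ≠ 0) :
    ∃ z, π.fRev t z z' ≠ 0 ∧ π.fMarg T (t + 1) z ≠ 0 := by
  rw [fMarg_of_lt π ht] at hz'
  obtain ⟨z, -, hz⟩ := Finset.exists_ne_zero_of_sum_ne_zero hz'
  exact ⟨z, mul_ne_zero_iff.mp hz⟩

theorem fMarg_ne_zero (ht : t < T) {z z' : Fin M} (hz : π.fMarg T (t + 1) z ≠ 0)
    (hzz' : π.fRev t z z' ≠ 0) : π.fMarg T t z' ≠ 0 := by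
  rw [fMarg_of_lt π ht]
  intro h0
  have := Finset.sum_eq_zero_iff.mp h0 z (Finset.mem_univ z)
  exact (mul_ne_zero hzz' hz) this

variable {π}

/-- A partial path ending in a charged mode extends forward in time, one mode at a time, to a full
path charged by `π`; that path has positive prior probability. -/
theorem SupportPossible.modePossible (h : π.SupportPossible S T) (ht : t ≤ T)
    (r : Fin (t + 1) → Fin M) (hr : π.fMarg T t (r (Fin.last t)) ≠ 0) (hr' : π.fCond t r ≠ 0) :
    S.ModePossible t r := by
  induction ht using Nat.decreasingInduction with
  | self => exact h r (mul_ne_zero (by rwa [fMarg_self] at hr) hr')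
  | of_succ t ht ih =>
    obtain ⟨z, hz, hz1⟩ := π.exists_fRev_ne_zero ht hr
    have := ih (Fin.snoc r z) (by rwa [Fin.snoc_last])
      (by rw [ReverseKernels.fCond_snoc]; exact mul_ne_zero hz hr')
    rw [JumpGaussMarkov.modePossible_succ, Fin.init_snoc] at this
    exact this.1

theorem _root_.ReverseKernels.exists_fCond_ne_zero (q : ReverseKernels M d) (t : ℕ) (z : Fin M) :
    ∃ r : Fin (t + 1) → Fin M, r (Fin.last t) = z ∧ q.fCond t r ≠ 0 := by
  induction t generalizing z with
  | zero => exact ⟨fun _ => z, rfl, by simp [ReverseKernels.fCond]⟩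
  | succ t ih =>
    obtain ⟨z', hz'⟩ := (q.fRev t z).support_nonempty
    obtain ⟨r, hr, hr'⟩ := ih z'
    refine ⟨Fin.snoc r z, Fin.snoc_last _ _, ?_⟩
    rw [q.fCond_snoc, hr]
    exact mul_ne_zero ((PMF.mem_support_iff _ _).mp hz') hr'

theorem SupportPossible.modeTrans_ne_zero (h : π.SupportPossible S T) (ht : t < T) {z z' : Fin M}
    (hz : π.fMarg T (t + 1) z ≠ 0) (hzz' : π.fRev t z z' ≠ 0) : S.modeTrans t z' z ≠ 0 := by
  obtain ⟨r, hr, hr'⟩ := π.exists_fCond_ne_zero t z'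
  have := h.modePossible (Nat.succ_le_of_lt ht) (Fin.snoc r z) (by rwa [Fin.snoc_last])
    (by rw [ReverseKernels.fCond_snoc, hr]; exact mul_ne_zero hzz' hr')
  rw [JumpGaussMarkov.modePossible_succ, Fin.snoc_castSucc, Fin.snoc_last, hr] at this
  exact this.2

theorem SupportPossible.modeInit_ne_zero (h : π.SupportPossible S T) {z : Fin M}
    (hz : π.fMarg T 0 z ≠ 0) : S.modeInit z ≠ 0 :=
  (h.modePossible (Nat.zero_le T) (fun _ => z) hz (by simp [ReverseKernels.fCond])).1

/-- The final marginal is Gaussian, and each Gaussian kernel sends finite second moments to finite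
second moments. -/
theorem lintegral_gMarg_sq_enorm_ne_top {G : GaussianChain d}
    (hlast : ∀ᵐ x, π.gLast x = ENNReal.ofReal (gaussianDensity G.mean G.cov x))
    (hrev : ∀ s < T, ∀ᵐ x, ∀ᵐ x', π.gRev s x x' = ENNReal.ofReal (G.kernel s x x'))
    (ht : t ≤ T) : ∫⁻ x, π.gMarg T t x * ‖x‖ₑ ^ 2 ≠ ∞ := by
  induction ht using Nat.decreasingInduction with
  | self =>
    rw [gMarg_self, lintegral_congr_ae (g := fun x =>
      ENNReal.ofReal (gaussianDensity G.mean G.cov x) * ‖x‖ₑ ^ 2)]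
    · exact G.lintegral_last_sq_enorm_ne_top
    · filter_upwards [hlast] with x hx
      rw [hx]
  | of_succ t ht ih =>
    have hm := π.measurable_gMarg (Nat.succ_le_of_lt ht)
    rw [gMarg_of_lt π ht, π.lintegral_gStep_mul t hm (by fun_prop)]
    obtain ⟨K, hK, hle⟩ := G.exists_lintegral_kernel_sq_enorm_le t
    have hle' : ∫⁻ x, π.gMarg T (t + 1) x * ∫⁻ x', π.gRev t x x' * ‖x'‖ₑ ^ 2 ≤
        ∫⁻ x, K * (π.gMarg T (t + 1) x + π.gMarg T (t + 1) x * ‖x‖ₑ ^ 2) := by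
      refine lintegral_mono_ae ?_
      filter_upwards [hrev t ht] with x hx
      calc π.gMarg T (t + 1) x * ∫⁻ x', π.gRev t x x' * ‖x'‖ₑ ^ 2
          = π.gMarg T (t + 1) x * ∫⁻ x', ENNReal.ofReal (G.kernel t x x') * ‖x'‖ₑ ^ 2 := by
            congr 1
            refine lintegral_congr_ae ?_
            filter_upwards [hx] with x' hx'
            rw [hx']
        _ ≤ π.gMarg T (t + 1) x * (K * (1 + ‖x‖ₑ ^ 2)) := by gcongr; exact hle x
        _ = _ := by ring
    refine ne_top_of_le_ne_top ?_ hle'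
    rw [lintegral_const_mul' _ _ hK, lintegral_add_left hm,
      π.lintegral_gMarg (Nat.succ_le_of_lt ht)]
    exact ENNReal.mul_ne_top hK (ENNReal.add_ne_top.mpr ⟨ENNReal.one_ne_top, ih⟩)

end FactoredDensity

end Optimality


/-! ### The joint law of two consecutive hidden states. -/

section OneStep

variable {M d m : ℕ}

instance {g : (Fin d → ℝ) → ℝ≥0∞} {f : Fin M → ℝ≥0∞} : SFinite (hiddenMeasure g f) := by
  unfold hiddenMeasure
  infer_instance

theorem isProbabilityMeasure_hiddenMeasure {g : (Fin d → ℝ) → ℝ≥0∞} (hg : Measurable g)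
    (hg1 : ∫⁻ x, g x = 1) {f : Fin M → ℝ≥0∞} (hf1 : ∑ z, f z = 1) :
    IsProbabilityMeasure (hiddenMeasure g f) :=
  isProbabilityMeasure_factoredMeasure hg hg1 hf1

namespace ReverseKernels

variable (q : ReverseKernels M d) (t : ℕ)

/-- The reverse-time transition kernel of the hidden state from time `t + 1` to time `t`. -/
def stepKernel : ProbabilityTheory.Kernel ((Fin d → ℝ) × Fin M) ((Fin d → ℝ) × Fin M) where
  toFun p := hiddenMeasure (q.gRev t p.1) (q.fRev t p.2)
  measurable' := by
    refine Measure.measurable_of_measurable_coe _ fun s hs => measurable_prod_of_finite fun z => ?_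
    have h : ∀ x, hiddenMeasure (q.gRev t x) (q.fRev t z) s =
        ∑ z', q.fRev t z z' * ∫⁻ x', q.gRev t x x' * s.indicator 1 (x', z') := by
      intro x
      rw [← lintegral_indicator_one hs]
      exact lintegral_hiddenMeasure (by fun_prop) _ (measurable_one.indicator hs)
    simp_rw [h]
    refine Finset.measurable_sum _ fun z' _ => Measurable.const_mul ?_ _
    refine Measurable.lintegral_prod_right' (f := fun p : (Fin d → ℝ) × (Fin d → ℝ) =>
      q.gRev t p.1 p.2 * s.indicator 1 (p.2, z')) ?_
    have : Measurable (s.indicator (1 : (Fin d → ℝ) × Fin M → ℝ≥0∞)) := measurable_one.indicator hs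
    fun_prop

theorem stepKernel_apply (p : (Fin d → ℝ) × Fin M) :
    q.stepKernel t p = hiddenMeasure (q.gRev t p.1) (q.fRev t p.2) := rfl

instance : ProbabilityTheory.IsMarkovKernel (q.stepKernel t) :=
  ⟨fun _ => isProbabilityMeasure_hiddenMeasure (by fun_prop) (q.gRev_lintegral t _)
    (PMF.sum_eq_one _)⟩

variable {q t} in
theorem stepKernel_congr {q' : ReverseKernels M d} (hg : q.gRev t = q'.gRev t)
    (hf : q.fRev t = q'.fRev t) : q.stepKernel t = q'.stepKernel t := by
  ext1 p
  rw [stepKernel_apply, stepKernel_apply, hg, hf]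

/-- The joint law of the hidden states at times `t + 1` and `t`, when `g(x) f(z)` is the law at
time `t + 1`. -/
def stepMeasure (g : (Fin d → ℝ) → ℝ≥0∞) (f : Fin M → ℝ≥0∞) :
    Measure (((Fin d → ℝ) × Fin M) × ((Fin d → ℝ) × Fin M)) :=
  (hiddenMeasure g f).compProd (q.stepKernel t)

variable {g : (Fin d → ℝ) → ℝ≥0∞} (f : Fin M → ℝ≥0∞)

theorem lintegral_stepMeasure (hg : Measurable g)
    {F : ((Fin d → ℝ) × Fin M) × ((Fin d → ℝ) × Fin M) → ℝ≥0∞} (hF : Measurable F) :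
    ∫⁻ s, F s ∂q.stepMeasure t g f =
      ∑ c, f c * ∫⁻ a, g a * ∫⁻ p', F ((a, c), p') ∂hiddenMeasure (q.gRev t a) (q.fRev t c) := by
  rw [stepMeasure, Measure.lintegral_compProd hF,
    lintegral_hiddenMeasure hg f hF.lintegral_kernel_prod_right']
  rfl

theorem lintegral_stepMeasure_fst {F : (Fin d → ℝ) × Fin M → ℝ≥0∞}
    (hF : Measurable F) :
    ∫⁻ s, F s.1 ∂q.stepMeasure t g f = ∫⁻ p, F p ∂hiddenMeasure g f := by
  rw [stepMeasure, Measure.lintegral_compProd (by fun_prop)]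
  simp

theorem lintegral_stepMeasure_snd (hg : Measurable g) {F : (Fin d → ℝ) × Fin M → ℝ≥0∞}
    (hF : Measurable F) :
    ∫⁻ s, F s.2 ∂q.stepMeasure t g f =
      ∫⁻ p, F p ∂hiddenMeasure (q.gStep t g) (q.fStep t f) := by
  rw [q.lintegral_stepMeasure t f hg (by fun_prop),
    lintegral_hiddenMeasure (q.measurable_gStep t hg) _ hF]
  have h1 : ∀ a c, ∫⁻ p', F p' ∂hiddenMeasure (q.gRev t a) (q.fRev t c) =
      ∑ z', q.fRev t c z' * ∫⁻ x', q.gRev t a x' * F (x', z') := fun a c =>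
    lintegral_hiddenMeasure (by fun_prop) _ hF
  have hm : ∀ z', Measurable fun a => ∫⁻ x', q.gRev t a x' * F (x', z') := fun z' =>
    Measurable.lintegral_prod_right' (f := fun p : (Fin d → ℝ) × (Fin d → ℝ) =>
      q.gRev t p.1 p.2 * F (p.2, z')) (by fun_prop)
  simp only [h1, Finset.mul_sum]
  simp_rw [fun z' => q.lintegral_gStep_mul t hg (F := fun x' => F (x', z')) (by fun_prop)]
  have h2 : ∀ c, ∫⁻ a, ∑ z', g a * (q.fRev t c z' * ∫⁻ x', q.gRev t a x' * F (x', z')) =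
      ∑ z', q.fRev t c z' * ∫⁻ a, g a * ∫⁻ x', q.gRev t a x' * F (x', z') := by
    intro c
    rw [lintegral_finsetSum]
    swap
    · exact fun z' _ => hg.mul ((hm z').const_mul _)
    refine Finset.sum_congr rfl fun z' _ => ?_
    rw [← lintegral_const_mul]
    swap
    · exact hg.mul (hm z')
    refine lintegral_congr fun a => ?_
    ring
  simp_rw [h2, Finset.mul_sum]
  rw [Finset.sum_comm]
  refine Finset.sum_congr rfl fun z' _ => ?_
  rw [fStep, Finset.sum_mul]
  refine Finset.sum_congr rfl fun c _ => ?_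
  ring

theorem map_snd_stepMeasure (hg : Measurable g) : (q.stepMeasure t g f).map Prod.snd =
    hiddenMeasure (q.gStep t g) (q.fStep t f) := by
  refine Measure.ext_of_lintegral _ fun F hF => ?_
  rw [lintegral_map hF measurable_snd, q.lintegral_stepMeasure_snd t f hg hF]

/-- The last two hidden states of a path. -/
def lastTwo (t : ℕ) (p : (Fin (t + 2) → Fin d → ℝ) × (Fin (t + 2) → Fin M)) :
    ((Fin d → ℝ) × Fin M) × ((Fin d → ℝ) × Fin M) :=
  ((p.1 (Fin.last (t + 1)), p.2 (Fin.last (t + 1))),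
    (p.1 (Fin.last t).castSucc, p.2 (Fin.last t).castSucc))

@[fun_prop]
theorem measurable_lastTwo : Measurable (lastTwo (M := M) (d := d) t) := by
  unfold lastTwo
  fun_prop

/-- Reduces integrals of one-step quantities over paths to a composition product, where Fubini's
theorem is available. -/
theorem map_lastTwo_chainMeasure (hg : Measurable g) :
    (q.chainMeasure (t + 1) g f).map (lastTwo t) = q.stepMeasure t g f := by
  refine Measure.ext_of_lintegral _ fun F hF => ?_
  rw [lintegral_map hF (measurable_lastTwo t), q.lintegral_stepMeasure t f hg hF]
  exact q.lintegral_chainMeasure_last_two t hg f hF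

/-- The reverse-time kernels at step `t` have the continuous part of the Gaussian chain `G`. -/
def IsGaussianAt (G : GaussianChain d) : Prop :=
  ∀ᵐ x, ∀ᵐ x', q.gRev t x x' = ENNReal.ofReal (G.kernel t x x')

variable {q t} in
theorem ae_stepMeasure {G : GaussianChain d} (hG : q.IsGaussianAt t G) (hg : Measurable g)
    {Φ : ((Fin d → ℝ) × Fin M) × ((Fin d → ℝ) × Fin M) → Prop} (hΦ : MeasurableSet {s | Φ s})
    (h : ∀ z z', f z ≠ 0 → q.fRev t z z' ≠ 0 → ∀ x x',
      q.gRev t x x' = ENNReal.ofReal (G.kernel t x x') → Φ ((x, z), (x', z'))) :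
    ∀ᵐ s ∂q.stepMeasure t g f, Φ s := by
  refine Measure.ae_compProd_of_ae_ae hΦ (ae_factoredMeasure hg f fun z hz => ?_)
  filter_upwards [hG] with x hx _
  refine ae_factoredMeasure (by fun_prop) _ fun z' hz' => ?_
  filter_upwards [hx] with x' hx' _
  exact h z z' hz hz' x x' hx'

variable {q t f} in
/-- Functions that are quadratic for each pair of modes are integrable. -/
theorem integrable_stepMeasure {G : GaussianChain d} (hG : q.IsGaussianAt t G) (hg : Measurable g)
    (hg1 : ∫⁻ x, g x = 1) (hg2 : ∫⁻ x, g x * ‖x‖ₑ ^ 2 ≠ ∞) (hf1 : ∑ z, f z = 1)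
    {Ψ : ((Fin d → ℝ) × Fin M) × ((Fin d → ℝ) × Fin M) → ℝ}
    (hΨ : ∀ z z', ∃ B, IsQuadratic (fun p : (Fin d → ℝ) × (Fin d → ℝ) =>
      Ψ ((p.2, z), (p.1, z'))) B) : Integrable Ψ (q.stepMeasure t g f) := by
  choose B hB using hΨ
  choose K hK hle using fun z z' => (hB z z').exists_enorm_le
  have hmeas : Measurable Ψ := by
    have h1 : ∀ z z', Measurable fun p : (Fin d → ℝ) × (Fin d → ℝ) => Ψ ((p.2, z), (p.1, z')) :=
      fun z z' => (hB z z').continuous.measurable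
    let e : (((Fin d → ℝ) × (Fin d → ℝ)) × (Fin M × Fin M)) → ℝ :=
      fun p => Ψ ((p.1.2, p.2.1), (p.1.1, p.2.2))
    have he : Measurable e := measurable_prod_of_finite fun z => h1 z.1 z.2
    exact he.comp (g := e) (f := fun s : ((Fin d → ℝ) × Fin M) × ((Fin d → ℝ) × Fin M) =>
      ((s.2.1, s.1.1), (s.1.2, s.2.2))) (by fun_prop)
  obtain ⟨Kt, hKt, hlet⟩ := G.exists_lintegral_kernel_sq_enorm_le t
  have hbound : ∀ s, ‖Ψ s‖ₑ ≤ (∑ z, ∑ z', K z z') * (1 + (‖s.1.1‖ₑ ^ 2 + ‖s.2.1‖ₑ ^ 2)) := by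
    rintro ⟨⟨x, z⟩, ⟨x', z'⟩⟩
    refine (hle z z' (x', x)).trans ?_
    refine mul_le_mul' ?_ ?_
    · exact (Finset.single_le_sum (f := fun z' => K z z') (fun _ _ => zero_le)
        (Finset.mem_univ z')).trans (Finset.single_le_sum (f := fun z => ∑ z', K z z')
        (fun _ _ => zero_le) (Finset.mem_univ z))
    · gcongr
      rw [enorm_eq_nnnorm, Prod.nnnorm_def]
      rcases le_total ‖x'‖₊ ‖x‖₊ with h | h
      · rw [max_eq_right h]; exact le_self_add
      · rw [max_eq_left h]; exact le_add_self
  have hprob := isProbabilityMeasure_hiddenMeasure hg hg1 hf1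
  refine ⟨hmeas.aestronglyMeasurable, (lintegral_mono hbound).trans_lt ?_⟩
  have hK' : ∑ z, ∑ z', K z z' ≠ ∞ :=
    ENNReal.sum_ne_top.mpr fun z _ => ENNReal.sum_ne_top.mpr fun z' _ => hK z z'
  have hone : ∫⁻ _, 1 ∂q.stepMeasure t g f = 1 := by
    rw [q.lintegral_stepMeasure_fst t f (F := fun _ => 1) (by fun_prop)]
    simp
  have hfst : ∫⁻ s, ‖s.1.1‖ₑ ^ 2 ∂q.stepMeasure t g f = ∫⁻ x, g x * ‖x‖ₑ ^ 2 := by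
    rw [q.lintegral_stepMeasure_fst t f (F := fun p => ‖p.1‖ₑ ^ 2) (by fun_prop),
      lintegral_hiddenMeasure hg f (by fun_prop)]
    dsimp only
    rw [← Finset.sum_mul, hf1, one_mul]
  have hsnd : ∫⁻ s, ‖s.2.1‖ₑ ^ 2 ∂q.stepMeasure t g f ≤
      Kt * (1 + ∫⁻ x, g x * ‖x‖ₑ ^ 2) := by
    rw [q.lintegral_stepMeasure_snd t f hg (F := fun p => ‖p.1‖ₑ ^ 2) (by fun_prop),
      lintegral_hiddenMeasure (q.measurable_gStep t hg) _ (by fun_prop)]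
    dsimp only
    rw [← Finset.sum_mul, q.sum_fStep t hf1, one_mul, q.lintegral_gStep_mul t hg (by fun_prop)]
    calc ∫⁻ x, g x * ∫⁻ x', q.gRev t x x' * ‖x'‖ₑ ^ 2
        ≤ ∫⁻ x, Kt * (g x + g x * ‖x‖ₑ ^ 2) := by
          refine lintegral_mono_ae ?_
          filter_upwards [hG] with x hx
          calc g x * ∫⁻ x', q.gRev t x x' * ‖x'‖ₑ ^ 2
              = g x * ∫⁻ x', ENNReal.ofReal (G.kernel t x x') * ‖x'‖ₑ ^ 2 := by
                congr 1
                refine lintegral_congr_ae ?_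
                filter_upwards [hx] with x' hx'
                rw [hx']
            _ ≤ g x * (Kt * (1 + ‖x‖ₑ ^ 2)) := by gcongr; exact hlet x
            _ = _ := by ring
      _ = Kt * (1 + ∫⁻ x, g x * ‖x‖ₑ ^ 2) := by
          rw [lintegral_const_mul' _ _ hKt, lintegral_add_left hg, hg1]
  rw [lintegral_const_mul' _ _ hK', lintegral_add_left measurable_const, hone,
    lintegral_add_left (by fun_prop), hfst]
  exact ENNReal.mul_lt_top (lt_top_iff_ne_top.mpr hK') (ENNReal.add_lt_top.mpr
    ⟨ENNReal.one_lt_top, ENNReal.add_lt_top.mpr ⟨lt_top_iff_ne_top.mpr hg2,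
      hsnd.trans_lt (by finiteness)⟩⟩)

end ReverseKernels

end OneStep


/-! ### One step of the forward representer. -/

section Representer

variable {M d m : ℕ}

theorem integrable_hiddenMeasure {g : (Fin d → ℝ) → ℝ≥0∞} (hg : Measurable g)
    (hg1 : ∫⁻ x, g x = 1) (hg2 : ∫⁻ x, g x * ‖x‖ₑ ^ 2 ≠ ∞) {f : Fin M → ℝ≥0∞}
    (hf1 : ∑ z, f z = 1) {Ψ : (Fin d → ℝ) × Fin M → ℝ}
    (hΨ : ∀ z, ∃ B, IsQuadratic (fun x => Ψ (x, z)) B) : Integrable Ψ (hiddenMeasure g f) := by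
  choose B hB using hΨ
  choose K hK hle using fun z => (hB z).exists_enorm_le
  have hmeas : Measurable Ψ := measurable_prod_of_finite fun z => (hB z).continuous.measurable
  refine ⟨hmeas.aestronglyMeasurable, ?_⟩
  have hbound : ∀ p, ‖Ψ p‖ₑ ≤ (∑ z, K z) * (1 + ‖p.1‖ₑ ^ 2) := by
    rintro ⟨x, z⟩
    refine (hle z x).trans (mul_le_mul' ?_ le_rfl)
    exact Finset.single_le_sum (f := K) (fun _ _ => zero_le) (Finset.mem_univ z)
  have hK' : ∑ z, K z ≠ ∞ := ENNReal.sum_ne_top.mpr fun z _ => hK z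
  refine (lintegral_mono hbound).trans_lt ?_
  have hprob := isProbabilityMeasure_hiddenMeasure hg hg1 hf1
  rw [lintegral_const_mul' _ _ hK', lintegral_add_left measurable_const, lintegral_one,
    measure_univ, lintegral_hiddenMeasure hg f (by fun_prop)]
  dsimp only
  rw [← Finset.sum_mul, hf1, one_mul]
  exact ENNReal.mul_lt_top (lt_top_iff_ne_top.mpr hK')
    (ENNReal.add_lt_top.mpr ⟨ENNReal.one_lt_top, lt_top_iff_ne_top.mpr hg2⟩)

theorem integral_hiddenMeasure {g : (Fin d → ℝ) → ℝ≥0∞} (hg : Measurable g)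
    (hg1 : ∫⁻ x, g x = 1) (hg2 : ∫⁻ x, g x * ‖x‖ₑ ^ 2 ≠ ∞) {f : Fin M → ℝ≥0∞}
    (hf1 : ∑ z, f z = 1) {Ψ : (Fin d → ℝ) × Fin M → ℝ}
    (hΨ : ∀ z, ∃ B, IsQuadratic (fun x => Ψ (x, z)) B) :
    ∫ p, Ψ p ∂hiddenMeasure g f = ∑ z, (f z).toReal * ∫ x, Ψ (x, z) ∂volume.withDensity g := by
  have h1 := extIntegral_coe (integrable_hiddenMeasure hg hg1 hg2 hf1 hΨ)
  have hf : ∀ z, f z ≠ ∞ := fun z => ne_top_of_le_ne_top ENNReal.one_ne_top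
    (hf1 ▸ Finset.single_le_sum (fun _ _ => zero_le) (Finset.mem_univ z))
  have h2 := extIntegral_factoredMeasure_coe (R := fun x z => Ψ (x, z)) hg hf
    (fun z => (hΨ z).choose_spec.continuous.measurable) fun z _ =>
      (hΨ z).choose_spec.integrable_withDensity hg (by rw [hg1]; simp) hg2
  exact EReal.coe_eq_coe_iff.mp (h1.symm.trans h2)

theorem integral_withDensity_gaussianDensity {g : (Fin d → ℝ) → ℝ≥0∞} {μ : Fin d → ℝ}
    {C : Matrix (Fin d) (Fin d) ℝ} (hC : C.PosDef)
    (hg : ∀ᵐ x, g x = ENNReal.ofReal (gaussianDensity μ C x)) (h : (Fin d → ℝ) → ℝ) :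
    ∫ x, h x ∂volume.withDensity g = ∫ x, h x * gaussianDensity μ C x := by
  have hm : Measurable fun x => ENNReal.ofReal (gaussianDensity μ C x) :=
    (Continuous.gaussianDensity continuous_const continuous_id C).measurable.ennreal_ofReal
  rw [withDensity_congr_ae hg, integral_withDensity_eq_integral_toReal_smul hm
    (Filter.Eventually.of_forall fun _ => ENNReal.ofReal_lt_top)]
  refine integral_congr_ae (Filter.Eventually.of_forall fun x => ?_)
  simp only [smul_eq_mul]
  rw [ENNReal.toReal_ofReal (gaussianDensity_pos _ hC x).le, mul_comm]

namespace JumpGaussMarkov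

variable (S : JumpGaussMarkov M d m) (y : ℕ → Fin m → ℝ) (t : ℕ) (G : GaussianChain d)
  (fr : Fin M → PMF (Fin M))

/-- The logarithm of the ratio of the unnormalized transition density and the reverse-time
transition density, as a function of the hidden states at times `t + 1` and `t`. -/
def stepLog (s : ((Fin d → ℝ) × Fin M) × ((Fin d → ℝ) × Fin M)) : ℝ :=
  S.logTrans y t s.2.1 s.2.2 s.1.1 s.1.2 - Real.log (G.kernel t s.1.1 s.2.1) -
    Real.log (fr s.1.2 s.2.2).toReal

theorem exists_isQuadratic_stepLog (z z' : Fin M) : ∃ B, IsQuadratic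
    (fun p : (Fin d → ℝ) × (Fin d → ℝ) => S.stepLog y t G fr ((p.2, z), (p.1, z'))) B := by
  obtain ⟨B, hB, -⟩ := S.isTransitionQuadratic_logTrans y t z' z
  have h := isQuadratic_log_gaussianDensity_comp (G.noise_posDef t)
    (m := fun p : (Fin d → ℝ) × (Fin d → ℝ) => (G.gain t).mulVec p.2 + G.shift t)
    (x := fun p => p.1)
    (LinearMap.fst ℝ _ _ - (Matrix.toLin' (G.gain t) ∘ₗ LinearMap.snd ℝ _ _)) (-G.shift t)
    fun v => by
      simp only [LinearMap.sub_apply, LinearMap.comp_apply, LinearMap.snd_apply,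
        LinearMap.fst_apply, Matrix.toLin'_apply]
      abel
  refine ⟨_, ((hB.add (h.const_mul (-1))).add_const
    (-Real.log (fr z z').toReal)).congr fun p => ?_⟩
  simp only [stepLog, GaussianChain.kernel]
  ring

theorem measurable_stepLog : Measurable (S.stepLog y t G fr) := by
  have h1 : ∀ z z', Measurable fun p : (Fin d → ℝ) × (Fin d → ℝ) =>
      S.stepLog y t G fr ((p.2, z), (p.1, z')) := fun z z' =>
    (S.exists_isQuadratic_stepLog y t G fr z z').choose_spec.continuous.measurable
  let e : (((Fin d → ℝ) × (Fin d → ℝ)) × (Fin M × Fin M)) → ℝ :=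
    fun p => S.stepLog y t G fr ((p.1.2, p.2.1), (p.1.1, p.2.2))
  have he : Measurable e := measurable_prod_of_finite fun z => h1 z.1 z.2
  exact he.comp (g := e) (f := fun s : ((Fin d → ℝ) × Fin M) × ((Fin d → ℝ) × Fin M) =>
    ((s.2.1, s.1.1), (s.1.2, s.2.2))) (by fun_prop)

variable {t G} in
theorem unnormTrans_div {q : ReverseKernels M d} {x x' : Fin d → ℝ} {z z' : Fin M}
    (hz : q.fRev t z z' ≠ 0) (hS : S.modeTrans t z' z ≠ 0)
    (hq : q.gRev t x x' = ENNReal.ofReal (G.kernel t x x')) :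
    S.unnormTrans y t x' z' x z / (q.gRev t x x' * q.fRev t z z') =
      ENNReal.ofReal (Real.exp (S.stepLog y t G (q.fRev t) ((x, z), (x', z')))) := by
  have hf : 0 < (q.fRev t z z').toReal := ENNReal.toReal_pos hz (PMF.apply_ne_top _ _)
  have hk := G.kernel_pos t x x'
  rw [S.unnormTrans_eq_exp y t x' x hS, hq, ← ENNReal.ofReal_toReal (PMF.apply_ne_top _ z'),
    ← ENNReal.ofReal_mul hk.le, ← ENNReal.ofReal_div_of_pos (mul_pos hk hf), stepLog, Real.exp_sub,
    Real.exp_sub, Real.exp_log hk, Real.exp_log hf, div_div]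

end JumpGaussMarkov

/-- `α` is almost everywhere the exponential of a strictly concave quadratic function. -/
def IsExpQuadratic (α : (Fin d → ℝ) → ℝ≥0∞) (β : (Fin d → ℝ) → ℝ) : Prop :=
  IsConcaveQuadratic β ∧ ∀ᵐ x, α x = ENNReal.ofReal (Real.exp (β x))

variable (S : JumpGaussMarkov M d m) (y : ℕ → Fin m → ℝ) {t : ℕ} {q : ReverseKernels M d}
  {G : GaussianChain d}

variable (t q) in
theorem forwardRepresenter_succ (x : Fin d → ℝ) (z : Fin M) :
    forwardRepresenter S y q (t + 1) x z = EReal.exp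
      (extIntegral (hiddenMeasure (q.gRev t x) (q.fRev t z)) fun p =>
        ENNReal.log (S.unnormTrans y t p.1 p.2 x z * forwardRepresenter S y q t p.1 p.2 /
          (q.gRev t x p.1 * q.fRev t z p.2))) := rfl

/-- The kernel gives `z'` positive mass, and the log integrand is `-∞` on that slice, so the
expectation is `-∞` and its exponential is zero. -/
theorem forwardRepresenter_succ_eq_zero {z z' : Fin M} (hz : q.fRev t z z' ≠ 0)
    (h : S.modeTrans t z' z = 0 ∨ ∀ᵐ x', forwardRepresenter S y q t x' z' = 0)
    (x : Fin d → ℝ) : forwardRepresenter S y q (t + 1) x z = 0 := by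
  rw [forwardRepresenter_succ, hiddenMeasure_eq, extIntegral_factoredMeasure_eq_bot (z := z')
    (by fun_prop) (q.gRev_lintegral t x) hz, EReal.exp_bot]
  rcases h with h | h
  · refine Filter.Eventually.of_forall fun x' => ?_
    simp [JumpGaussMarkov.unnormTrans, h]
  · filter_upwards [h] with x' hx'
    simp [hx']

/-- For each `z'` the integrand is quadratic in `x'` with a Hessian that does not depend on `x`. Its
Gaussian mean is thus its value at the kernel mean plus a constant, and the log kernel itself is
constant at its mean. The last conclusion keeps the real integral for the recursion of the values.
-/
theorem exists_forwardRepresenter_succ (hG : q.IsGaussianAt t G)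
    {β : (Fin d → ℝ) → Fin M → ℝ} (hβ : ∀ z, IsConcaveQuadratic fun x => β x z) {z : Fin M}
    (h : ∀ z', q.fRev t z z' ≠ 0 → S.modeTrans t z' z ≠ 0 ∧
      ∀ᵐ x', forwardRepresenter S y q t x' z' = ENNReal.ofReal (Real.exp (β x' z'))) :
    ∃ β', IsExpQuadratic (fun x => forwardRepresenter S y q (t + 1) x z) β' ∧
      ∀ᵐ x, β' x = ∫ p, (S.stepLog y t G (q.fRev t) ((x, z), p) + β p.1 p.2)
        ∂q.stepKernel t (x, z) := by
  choose B hB hpos using hβ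
  choose B' hB' using S.exists_isQuadratic_stepLog y t G (q.fRev t) z
  choose K hK using fun z' => exists_integral_quadratic_mul_gaussianDensity
    ((B' z').compl₁₂ (LinearMap.inl ℝ _ _) (LinearMap.inl ℝ _ _) + B z') (G.noise_posDef t)
  have hquad : ∀ x z', IsQuadratic (fun x' => S.stepLog y t G (q.fRev t) ((x, z), (x', z')) +
      β x' z') ((B' z').compl₁₂ (LinearMap.inl ℝ _ _) (LinearMap.inl ℝ _ _) + B z') := by
    intro x z'
    refine IsQuadratic.add (((hB' z').comp_affine (LinearMap.inl ℝ _ _) (0, x)).congr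
      fun x' => ?_) (hB z')
    simp
  obtain ⟨Kt, hKt, hlet⟩ := G.exists_lintegral_kernel_sq_enorm_le t
  -- `c` is the log of the reverse kernel at its mean, the same for every `x`.
  let c : ℝ := Real.log (gaussianDensity 0 (G.noise t) 0)
  let avg : (Fin d → ℝ) × (Fin d → ℝ) → ℝ := fun p =>
    ∑ z', (q.fRev t z z').toReal * (β p.1 z' + S.logTrans y t p.1 z' p.2 z)
  let C : ℝ := ∑ z', (q.fRev t z z').toReal * (K z' - c - Real.log (q.fRev t z z').toReal)
  let step : (Fin d → ℝ) → (Fin d → ℝ) := fun x => (G.gain t).mulVec x + G.shift t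
  have havg : IsConcaveQuadratic avg := by
    exact isConcaveQuadratic_weighted_sum (PMF.toReal_mem_stdSimplex _).1
      (PMF.toReal_mem_stdSimplex (q.fRev t z)).2 (fun z' => ⟨B z', hB z', hpos z'⟩)
      fun z' => S.isTransitionQuadratic_logTrans y t z' z
  -- `avg` is strictly concave in both states jointly, and `x ↦ (step x, x)` is an injective affine
  -- map. The convex term `-log kernel` has been reduced to a constant and does no harm.
  have hquad' : IsConcaveQuadratic fun x => avg (step x, x) + C := by
    refine (((havg.comp_injective ((Matrix.toLin' (G.gain t)).prod LinearMap.id)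
      (fun a b hab => (Prod.ext_iff.mp hab).2) (G.shift t, 0)).congr fun x => ?_).add_const C)
    simp [step]
  have hint : ∀ x, (∀ᵐ x', q.gRev t x x' = ENNReal.ofReal (G.kernel t x x')) →
      Integrable (fun p => S.stepLog y t G (q.fRev t) ((x, z), p) + β p.1 p.2)
        (hiddenMeasure (q.gRev t x) (q.fRev t z)) ∧
      ∫ p, (S.stepLog y t G (q.fRev t) ((x, z), p) + β p.1 p.2)
        ∂hiddenMeasure (q.gRev t x) (q.fRev t z) = avg (step x, x) + C := by
    intro x hx
    have hm : Measurable (q.gRev t x) := by fun_prop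
    have h2 : ∫⁻ x', q.gRev t x x' * ‖x'‖ₑ ^ 2 ≠ ∞ := by
      rw [lintegral_congr_ae (g := fun x' => ENNReal.ofReal (G.kernel t x x') * ‖x'‖ₑ ^ 2)
        (by filter_upwards [hx] with x' hx'; rw [hx'])]
      exact ne_top_of_le_ne_top (by finiteness) (hlet x)
    refine ⟨integrable_hiddenMeasure hm (q.gRev_lintegral t x) h2 (PMF.sum_eq_one _)
      fun z' => ⟨_, hquad x z'⟩, ?_⟩
    rw [integral_hiddenMeasure hm (q.gRev_lintegral t x) h2 (PMF.sum_eq_one _)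
      fun z' => ⟨_, hquad x z'⟩]
    simp only [avg, C]
    rw [← Finset.sum_add_distrib]
    refine Finset.sum_congr rfl fun z' _ => ?_
    rw [← mul_add, integral_withDensity_gaussianDensity (G.noise_posDef t) hx,
      (hK z' _ _ (hquad x z')).2, JumpGaussMarkov.stepLog, GaussianChain.kernel,
      gaussianDensity_sub, sub_self]
    ring
  refine ⟨fun x => avg (step x, x) + C, ⟨hquad', ?_⟩, ?_⟩
  · filter_upwards [hG] with x hx
    obtain ⟨hi, hval⟩ := hint x hx
    rw [forwardRepresenter_succ, extIntegral_congr_ae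
      (G := fun p => ((S.stepLog y t G (q.fRev t) ((x, z), p) + β p.1 p.2 : ℝ) : EReal)),
      extIntegral_coe hi, hval, EReal.exp_coe]
    refine ae_factoredMeasure (by fun_prop) _ fun z' hz' => ?_
    obtain ⟨hS, hα⟩ := h z' hz'
    filter_upwards [hx, hα] with x' hx' hα' _
    rw [mul_comm, mul_div_assoc, S.unnormTrans_div y hz' hS hx', hα',
      ← ENNReal.ofReal_mul (Real.exp_pos _).le, ← Real.exp_add,
      ENNReal.log_ofReal_of_pos (Real.exp_pos _), Real.log_exp, add_comm]
  · filter_upwards [hG] with x hx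
    exact (hint x hx).2.symm

end Representer


/-! ### Recursion for the past objective. -/

section ForwardValue

variable {M d m : ℕ}

theorem ENNReal.log_mul_div_mul {a b c u : ℝ≥0∞} (hc : c ≠ 0) (hc' : c ≠ ∞) :
    ENNReal.log (a * u / (c * b)) = ENNReal.log (a / b) + ENNReal.log (u / c) := by
  rw [← ENNReal.log_mul_add, div_eq_mul_inv, div_eq_mul_inv, div_eq_mul_inv,
    ENNReal.mul_inv (Or.inl hc) (Or.inl hc')]
  congr 1
  ring

variable (S : JumpGaussMarkov M d m) (y : ℕ → Fin m → ℝ)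

theorem measurable_log_past (t : ℕ) (q : ReverseKernels M d) :
    Measurable fun p : (Fin (t + 1) → Fin d → ℝ) × (Fin (t + 1) → Fin M) =>
      ENNReal.log (S.unnormPath y t p.1 p.2 / (q.gCond t p.1 * q.fCond t p.2)) := by
  refine measurable_prod_of_finite fun z => Measurable.ennreal_log ?_
  have h1 := S.measurable_unnormPath y t z
  have h2 : Measurable fun x => q.gCond t x * q.fCond t z := by fun_prop
  exact h1.div h2

theorem pastObjective_eq (t : ℕ) (g : (Fin d → ℝ) → ℝ≥0∞) (f : Fin M → ℝ≥0∞)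
    (q : ReverseKernels M d) : pastObjective S y t g f q =
      extIntegral (q.chainMeasure t g f) fun p =>
        ENNReal.log (S.unnormPath y t p.1 p.2 / (q.gCond t p.1 * q.fCond t p.2)) := rfl

theorem pastObjective_congr {t : ℕ} (g : (Fin d → ℝ) → ℝ≥0∞) (f : Fin M → ℝ≥0∞)
    {q q' : ReverseKernels M d} (hg : ∀ s < t, q.gRev s = q'.gRev s)
    (hf : ∀ s < t, q.fRev s = q'.fRev s) :
    pastObjective S y t g f q = pastObjective S y t g f q' := by
  have h1 : q.gCond t = q'.gCond t := by
    funext x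
    exact Finset.prod_congr rfl fun i _ => by rw [hg i i.2]
  have h2 : q.fCond t = q'.fCond t := by
    funext x
    exact Finset.prod_congr rfl fun i _ => by rw [hf i i.2]
  unfold pastObjective
  rw [h1, h2]

theorem pastObjective_zero {g : (Fin d → ℝ) → ℝ≥0∞} (hg : Measurable g) (f : Fin M → ℝ≥0∞)
    (q : ReverseKernels M d) : pastObjective S y 0 g f q =
      extIntegral (hiddenMeasure g f) fun p => ENNReal.log (S.unnormInit y p.1 p.2) := by
  rw [pastObjective_eq]
  have h : ∀ F : (Fin d → ℝ) × Fin M → ℝ≥0∞, Measurable F →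
      ∫⁻ p, F (p.1 (Fin.last 0), p.2 (Fin.last 0)) ∂q.chainMeasure 0 g f =
        ∫⁻ p, F p ∂hiddenMeasure g f := fun F hF => q.lintegral_chainMeasure_last 0 hg f hF
  have hm : Measurable fun p : (Fin d → ℝ) × Fin M => ENNReal.log (S.unnormInit y p.1 p.2) := by
    have h1 := (measurable_log_past S y 0 q).comp (f := fun p : (Fin d → ℝ) × Fin M =>
      ((fun _ => p.1 : Fin 1 → Fin d → ℝ), (fun _ => p.2 : Fin 1 → Fin M))) (by fun_prop)
    simpa [Function.comp_def, JumpGaussMarkov.unnormPath, ReverseKernels.gCond,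
      ReverseKernels.fCond] using h1
  rw [← extIntegral_comp h hm]
  simp [JumpGaussMarkov.unnormPath, ReverseKernels.gCond, ReverseKernels.fCond]

/-- Only the kernels at step `t` must be Gaussian; the earlier ones are arbitrary and may make the
past term `-∞`. The step term is integrable, so adding it is harmless, and it can be cancelled when
optimal kernels are compared with competitors. -/
theorem pastObjective_succ {t : ℕ} {q : ReverseKernels M d} {G : GaussianChain d}
    (hG : q.IsGaussianAt t G) {g : (Fin d → ℝ) → ℝ≥0∞} (hg : Measurable g)
    (hg1 : ∫⁻ x, g x = 1) (hg2 : ∫⁻ x, g x * ‖x‖ₑ ^ 2 ≠ ∞) {f : Fin M → ℝ≥0∞}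
    (hf1 : ∑ z, f z = 1)
    (hS : ∀ z z', f z ≠ 0 → q.fRev t z z' ≠ 0 → S.modeTrans t z' z ≠ 0) :
    pastObjective S y (t + 1) g f q = pastObjective S y t (q.gStep t g) (q.fStep t f) q +
      ((∫ s, S.stepLog y t G (q.fRev t) s ∂q.stepMeasure t g f : ℝ) : EReal) := by
  have hmap := q.map_lastTwo_chainMeasure t f hg
  have hlast : AEMeasurable (ReverseKernels.lastTwo (M := M) (d := d) t)
      (q.chainMeasure (t + 1) g f) := (ReverseKernels.measurable_lastTwo t).aemeasurable
  have hint := q.integrable_stepMeasure hG hg hg1 hg2 hf1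
    (S.exists_isQuadratic_stepLog y t G (q.fRev t))
  have hstep := S.measurable_stepLog y t G (q.fRev t)
  have hae : ∀ᵐ s ∂q.stepMeasure t g f, q.fRev t s.1.2 s.2.2 ≠ 0 ∧
      S.modeTrans t s.2.2 s.1.2 ≠ 0 ∧
      q.gRev t s.1.1 s.2.1 = ENNReal.ofReal (G.kernel t s.1.1 s.2.1) := by
    refine ReverseKernels.ae_stepMeasure f hG hg ?_ fun z z' hz hz' x x' hx =>
      ⟨hz', hS z z' hz hz', hx⟩
    have h1 : MeasurableSet {s : ((Fin d → ℝ) × Fin M) × ((Fin d → ℝ) × Fin M) |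
        q.fRev t s.1.2 s.2.2 ≠ 0 ∧ S.modeTrans t s.2.2 s.1.2 ≠ 0} :=
      (Set.toFinite {r : Fin M × Fin M | q.fRev t r.1 r.2 ≠ 0 ∧
        S.modeTrans t r.2 r.1 ≠ 0}).measurableSet.preimage
        (f := fun s : ((Fin d → ℝ) × Fin M) × ((Fin d → ℝ) × Fin M) => (s.1.2, s.2.2))
        (by fun_prop)
    have h2 : MeasurableSet {s : ((Fin d → ℝ) × Fin M) × ((Fin d → ℝ) × Fin M) |
        q.gRev t s.1.1 s.2.1 = ENNReal.ofReal (G.kernel t s.1.1 s.2.1)} := by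
      refine measurableSet_eq_fun (by fun_prop) ?_
      exact ((G.continuous_kernel t).measurable.comp (g := Function.uncurry (G.kernel t))
        (f := fun s : ((Fin d → ℝ) × Fin M) × ((Fin d → ℝ) × Fin M) => (s.1.1, s.2.1))
        (by fun_prop)).ennreal_ofReal
    have h3 := h1.inter h2
    simpa only [Set.ofPred_and, Set.inter_assoc] using h3
  rw [← hmap] at hae
  have hae' := ae_of_ae_map hlast hae
  rw [pastObjective_eq, pastObjective_eq, ← extIntegral_comp
    (fun F hF => q.lintegral_chainMeasure_init t hg f hF) (measurable_log_past S y t q),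
    ← hmap, integral_map hlast hstep.aestronglyMeasurable, ← extIntegral_add_coe]
  · refine extIntegral_congr_ae ?_
    filter_upwards [hae'] with p hp
    obtain ⟨h1, h2, h3⟩ := hp
    rw [S.unnormPath_succ, q.gCond_succ, q.fCond_succ, mul_mul_mul_comm]
    simp only [ReverseKernels.lastTwo] at h1 h2 h3 ⊢
    rw [ENNReal.log_mul_div_mul, S.unnormTrans_div y h1 h2 h3,
      ENNReal.log_ofReal_of_pos (Real.exp_pos _), Real.log_exp]
    · rw [h3]
      exact mul_ne_zero (ENNReal.ofReal_pos.mpr (G.kernel_pos _ _ _)).ne' h1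
    · rw [h3]
      exact ENNReal.mul_ne_top ENNReal.ofReal_ne_top (PMF.apply_ne_top _ _)
  · exact (measurable_log_past S y t q).comp (f := fun p :
      (Fin (t + 2) → Fin d → ℝ) × (Fin (t + 2) → Fin M) => (Fin.init p.1, Fin.init p.2))
      (by fun_prop)
  · rw [← hmap] at hint
    exact hint.comp_aemeasurable hlast

end ForwardValue


/-! ### Dynamic programming: the posterior kernels attain the forward value. -/

section Maximality

variable {M d m : ℕ}

theorem EReal.le_of_add_coe_le_add_coe {a c : EReal} {b : ℝ}
    (h : a + (b : EReal) ≤ c + (b : EReal)) : a ≤ c := by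
  have := add_le_add_left h ((-b : ℝ) : EReal)
  rwa [← EReal.eq_add_coe_add_coe_neg, ← EReal.eq_add_coe_add_coe_neg] at this

variable (S : JumpGaussMarkov M d m) (y : ℕ → Fin m → ℝ)

/-- The added term is the entropy of the final law. It is finite and common to all members with that
final law, so optimality passes to the past objective at `T`. -/
theorem lowerBound_eq_pastObjective_add (T : ℕ) (π : FactoredDensity M d) {G : GaussianChain d}
    (hlast : ∀ᵐ x, π.gLast x = ENNReal.ofReal (gaussianDensity G.mean G.cov x)) :
    lowerBound S y T π = pastObjective S y T π.gLast (fun z => π.fLast z) π.toReverseKernels +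
      ((∫ p, (-Real.log (gaussianDensity G.mean G.cov p.1) - Real.log (π.fLast p.2).toReal)
        ∂hiddenMeasure π.gLast (fun z => π.fLast z) : ℝ) : EReal) := by
  have hg := π.gLast_measurable
  have hmap : (π.chainMeasure T π.gLast fun z => π.fLast z).map
      (fun p => (p.1 (Fin.last T), p.2 (Fin.last T))) =
      hiddenMeasure π.gLast (fun z => π.fLast z) := by
    refine Measure.ext_of_lintegral _ fun F hF => ?_
    rw [lintegral_map hF (by fun_prop)]
    exact π.lintegral_chainMeasure_last T hg _ hF
  have hm : AEMeasurable (fun p : (Fin (T + 1) → Fin d → ℝ) × (Fin (T + 1) → Fin M) =>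
      (p.1 (Fin.last T), p.2 (Fin.last T))) (π.chainMeasure T π.gLast fun z => π.fLast z) :=
    Measurable.aemeasurable (by fun_prop)
  have h2 : ∫⁻ x, π.gLast x * ‖x‖ₑ ^ 2 ≠ ∞ := by
    rw [lintegral_congr_ae (g := fun x =>
      ENNReal.ofReal (gaussianDensity G.mean G.cov x) * ‖x‖ₑ ^ 2)
      (by filter_upwards [hlast] with x hx; rw [hx])]
    exact G.lintegral_last_sq_enorm_ne_top
  obtain ⟨B, hB, -⟩ := isConcaveQuadratic_log_gaussianDensity G.mean G.cov_posDef
  have hint : Integrable (fun p : (Fin d → ℝ) × Fin M =>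
      -Real.log (gaussianDensity G.mean G.cov p.1) - Real.log (π.fLast p.2).toReal)
      (hiddenMeasure π.gLast (fun z => π.fLast z)) := by
    refine integrable_hiddenMeasure hg π.gLast_lintegral h2 (PMF.sum_eq_one _) fun z =>
      ⟨_, ((hB.const_mul (-1)).add_const (-Real.log (π.fLast z).toReal)).congr fun x => ?_⟩
    ring
  have hae : ∀ᵐ p ∂hiddenMeasure π.gLast (fun z => π.fLast z), π.fLast p.2 ≠ 0 ∧
      π.gLast p.1 = ENNReal.ofReal (gaussianDensity G.mean G.cov p.1) :=
    ae_factoredMeasure hg _ fun z hz => hlast.mono fun x hx _ => ⟨hz, hx⟩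
  rw [← hmap] at hae hint ⊢
  rw [pastObjective_eq, integral_map hm hint.aestronglyMeasurable]
  refine Eq.trans (extIntegral_congr_ae ?_) (extIntegral_add_coe
    (measurable_log_past S y T π.toReverseKernels) (hint.comp_aemeasurable hm))
  filter_upwards [ae_of_ae_map hm hae] with p hp
  obtain ⟨h1, h3⟩ := hp
  have hN := gaussianDensity_pos G.mean G.cov_posDef (p.1 (Fin.last T))
  have hf : 0 < (π.fLast (p.2 (Fin.last T))).toReal :=
    ENNReal.toReal_pos h1 (PMF.apply_ne_top _ _)
  have hc : π.gLast (p.1 (Fin.last T)) * π.fLast (p.2 (Fin.last T)) =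
      ENNReal.ofReal (gaussianDensity G.mean G.cov (p.1 (Fin.last T)) *
        (π.fLast (p.2 (Fin.last T))).toReal) := by
    rw [h3, ENNReal.ofReal_mul hN.le, ENNReal.ofReal_toReal (PMF.apply_ne_top _ _)]
  rw [FactoredDensity.gPath, FactoredDensity.fPath, mul_mul_mul_comm,
    ← mul_one (S.unnormPath y T p.1 p.2), hc, ENNReal.log_mul_div_mul
    (ENNReal.ofReal_pos.mpr (mul_pos hN hf)).ne' ENNReal.ofReal_ne_top, mul_one,
    ← ENNReal.ofReal_one, ← ENNReal.ofReal_div_of_pos (mul_pos hN hf),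
    ENNReal.log_ofReal_of_pos (by positivity), Real.log_div one_ne_zero (mul_pos hN hf).ne',
    Real.log_one, Real.log_mul hN.ne' hf.ne']
  congr 2
  ring

/-- The reverse-time kernels `q'`, with those of `q` at step `t`. -/
def ReverseKernels.replaceStep (q' q : ReverseKernels M d) (t : ℕ) : ReverseKernels M d where
  fRev s := if s = t then q.fRev s else q'.fRev s
  gRev s := if s = t then q.gRev s else q'.gRev s
  gRev_measurable s := by
    split_ifs
    exacts [q.gRev_measurable s, q'.gRev_measurable s]
  gRev_lintegral s x := by
    split_ifs
    exacts [q.gRev_lintegral s x, q'.gRev_lintegral s x]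

namespace ReverseKernels

variable (q' q : ReverseKernels M d) (t : ℕ)

theorem replaceStep_fRev : (q'.replaceStep q t).fRev t = q.fRev t := if_pos rfl

theorem replaceStep_gRev : (q'.replaceStep q t).gRev t = q.gRev t := if_pos rfl

theorem replaceStep_fRev_of_ne {s : ℕ} (h : s ≠ t) : (q'.replaceStep q t).fRev s = q'.fRev s :=
  if_neg h

theorem replaceStep_gRev_of_ne {s : ℕ} (h : s ≠ t) : (q'.replaceStep q t).gRev s = q'.gRev s :=
  if_neg h

variable {q' q t} in
theorem gStep_congr (h : q'.gRev t = q.gRev t) (g : (Fin d → ℝ) → ℝ≥0∞) :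
    q'.gStep t g = q.gStep t g := by
  unfold gStep
  rw [h]

variable {q' q t} in
theorem fStep_congr (h : q'.fRev t = q.fRev t) (f : Fin M → ℝ≥0∞) :
    q'.fStep t f = q.fStep t f := by
  unfold fStep
  rw [h]

end ReverseKernels

variable {S y} {T : ℕ} {π : FactoredDensity M d} {G : GaussianChain d}

theorem pastObjective_gMarg_succ (hS : π.SupportPossible S T)
    (hlast : ∀ᵐ x, π.gLast x = ENNReal.ofReal (gaussianDensity G.mean G.cov x))
    (hrev : ∀ s < T, π.IsGaussianAt s G) {t : ℕ} (ht : t < T) {q : ReverseKernels M d}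
    (hg : q.gRev t = π.gRev t) (hf : q.fRev t = π.fRev t) :
    pastObjective S y (t + 1) (π.gMarg T (t + 1)) (π.fMarg T (t + 1)) q =
      pastObjective S y t (π.gMarg T t) (π.fMarg T t) q +
      ((∫ s, S.stepLog y t G (π.fRev t) s
        ∂π.stepMeasure t (π.gMarg T (t + 1)) (π.fMarg T (t + 1)) : ℝ) : EReal) := by
  have hG : q.IsGaussianAt t G := by
    have := hrev t ht
    unfold ReverseKernels.IsGaussianAt at this ⊢
    rwa [hg]
  rw [pastObjective_succ S y hG (π.measurable_gMarg ht) (π.lintegral_gMarg ht)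
    (π.lintegral_gMarg_sq_enorm_ne_top hlast hrev ht) (π.sum_fMarg ht)
    (fun z z' hz hz' => hS.modeTrans_ne_zero ht hz (by rwa [hf] at hz')),
    ReverseKernels.gStep_congr hg, ReverseKernels.fStep_congr hf, ← π.gMarg_of_lt ht,
    ← π.fMarg_of_lt ht, hf, ReverseKernels.stepMeasure, ReverseKernels.stepKernel_congr hg hf,
    ReverseKernels.stepMeasure]

/-- Bellman's principle by descending induction. A competitor up to `t` is prolonged by the
posterior's own kernels at step `t`; the finite step term is then the same on both sides and
cancels. -/
theorem IsVariationalPosterior.pastObjective_le (h : IsVariationalPosterior S y T π)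
    (hlast : ∀ᵐ x, π.gLast x = ENNReal.ofReal (gaussianDensity G.mean G.cov x))
    (hrev : ∀ s < T, π.IsGaussianAt s G) {t : ℕ} (ht : t ≤ T) (q : ReverseKernels M d) :
    pastObjective S y t (π.gMarg T t) (π.fMarg T t) q ≤
      pastObjective S y t (π.gMarg T t) (π.fMarg T t) π.toReverseKernels := by
  induction ht using Nat.decreasingInduction generalizing q with
  | self =>
    rw [π.gMarg_self, π.fMarg_self]
    let π' : FactoredDensity M d :=
      { q with
        fLast := π.fLast
        gLast := π.gLast
        gLast_measurable := π.gLast_measurable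
        gLast_lintegral := π.gLast_lintegral }
    have h1 := h π'
    rw [lowerBound_eq_pastObjective_add S y T π hlast,
      lowerBound_eq_pastObjective_add S y T π' (G := G) hlast] at h1
    exact EReal.le_of_add_coe_le_add_coe h1
  | of_succ t ht ih =>
    have h1 := ih (q.replaceStep π.toReverseKernels t)
    rw [pastObjective_gMarg_succ h.supportPossible hlast hrev ht rfl rfl,
      pastObjective_gMarg_succ h.supportPossible hlast hrev ht
      (q.replaceStep_gRev _ t) (q.replaceStep_fRev _ t)] at h1
    have h2 := EReal.le_of_add_coe_le_add_coe h1
    rwa [pastObjective_congr S y _ _ (fun s hs => q.replaceStep_gRev_of_ne _ t hs.ne)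
      (fun s hs => q.replaceStep_fRev_of_ne _ t hs.ne)] at h2

theorem extIntegral_log_eq {g : (Fin d → ℝ) → ℝ≥0∞} (hg : Measurable g)
    (hg1 : ∫⁻ x, g x = 1) (hg2 : ∫⁻ x, g x * ‖x‖ₑ ^ 2 ≠ ∞) {f : Fin M → ℝ≥0∞}
    (hf1 : ∑ z, f z = 1) {α : (Fin d → ℝ) → Fin M → ℝ≥0∞} {β : (Fin d → ℝ) → Fin M → ℝ}
    (hβ : ∀ z, IsConcaveQuadratic fun x => β x z)
    (h : ∀ z, f z ≠ 0 → ∀ᵐ x, α x z = ENNReal.ofReal (Real.exp (β x z))) :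
    extIntegral (hiddenMeasure g f) (fun p => ENNReal.log (α p.1 p.2)) =
      ((∫ p, β p.1 p.2 ∂hiddenMeasure g f : ℝ) : EReal) := by
  rw [← extIntegral_coe (integrable_hiddenMeasure hg hg1 hg2 hf1 fun z =>
    ⟨_, (hβ z).choose_spec.1⟩)]
  refine extIntegral_congr_ae (ae_factoredMeasure hg f fun z hz => ?_)
  filter_upwards [h z hz] with x hx _
  rw [hx, ENNReal.log_ofReal_of_pos (Real.exp_pos _), Real.log_exp]

/-- The forward representer is, mode by mode, zero or the exponential of a strictly concave
quadratic function, and its logarithm integrates to the past objective. -/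
theorem exists_forwardRepresenter_eq (hS : π.SupportPossible S T)
    (hlast : ∀ᵐ x, π.gLast x = ENNReal.ofReal (gaussianDensity G.mean G.cov x))
    (hrev : ∀ s < T, π.IsGaussianAt s G) {t : ℕ} (ht : t ≤ T) :
    ∃ β : (Fin d → ℝ) → Fin M → ℝ, (∀ z, IsConcaveQuadratic fun x => β x z) ∧
      (∀ z, (∀ᵐ x, forwardRepresenter S y π.toReverseKernels t x z = 0) ∨
        ∀ᵐ x, forwardRepresenter S y π.toReverseKernels t x z =
          ENNReal.ofReal (Real.exp (β x z))) ∧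
      (∀ z, π.fMarg T t z ≠ 0 → ∀ᵐ x, forwardRepresenter S y π.toReverseKernels t x z =
        ENNReal.ofReal (Real.exp (β x z))) ∧
      pastObjective S y t (π.gMarg T t) (π.fMarg T t) π.toReverseKernels =
        ((∫ p, β p.1 p.2 ∂hiddenMeasure (π.gMarg T t) (π.fMarg T t) : ℝ) : EReal) := by
  have hmom := fun {t : ℕ} (ht : t ≤ T) => π.lintegral_gMarg_sq_enorm_ne_top hlast hrev ht
  induction t with
  | zero =>
    have h0 : ∀ z, S.modeInit z ≠ 0 → ∀ᵐ x, forwardRepresenter S y π.toReverseKernels 0 x z =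
        ENNReal.ofReal (Real.exp (S.logInit y x z)) := fun z hz =>
      Filter.Eventually.of_forall fun x => S.unnormInit_eq_exp y x hz
    have h1 : ∀ z, π.fMarg T 0 z ≠ 0 → ∀ᵐ x, forwardRepresenter S y π.toReverseKernels 0 x z =
        ENNReal.ofReal (Real.exp (S.logInit y x z)) := fun z hz => h0 z (hS.modeInit_ne_zero hz)
    refine ⟨S.logInit y, S.isConcaveQuadratic_logInit y, fun z => ?_, h1, ?_⟩
    · by_cases hz : S.modeInit z = 0
      · refine Or.inl (Filter.Eventually.of_forall fun x => ?_)
        simp [forwardRepresenter, JumpGaussMarkov.unnormInit, hz]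
      · exact Or.inr (h0 z hz)
    · rw [pastObjective_zero S y (π.measurable_gMarg ht), ← extIntegral_log_eq
        (π.measurable_gMarg ht) (π.lintegral_gMarg ht) (hmom ht) (π.sum_fMarg ht)
        (S.isConcaveQuadratic_logInit y) h1]
      rfl
  | succ t ih =>
    have ht' : t < T := ht
    obtain ⟨β, hβ, hdich, hcharged, hval⟩ := ih ht'.le
    -- The representer is needed at all modes, also those not charged by `π`, whose reverse kernels
    -- are arbitrary. `Good` singles out the modes at which the log-expectation is finite.
    let Good : Fin M → Prop := fun z => ∀ z', π.fRev t z z' ≠ 0 → S.modeTrans t z' z ≠ 0 ∧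
      ∀ᵐ x', forwardRepresenter S y π.toReverseKernels t x' z' =
        ENNReal.ofReal (Real.exp (β x' z'))
    have hgood : ∀ z, π.fMarg T (t + 1) z ≠ 0 → Good z := fun z hz z' hz' =>
      ⟨hS.modeTrans_ne_zero ht' hz hz', hcharged z' (π.fMarg_ne_zero ht' hz hz')⟩
    have hex : ∀ z, ∃ β' : (Fin d → ℝ) → ℝ, IsConcaveQuadratic β' ∧ (Good z →
        (∀ᵐ x, forwardRepresenter S y π.toReverseKernels (t + 1) x z =
          ENNReal.ofReal (Real.exp (β' x))) ∧
        ∀ᵐ x, β' x = ∫ p, (S.stepLog y t G (π.fRev t) ((x, z), p) + β p.1 p.2)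
          ∂π.stepKernel t (x, z)) := by
      intro z
      by_cases hz : Good z
      · obtain ⟨β', ⟨h1, h2⟩, h3⟩ := exists_forwardRepresenter_succ S y (hrev t ht') hβ hz
        exact ⟨β', h1, fun _ => ⟨h2, h3⟩⟩
      -- At bad modes any strictly concave quadratic serves as a filler, since the representer
      -- vanishes there.
      · exact ⟨_, S.isConcaveQuadratic_logInit y z, fun h => absurd h hz⟩
    choose β' hβ' hβ'good using hex
    have hbad : ∀ z, ¬ Good z →
        ∀ x, forwardRepresenter S y π.toReverseKernels (t + 1) x z = 0 := by
      intro z hz x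
      simp only [Good] at hz
      push Not at hz
      obtain ⟨z', hz', h⟩ := hz
      refine forwardRepresenter_succ_eq_zero S y hz' ?_ x
      by_cases h0 : S.modeTrans t z' z = 0
      · exact Or.inl h0
      · exact Or.inr ((hdich z').resolve_right (Filter.not_eventually.mpr (h h0)))
    refine ⟨fun x z => β' z x, hβ', fun z => ?_, fun z hz => (hβ'good z (hgood z hz)).1, ?_⟩
    · by_cases hz : Good z
      · exact Or.inr (hβ'good z hz).1
      · exact Or.inl (Filter.Eventually.of_forall (hbad z hz))
    have hm := π.measurable_gMarg ht
    have hm1 := π.lintegral_gMarg ht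
    have hf1 := π.sum_fMarg ht
    have hint1 := π.integrable_stepMeasure (hrev t ht') hm hm1 (hmom ht) hf1
      (S.exists_isQuadratic_stepLog y t G (π.fRev t))
    have hint2 := π.integrable_stepMeasure (hrev t ht') hm hm1 (hmom ht) hf1
      (Ψ := fun s => β s.2.1 s.2.2) fun z z' => by
        obtain ⟨B, hB, -⟩ := hβ z'
        exact ⟨_, (hB.comp_affine (LinearMap.fst ℝ (Fin d → ℝ) (Fin d → ℝ)) 0).congr
          fun v => by simp⟩
    have hsnd : ∫ s, β s.2.1 s.2.2 ∂π.stepMeasure t (π.gMarg T (t + 1)) (π.fMarg T (t + 1)) =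
        ∫ p, β p.1 p.2 ∂hiddenMeasure (π.gMarg T t) (π.fMarg T t) := by
      have hβm : Measurable fun p : (Fin d → ℝ) × Fin M => β p.1 p.2 :=
        measurable_prod_of_finite fun z => (hβ z).choose_spec.1.continuous.measurable
      rw [π.gMarg_of_lt ht', π.fMarg_of_lt ht', ← π.map_snd_stepMeasure t _ hm,
        integral_map measurable_snd.aemeasurable hβm.aestronglyMeasurable]
    rw [pastObjective_gMarg_succ hS hlast hrev ht' rfl rfl, hval, ← EReal.coe_add,
      EReal.coe_eq_coe_iff, ← hsnd, add_comm, ← integral_add hint1 hint2]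
    have hsum := hint1.add hint2
    rw [ReverseKernels.stepMeasure] at hsum ⊢
    -- Integrating over the earlier state first gives the new exponent `β'`, so the value recursion
    -- matches that of the representer.
    refine (Measure.integral_compProd hsum).trans (integral_congr_ae ?_)
    refine ae_factoredMeasure hm _ fun z hz => ?_
    filter_upwards [(hβ'good z (hgood z hz)).2] with x hx _
    exact hx.symm

end Maximality

end


/-- A function that is, mode by mode, zero or the exponential of a strictly concave quadratic
function is proportional to a mixture of Gaussian densities. -/
theorem exists_log_eq_gaussian_mixture {M d : ℕ} {α : (Fin d → ℝ) → Fin M → ℝ≥0∞}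
    {β : (Fin d → ℝ) → Fin M → ℝ} (hβ : ∀ z, IsConcaveQuadratic fun x => β x z)
    (h : ∀ z, (∀ᵐ x, α x z = 0) ∨ ∀ᵐ x, α x z = ENNReal.ofReal (Real.exp (β x z)))
    {z₀ : Fin M} (hz₀ : ∀ᵐ x, α x z₀ = ENNReal.ofReal (Real.exp (β x z₀))) :
    ∃ (κ : ℝ) (fStar : PMF (Fin M)) (μStar : Fin M → Fin d → ℝ)
      (covStar : Fin M → Matrix (Fin d) (Fin d) ℝ), 0 < κ ∧ (∀ z, (covStar z).PosDef) ∧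
      ∀ᵐ x, ∀ z, ENNReal.log (α x z) = (Real.log κ : EReal) + ENNReal.log (fStar z) +
        (Real.log (gaussianDensity (μStar z) (covStar z) x) : EReal) := by
  classical
  choose μ C c hC hβc using fun z => (hβ z).exists_eq_log_gaussianDensity
  -- Unnormalized mixture weights: the total mass of `α (·, z)`, which is zero at dead modes. Their
  -- sum is `κ`, positive because `z₀` is alive.
  let K : Fin M → ℝ := fun z =>
    if ∀ᵐ x, α x z = ENNReal.ofReal (Real.exp (β x z)) then Real.exp (c z) else 0
  have hK : ∀ z, 0 ≤ K z := by
    intro z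
    simp only [K]
    split_ifs
    · exact (Real.exp_pos _).le
    · exact le_rfl
  have hκ : 0 < ∑ z, K z := by
    refine Finset.sum_pos' (fun z _ => hK z) ⟨z₀, Finset.mem_univ _, ?_⟩
    simp only [K, if_pos hz₀]
    exact Real.exp_pos _
  obtain ⟨P, hP⟩ := exists_pmf_toReal_eq (p := fun z => K z / ∑ z, K z)
    ⟨fun z => div_nonneg (hK z) hκ.le, by rw [← Finset.sum_div, div_self hκ.ne']⟩
  have hP' : ∀ z, P z = ENNReal.ofReal (K z / ∑ z, K z) := fun z => by
    rw [← hP, ENNReal.ofReal_toReal (PMF.apply_ne_top _ _)]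
  refine ⟨∑ z, K z, P, μ, C, hκ, hC, ae_all_iff.mpr fun z => ?_⟩
  by_cases hz : ∀ᵐ x, α x z = ENNReal.ofReal (Real.exp (β x z))
  · have hKz : K z = Real.exp (c z) := if_pos hz
    filter_upwards [hz] with x hx
    rw [hx, hP', hKz, ENNReal.log_ofReal_of_pos (Real.exp_pos _), Real.log_exp,
      ENNReal.log_ofReal_of_pos (div_pos (Real.exp_pos _) hκ),
      Real.log_div (Real.exp_pos _).ne' hκ.ne', Real.log_exp, hβc, ← EReal.coe_add,
      ← EReal.coe_add, EReal.coe_eq_coe_iff]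
    ring
  · have hKz : K z = 0 := if_neg hz
    filter_upwards [(h z).resolve_right hz] with x hx
    rw [hx, hP', hKz, zero_div, ENNReal.ofReal_zero, ENNReal.log_zero, EReal.add_bot,
      EReal.bot_add]

theorem mainTheorem8 (M d m T : ℕ) (S : JumpGaussMarkov M d m) (y : ℕ → Fin m → ℝ) :
    (∃ π : FactoredDensity M d, IsVariationalPosterior S y T π) ∧
    ∀ π : FactoredDensity M d, IsVariationalPosterior S y T π →
      (∀ t ≤ T,
        (∃ (κ : ℝ) (fStar : PMF (Fin M)) (μStar : Fin M → Fin d → ℝ)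
            (covStar : Fin M → Matrix (Fin d) (Fin d) ℝ),
          0 < κ ∧ (∀ z, (covStar z).PosDef) ∧
          ∀ᵐ x : Fin d → ℝ, ∀ z : Fin M,
            ENNReal.log (forwardRepresenter S y π.toReverseKernels t x z) =
              (Real.log κ : EReal) + ENNReal.log (fStar z) +
                (Real.log (gaussianDensity (μStar z) (covStar z) x) : EReal)) ∧
        IsForwardValue S y t (π.gMarg T t) (π.fMarg T t)
          (extIntegral (hiddenMeasure (π.gMarg T t) (π.fMarg T t)) fun p =>
            ENNReal.log (forwardRepresenter S y π.toReverseKernels t p.1 p.2))) ∧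
      IsGaussMarkov T (π.gPath T) := by

  refine ⟨exists_isVariationalPosterior T S y, fun π hπ => ?_⟩
  obtain ⟨G, hG⟩ := hπ.exists_gaussianChain
  obtain ⟨hlast, hrev⟩ := π.ae_eq_of_gPath_ae_eq T G hG
  have hS := hπ.supportPossible
  refine ⟨fun t ht => ?_, G.isGaussMarkov hG⟩
  obtain ⟨β, hβ, hdich, hcharged, hval⟩ := exists_forwardRepresenter_eq (y := y) hS hlast hrev ht
  have hf1 := π.sum_fMarg ht
  constructor
  -- The marginal has mass one and so charges some mode, at which the representer is not zero.
  · obtain ⟨z₀, -, hz₀⟩ := Finset.exists_ne_zero_of_sum_ne_zero (hf1.trans_ne one_ne_zero)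
    exact exists_log_eq_gaussian_mixture hβ hdich (hcharged z₀ hz₀)
  · rw [extIntegral_log_eq (π.measurable_gMarg ht) (π.lintegral_gMarg ht)
      (π.lintegral_gMarg_sq_enorm_ne_top hlast hrev ht) hf1 hβ hcharged, ← hval]
    refine ⟨⟨π.toReverseKernels, rfl⟩, ?_⟩
    rintro _ ⟨q, rfl⟩
    exact hπ.pastObjective_le hlast hrev ht q
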